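/- **Theorem (asymptotic normality, repeated cross-sections).** *Population.* Let $Y_t(\delta),Y_{t-1}(\delta)$ be potential outcomes at dose $\delta$, $Y_t,Y_{t-1}$ realized outcomes, $D$ a dose, $X$ covariates and $T\in\{0,1\}$ a period indicator. Put $Y=(1-T)Y_{t-1}+TY_t$, $Z=(Y,T,D,X)$, $\lambda_0=P(T=1)\in(0,1)$ and $Y^\lambda=\frac{T-\lambda_0}{\lambda_0(1-\lambda_0)}Y$. Let $\mathcal D=(d_L,d_H)$ and $d\in\mathcal D$. Conditional expectations $E[\,\cdot\mid D=s]$ are taken with respect to a regular conditional probability given $D$ that is concentrated on $\{D=s\}$. The means of $Y_t(s),Y_t(0),Y_{t-1}(0)$ given $D=s$ exist for $s\in[d_L,d_H]$, and for the chosen versions $s\mapsto E[Y_t-Y_{t-1}\mid D=s]$ and $s\mapsto P(X\in A\mid D=s)$ ($A$ measurable) are continuous on $\mathcal D$. The target is $ATT(d)=E[Y_t(d)-Y_t(0)\mid D=d]$. Assume the following. 1. *(Sampling)* $(D,X)$ is independent of $T$; given $T=0$, $(Y,D,X)$ has the law of $(Y_{t-1},D,X)$; given $T=1$, it has the law of $(Y_t,D,X)$.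 The sample $Z_1,Z_2,\dots$ is i.i.d. with the law of $Z$. 2. *(Support)* $0<d_L<d_H<\infty$; the support of $D$ is $\{0\}\cup[d_L,d_H]$; the law of $D$ is the sum of a point mass at $0$ and a measure with density $f_D$ on $[d_L,d_H]$, and likewise given $X=x$ with density $f_{D|X}(\cdot|x)$. With $g_0(X)=P(D=0|X)$ there is $0<\kappa<\frac12$ such that a.s. $\kappa<g_0(X)<1-\kappa$ and $f_{D|X}(s|X)>\kappa$ for all $s\in[d_L,d_H]$. 3. *(No anticipation)* $Y_t=Y_t(D)$ and $Y_{t-1}=Y_{t-1}(0)$. 4. *(Conditional parallel trends)* $E[Y_t(0)-Y_{t-1}(0)|X,D=s]=E[Y_t(0)-Y_{t-1}(0)|X,D=0]$ for all $s\in[d_L,d_H]$. 5. *(Kernel)* $K(\cdot)$ is bounded and differentiable, $K$ and $u^2K(u)$ are integrable, $\int K=1$, $\int uK(u)\,du=0$, $\int u^2K(u)\,du>0$, and $K(u)=O(|u|^{-3})$ as $u\to-\infty$. Put $K_h(u)=h^{-1}K(u/h)$. 6. *(Bounds and smoothness)* Let $f^0_h(s|X)=E[K_h(D-s)|X]$ and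 $\mathcal E^0_{\lambda Y}(X)=E[Y^\lambda|X,D=0]$. There are $c>0$ and $0<C<\infty$ with $\sup_{\mathcal D}f_D>c$, and a.s. $|Y|<C$ and $|\mathcal E^0_{\lambda Y}(X)|<C$; for all large $N$, with $h=h_N$, a.s. $c<f_h^0(s|X)<C$ for all $s\in\mathcal D$. The functions $f_D$ and (for a.e. $x$) $f_{D|X}(\cdot|x)$ are $C^2$ on $\mathcal D$ with uniformly bounded second derivatives. $(Y^\lambda,D)$ has on $\mathbb R\times\mathcal D$ a joint density $f_{Y^\lambda,D}(y,s)$ that, for each $y$ in the support of $Y^\lambda$, is $C^2$ in $s\in\mathcal D$, with $\partial_s^2f_{Y^\lambda,D}$ bounded uniformly in $(y,s)$. *Estimator.* Fix $K\ge2$ and let $N=Kn$, $n\to\infty$. Let $\{I_k\}_{k\le K}$ be a partition of $\{1,\dots,N\}$ into folds of size $n$ and $I_k^c$ the complement of $I_k$. Let $\hat\lambda_k$ and $\hat f_k(d)$ be the means over $i\in I_k^c$ of $T_i$ and $K_h(D_i-d)$, and let $\hat f_{h,k}(d|\cdot),\hat g_k,\hat{\mathcal E}_{\lambda Y,k}$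 be (jointly measurable) estimators built from the data in $I_k^c$. Define $$\widehat{ATT}(d)=\frac1K\sum_{k=1}^K\frac1n\sum_{i\in I_k}\frac{K_h(D_i-d)\hat g_k(X_i)-\mathbf 1\{D_i=0\}\hat f_{h,k}(d|X_i)}{\hat f_k(d)\hat g_k(X_i)}\Big(\frac{T_i-\hat\lambda_k}{\hat\lambda_k(1-\hat\lambda_k)}Y_i-\hat{\mathcal E}_{\lambda Y,k}(X_i)\Big).$$ 7. *(Rates)* $h=h_N>0$, $h\to0$, $Nh\to\infty$, $\sqrt{Nh^5}\to0$; $\varepsilon_N\to0$, $h^{-1}\varepsilon_N^2\to0$ and $\varepsilon_N=o(N^{-1/4})$. For each $k$, with probability tending to one: $\|\hat f_{h,k}(d|X)-f_h^0(d|X)\|_{P,2}\le h^{-1/2}\varepsilon_N$, $\|\hat g_k(X)-g_0(X)\|_{P,2}\le\varepsilon_N$, $\|\hat{\mathcal E}_{\lambda Y,k}(X)-\mathcal E^0_{\lambda Y}(X)\|_{P,2}\le\varepsilon_N$, $\kappa<\hat g_k(X)<1-\kappa$ and $c<\hat f_{h,k}(d|X)<C$ a.s., and $\|\hat{\mathcal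 E}_{\lambda Y,k}(X)\|_{P,\infty}<C$. *Variance.* Let $$\theta_{0h}(d)=E\Big[Y^\lambda\,\frac{K_h(D-d)g_0(X)-\mathbf 1\{D=0\}f_h^0(d|X)}{f_D(d)g_0(X)}\Big],$$ $$\psi_h^{(2)}=\frac{K_h(D-d)g_0(X)-\mathbf 1\{D=0\}f^0_h(d|X)}{f_D(d)g_0(X)}\big(Y^\lambda-\mathcal E^0_{\lambda Y}(X)\big)-\theta_{0h}(d),$$ $$\sigma_N^2(d)=E\Big[\Big(\psi_h^{(2)}-\frac{\theta_{0h}(d)}{f_D(d)}\big(K_h(D-d)-E[K_h(D-d)]\big)\Big)^2\Big].$$ 8. *(Nondegeneracy)* $\liminf_N h\,\sigma_N^2(d)>0$. Then, as $N=Kn\to\infty$: $$\frac{\widehat{ATT}(d)-ATT(d)}{\sigma_N(d)/\sqrt N}\ \xrightarrow{\ d\ }\ N(0,1).$$ Moreover $\hat\lambda_k-\lambda_0=O_p(N^{-1/2})$ for each $k$, and if $\widetilde{ATT}(d)$ denotes $\widehat{ATT}(d)$ with every $\hat\lambda_k$ replaced by $\lambda_0$, then $\dfrac{\widehat{ATT}(d)-\widetilde{ATT}(d)}{\sigma_N(d)/\sqrt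 N}\to0$ in probability. -/

import Mathlib

open MeasureTheory ProbabilityTheory Filter Asymptotics Set Topology

noncomputable section

namespace CDiD

/-! ### Population -/

/-- The random variables of the two-period model on a probability space `Ω`: potential outcomes
`Y_t(δ)`, `Y_{t-1}(δ)` for every dose `δ`, realized outcomes `Y_t`, `Y_{t-1}`, dose `D`,
covariates `X` and the sampling-period indicator `T`. -/
structure Population (Ω 𝒳 : Type*) [MeasurableSpace Ω] [MeasurableSpace 𝒳] where
  potPost : ℝ → Ω → ℝ
  potPre : ℝ → Ω → ℝ
  Ypost : Ω → ℝ
  Ypre : Ω → ℝ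
  D : Ω → ℝ
  X : Ω → 𝒳
  T : Ω → ℝ
  measurable_potPost : ∀ δ, Measurable (potPost δ)
  measurable_potPre : ∀ δ, Measurable (potPre δ)
  measurable_Ypost : Measurable Ypost
  measurable_Ypre : Measurable Ypre
  measurable_D : Measurable D
  measurable_X : Measurable X
  measurable_T : Measurable T
  T_binary : ∀ ω, T ω = 0 ∨ T ω = 1

/-- One observation `(Y, T, D, X)` of the pooled sample. -/
abbrev Obs (𝒳 : Type*) := ℝ × ℝ × ℝ × 𝒳

namespace Obs

variable {𝒳 : Type*}

def y (z : Obs 𝒳) : ℝ := z.1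
def t (z : Obs 𝒳) : ℝ := z.2.1
def dose (z : Obs 𝒳) : ℝ := z.2.2.1
def cov (z : Obs 𝒳) : 𝒳 := z.2.2.2

end Obs

/-- The rescaled kernel `K_h(u) = h⁻¹ K(u / h)`. -/
def rescale (Ker : ℝ → ℝ) (h u : ℝ) : ℝ := h⁻¹ * Ker (u / h)

/-- The infinite-dimensional nuisance parameters at a dose `d`: `f = f_h(d | ·)`,
`g = P(D = 0 | X = ·)` and `e = 𝓔_{λY}`. -/
structure Nuisance (𝒳 : Type*) where
  f : 𝒳 → ℝ
  g : 𝒳 → ℝ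
  e : 𝒳 → ℝ

/-- The estimating function
`(K_h(D-d) g(X) - 1{D=0} f_h(d|X)) / (f_D g(X)) * ((T-λ)/(λ(1-λ)) Y - 𝓔(X))`. -/
def signal {𝒳 : Type*} (Ker : ℝ → ℝ) (h d lam fd : ℝ) (η : Nuisance 𝒳) (z : Obs 𝒳) : ℝ :=
  (rescale Ker h (z.dose - d) * η.g z.cov - ({0} : Set ℝ).indicator 1 z.dose * η.f z.cov)
      / (fd * η.g z.cov)
    * ((z.t - lam) / (lam * (1 - lam)) * z.y - η.e z.cov)

/-- The orthogonal score `ψ_h^{(2)}(Z, θ, λ, f_D, η)`. -/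
def score {𝒳 : Type*} (Ker : ℝ → ℝ) (h d θ lam fd : ℝ) (η : Nuisance 𝒳) (z : Obs 𝒳) : ℝ :=
  signal Ker h d lam fd η z - θ

namespace Population

variable {Ω 𝒳 : Type*} [MeasurableSpace Ω] [MeasurableSpace 𝒳]

/-- The pooled outcome `Y = (1 - T) Y_{t-1} + T Y_t`. -/
def Y (M : Population Ω 𝒳) (ω : Ω) : ℝ := (1 - M.T ω) * M.Ypre ω + M.T ω * M.Ypost ω

/-- The observable vector `Z = (Y, T, D, X)`. -/
def obs (M : Population Ω 𝒳) (ω : Ω) : Obs 𝒳 := (M.Y ω, M.T ω, M.D ω, M.X ω)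

/-- `λ = P(T = 1)`. -/
def lam (M : Population Ω 𝒳) (P : Measure Ω) : ℝ := P.real {ω | M.T ω = 1}

/-- `Y^λ = (T - λ) / (λ (1 - λ)) * Y`. -/
def Ylam (M : Population Ω 𝒳) (P : Measure Ω) (ω : Ω) : ℝ :=
  (M.T ω - M.lam P) / (M.lam P * (1 - M.lam P)) * M.Y ω

/-- The conditional law of the dose given `X = x`. -/
def doseGiven (M : Population Ω 𝒳) (P : Measure Ω) [IsFiniteMeasure P] (x : 𝒳) : Measure ℝ :=
  condDistrib M.D M.X P x

/-- `g_0(x) = P(D = 0 | X = x)`. -/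
def g0 (M : Population Ω 𝒳) (P : Measure Ω) [IsFiniteMeasure P] (x : 𝒳) : ℝ :=
  (M.doseGiven P x).real {0}

/-- `f_h^0(d | x) = E[K_h(D - d) | X = x]`. -/
def fh0 (M : Population Ω 𝒳) (P : Measure Ω) [IsFiniteMeasure P] (Ker : ℝ → ℝ) (h d : ℝ)
    (x : 𝒳) : ℝ :=
  ∫ s, rescale Ker h (s - d) ∂(M.doseGiven P x)

/-- `𝓔_{λY}^0(x) = E[Y^λ | X = x, D = 0]`. -/
def e0 (M : Population Ω 𝒳) (P : Measure Ω) (x : 𝒳) : ℝ :=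
  ∫ y, y ∂(condDistrib (M.Ylam P) M.X (cond P {ω | M.D ω = 0}) x)

/-- The true nuisance parameters `η_0(d)`. -/
def eta0 (M : Population Ω 𝒳) (P : Measure Ω) [IsFiniteMeasure P] (Ker : ℝ → ℝ) (h d : ℝ) :
    Nuisance 𝒳 where
  f := M.fh0 P Ker h d
  g := M.g0 P
  e := M.e0 P

/-- The smoothed parameter `ATT_h(d)`; `fd` is the value `f_D(d)`. -/
def ATTh (M : Population Ω 𝒳) (P : Measure Ω) [IsFiniteMeasure P] (Ker : ℝ → ℝ)
    (h d fd : ℝ) : ℝ :=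
  ∫ ω, M.Ylam P ω *
    ((rescale Ker h (M.D ω - d) * M.g0 P (M.X ω)
        - ({0} : Set ℝ).indicator 1 (M.D ω) * M.fh0 P Ker h d (M.X ω))
      / (fd * M.g0 P (M.X ω))) ∂P

/-- The asymptotic variance `σ²`:
`E[(ψ_h(Z, θ_{0h}, λ_0, f_D(d), η_0) - θ_{0h} / f_D(d) * (K_h(D-d) - E[K_h(D-d)]))²]`. -/
def sigmaSq (M : Population Ω 𝒳) (P : Measure Ω) [IsFiniteMeasure P] (Ker : ℝ → ℝ)
    (h d fd : ℝ) : ℝ :=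
  ∫ ω, (score Ker h d (M.ATTh P Ker h d fd) (M.lam P) fd (M.eta0 P Ker h d) (M.obs ω)
      - M.ATTh P Ker h d fd / fd *
        (rescale Ker h (M.D ω - d) - ∫ ω', rescale Ker h (M.D ω' - d) ∂P)) ^ 2 ∂P

/-! ### Conditioning on the dose, and the target parameter -/

/-- `Q s` is a (proper) regular version of the conditional probability `P( · | D = s)`. -/
structure IsCondProbGivenDose (M : Population Ω 𝒳) (P : Measure Ω) (Q : Kernel ℝ Ω)
    (dL dH : ℝ) : Prop where
  disintegration : (P.map M.D) ⊗ₘ Q = P.map (fun ω => (M.D ω, ω))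
  proper : ∀ s ∈ ({0} : Set ℝ) ∪ Icc dL dH, ∀ᵐ ω ∂(Q s), M.D ω = s

/-- The convention under which `E[ · | D = s]` has a meaning at each single dose `s`, an event of
probability zero: the means involved exist, and the versions of `E[Y_t - Y_{t-1} | D = s]` and of
`P(X ∈ A | D = s)` are the continuous ones on `(d_L, d_H)`. -/
structure ContinuousVersion (M : Population Ω 𝒳) (Q : Kernel ℝ Ω) (dL dH : ℝ) : Prop where
  integrable_treated : ∀ s ∈ Icc dL dH, Integrable (M.potPost s) (Q s)
  integrable_untreated : ∀ s ∈ Icc dL dH, Integrable (M.potPost 0) (Q s)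
  integrable_pre : ∀ s ∈ Icc dL dH, Integrable (M.potPre 0) (Q s)
  continuousOn_trend :
    ContinuousOn (fun s => ∫ ω, (M.Ypost ω - M.Ypre ω) ∂(Q s)) (Ioo dL dH)
  continuousOn_cov : ∀ A : Set 𝒳, MeasurableSet A →
    ContinuousOn (fun s => (Q s).real (M.X ⁻¹' A)) (Ioo dL dH)

/-- `ATT(d) = E[Y_t(d) - Y_t(0) | D = d]`. -/
def ATT (M : Population Ω 𝒳) (Q : Kernel ℝ Ω) (d : ℝ) : ℝ :=
  ∫ ω, (M.potPost d ω - M.potPost 0 ω) ∂(Q d)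

/-! ### Assumptions on the population -/

/-- Repeated cross-sections: `(D, X)` is independent of `T`, both periods are sampled, and the
sample of period `t - 1` (resp. `t`) has the law of `(Y_{t-1}, D, X)` (resp. `(Y_t, D, X)`). -/
structure RepeatedCrossSections (M : Population Ω 𝒳) (P : Measure Ω) : Prop where
  lam_pos : 0 < M.lam P
  lam_lt_one : M.lam P < 1
  indep : IndepFun (fun ω => (M.D ω, M.X ω)) M.T P
  law_pre : (cond P {ω | M.T ω = 0}).map (fun ω => (M.Y ω, M.D ω, M.X ω))
    = P.map (fun ω => (M.Ypre ω, M.D ω, M.X ω))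
  law_post : (cond P {ω | M.T ω = 1}).map (fun ω => (M.Y ω, M.D ω, M.X ω))
    = P.map (fun ω => (M.Ypost ω, M.D ω, M.X ω))

/-- No anticipation: `Y_t = Y_t(D)` and `Y_{t-1} = Y_{t-1}(0)`. -/
structure NoAnticipation (M : Population Ω 𝒳) : Prop where
  post : ∀ ω, M.Ypost ω = M.potPost (M.D ω) ω
  pre : ∀ ω, M.Ypre ω = M.potPre 0 ω

/-- Conditional parallel trends: for each `s ∈ [d_L, d_H]` the conditional expectations
`E[Y_t(0) - Y_{t-1}(0) | X, D = s]` and `E[Y_t(0) - Y_{t-1}(0) | X, D = 0]` are the same function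
of `X`. -/
def ParallelTrends (M : Population Ω 𝒳) (Q : Kernel ℝ Ω) (dL dH : ℝ) : Prop :=
  ∀ s ∈ Icc dL dH, ∃ m : 𝒳 → ℝ, Measurable m ∧
    (Q s)[fun ω => M.potPost 0 ω - M.potPre 0 ω | MeasurableSpace.comap M.X inferInstance]
      =ᵐ[Q s] (fun ω => m (M.X ω)) ∧
    (Q 0)[fun ω => M.potPost 0 ω - M.potPre 0 ω | MeasurableSpace.comap M.X inferInstance]
      =ᵐ[Q 0] (fun ω => m (M.X ω))

/-- `fD`, `fDX x` and `fYD` are the density of `D` on `[d_L, d_H]`, its conditional density given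
`X = x`, and the joint density of `(Y^λ, D)` on `ℝ × (d_L, d_H)`. -/
structure HasDensities (M : Population Ω 𝒳) (P : Measure Ω) [IsFiniteMeasure P] (dL dH : ℝ)
    (fD : ℝ → ℝ) (fDX : 𝒳 → ℝ → ℝ) (fYD : ℝ → ℝ → ℝ) : Prop where
  measurable_fD : Measurable fD
  measurable_fDX : Measurable (Function.uncurry fDX)
  measurable_fYD : Measurable (Function.uncurry fYD)
  fD_nonneg : ∀ s ∈ Icc dL dH, 0 ≤ fD s
  fDX_nonneg : ∀ x, ∀ s ∈ Icc dL dH, 0 ≤ fDX x s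
  fYD_nonneg : ∀ t, ∀ s ∈ Ioo dL dH, 0 ≤ fYD t s
  law_dose : P.map M.D = (P.map M.D {0}) • Measure.dirac 0
    + (volume.restrict (Icc dL dH)).withDensity (fun s => ENNReal.ofReal (fD s))
  law_doseGiven : ∀ᵐ x ∂(P.map M.X), M.doseGiven P x = (M.doseGiven P x {0}) • Measure.dirac 0
    + (volume.restrict (Icc dL dH)).withDensity (fun s => ENNReal.ofReal (fDX x s))
  law_joint : (P.map (fun ω => (M.Ylam P ω, M.D ω))).restrict (univ ×ˢ Ioo dL dH)
    = ((volume : Measure (ℝ × ℝ)).restrict (univ ×ˢ Ioo dL dH)).withDensity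
        (fun p => ENNReal.ofReal (fYD p.1 p.2))

/-- Support and strong overlap. -/
structure Support (M : Population Ω 𝒳) (P : Measure Ω) [IsFiniteMeasure P] (dL dH κ : ℝ)
    (fDX : 𝒳 → ℝ → ℝ) : Prop where
  dL_pos : 0 < dL
  dL_lt_dH : dL < dH
  support_dose : (P.map M.D).support = {0} ∪ Icc dL dH
  κ_pos : 0 < κ
  κ_lt_half : κ < 1 / 2
  overlap : ∀ᵐ x ∂(P.map M.X), κ < M.g0 P x ∧ M.g0 P x < 1 - κ ∧ ∀ s ∈ Icc dL dH, κ < fDX x s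

/-- Conditions on the kernel function. -/
structure KernelAssumption (Ker : ℝ → ℝ) : Prop where
  bounded : ∃ B, ∀ u, |Ker u| ≤ B
  differentiable : Differentiable ℝ Ker
  integrable : Integrable Ker
  integrable_sq : Integrable (fun u => u ^ 2 * Ker u)
  integral_eq_one : ∫ u, Ker u = 1
  first_moment : ∫ u, u * Ker u = 0
  second_moment_pos : 0 < ∫ u, u ^ 2 * Ker u
  /-- The control group, at distance `d > 0` to the left of the dose of interest, contributes
  `K_h(0 - d) = O(h²)`. -/
  tail : (fun u => u ^ 3 * Ker u) =O[atBot] (fun _ => (1 : ℝ))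

/-- Bounds and smoothness; `h n` is the bandwidth sequence. -/
structure BoundsSmoothness (M : Population Ω 𝒳) (P : Measure Ω) [IsFiniteMeasure P]
    (Ker : ℝ → ℝ) (h : ℕ → ℝ) (dL dH c C : ℝ)
    (fD : ℝ → ℝ) (fDX : 𝒳 → ℝ → ℝ) (fYD : ℝ → ℝ → ℝ) : Prop where
  c_pos : 0 < c
  C_pos : 0 < C
  fD_lower : ∃ s ∈ Ioo dL dH, c < fD s
  Y_bound : ∀ᵐ ω ∂P, |M.Y ω| < C
  fh0_bound : ∀ᶠ n in atTop, ∀ᵐ x ∂(P.map M.X), ∀ s ∈ Ioo dL dH,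
    c < M.fh0 P Ker (h n) s x ∧ M.fh0 P Ker (h n) s x < C
  e0_bound : ∀ᵐ x ∂(P.map M.X), |M.e0 P x| < C
  fD_C2 : ContDiffOn ℝ 2 fD (Ioo dL dH)
  fD_deriv : ∃ B, ∀ s ∈ Ioo dL dH, |iteratedDeriv 2 fD s| ≤ B
  fDX_C2 : ∀ᵐ x ∂(P.map M.X), ContDiffOn ℝ 2 (fDX x) (Ioo dL dH)
  fDX_deriv : ∃ B, ∀ᵐ x ∂(P.map M.X), ∀ s ∈ Ioo dL dH, |iteratedDeriv 2 (fDX x) s| ≤ B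
  fYD_C2 : ∀ t ∈ (P.map (M.Ylam P)).support, ContDiffOn ℝ 2 (fYD t) (Ioo dL dH)
  fYD_deriv : ∃ B, ∀ t ∈ (P.map (M.Ylam P)).support, ∀ s ∈ Ioo dL dH,
    |iteratedDeriv 2 (fYD t) s| ≤ B

end Population

/-! ### Sample, cross-fitting, and the estimator -/

/-- `fold n` splits the sample of size `N = K * n` into `K` folds of equal size `n`. -/
def IsEqualPartition {K : ℕ} (fold : ∀ n : ℕ, Fin (K * n) → Fin K) : Prop :=
  ∀ n k, (Finset.univ.filter (fun i => fold n i = k)).card = n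

/-- The possible values of the auxiliary sample `I_k^c`. -/
abbrev AuxData (𝒳 : Type*) {K n : ℕ} (fold : Fin (K * n) → Fin K) (k : Fin K) :=
  {i : Fin (K * n) // fold i ≠ k} → Obs 𝒳

/-- The auxiliary sample `I_k^c` extracted from the full sample. -/
def auxSample {𝒳 : Type*} {K n : ℕ} (fold : Fin (K * n) → Fin K) (k : Fin K)
    (z : Fin (K * n) → Obs 𝒳) : AuxData 𝒳 fold k := fun i => z i.1

/-- A nuisance estimator: a jointly measurable function of the auxiliary sample and the covariates,
one for each sample size and each fold. -/
structure NuisanceEstimator (𝒳 : Type*) [MeasurableSpace 𝒳] {K : ℕ}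
    (fold : ∀ n : ℕ, Fin (K * n) → Fin K) where
  est : ∀ (n : ℕ) (k : Fin K), AuxData 𝒳 (fold n) k → Nuisance 𝒳
  measurable_f : ∀ n k, Measurable (fun p : AuxData 𝒳 (fold n) k × 𝒳 => (est n k p.1).f p.2)
  measurable_g : ∀ n k, Measurable (fun p : AuxData 𝒳 (fold n) k × 𝒳 => (est n k p.1).g p.2)
  measurable_e : ∀ n k, Measurable (fun p : AuxData 𝒳 (fold n) k × 𝒳 => (est n k p.1).e p.2)

section Estimators

variable {𝒳 : Type*} {K n : ℕ}

/-- `λ̂_k`, the mean of `T_i` over `I_k^c` (which has `K n - n` elements). -/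
def lamHat (fold : Fin (K * n) → Fin K) (z : Fin (K * n) → Obs 𝒳) (k : Fin K) : ℝ :=
  ((K : ℝ) * n - n)⁻¹ * ∑ i ∈ Finset.univ.filter (fun i => fold i ≠ k), (z i).t

/-- The kernel density estimator `f̂_k(d)`, the mean of `K_h(D_i - d)` over `I_k^c`. -/
def fHat (Ker : ℝ → ℝ) (h d : ℝ) (fold : Fin (K * n) → Fin K) (z : Fin (K * n) → Obs 𝒳)
    (k : Fin K) : ℝ :=
  ((K : ℝ) * n - n)⁻¹ *
    ∑ i ∈ Finset.univ.filter (fun i => fold i ≠ k), rescale Ker h ((z i).dose - d)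

/-- The cross-fitted estimator, in which fold `k` uses the value `l k` for `λ`. -/
def attHatWith (Ker : ℝ → ℝ) (h d : ℝ) (fold : Fin (K * n) → Fin K)
    (est : ∀ k : Fin K, AuxData 𝒳 fold k → Nuisance 𝒳) (l : Fin K → ℝ)
    (z : Fin (K * n) → Obs 𝒳) : ℝ :=
  (K : ℝ)⁻¹ * ∑ k, (n : ℝ)⁻¹ * ∑ i ∈ Finset.univ.filter (fun i => fold i = k),
    signal Ker h d (l k) (fHat Ker h d fold z k) (est k (auxSample fold k z)) (z i)

/-- The cross-fitted estimator of `ATT(d)`, with `λ` estimated by `λ̂_k`. -/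
def attHat (Ker : ℝ → ℝ) (h d : ℝ) (fold : Fin (K * n) → Fin K)
    (est : ∀ k : Fin K, AuxData 𝒳 fold k → Nuisance 𝒳) (z : Fin (K * n) → Obs 𝒳) : ℝ :=
  attHatWith Ker h d fold est (lamHat fold z) z

end Estimators

/-- The first `N` observations of the sequence `Z`. -/
def firstObs {S 𝒳 : Type*} (Z : ℕ → S → Obs 𝒳) (N : ℕ) (s : S) : Fin N → Obs 𝒳 :=
  fun i => Z i s

/-- The pooled sample is i.i.d. with the law of `Z = (Y, T, D, X)`. -/
structure IsIIDSample {Ω 𝒳 S : Type*} [MeasurableSpace Ω] [MeasurableSpace 𝒳]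
    [MeasurableSpace S] (M : Population Ω 𝒳) (P : Measure Ω) (μ : Measure S)
    (Z : ℕ → S → Obs 𝒳) : Prop where
  measurable : ∀ i, Measurable (Z i)
  indep : iIndepFun Z μ
  law : ∀ i, μ.map (Z i) = P.map M.obs

/-- A nuisance value `η` obeys the error bounds and the range restrictions. -/
structure NuisanceGood {𝒳 : Type*} [MeasurableSpace 𝒳] (PX : Measure 𝒳) (h ε κ c C : ℝ)
    (η0 η : Nuisance 𝒳) : Prop where
  f_error : eLpNorm (fun x => η.f x - η0.f x) 2 PX ≤ ENNReal.ofReal (ε / √h)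
  g_error : eLpNorm (fun x => η.g x - η0.g x) 2 PX ≤ ENNReal.ofReal ε
  e_error : eLpNorm (fun x => η.e x - η0.e x) 2 PX ≤ ENNReal.ofReal ε
  g_range : ∀ᵐ x ∂PX, κ < η.g x ∧ η.g x < 1 - κ
  f_range : ∀ᵐ x ∂PX, c < η.f x ∧ η.f x < C
  e_range : eLpNorm η.e ⊤ PX < ENNReal.ofReal C

/-- Bandwidth and nuisance rates, at the sample sizes `N = K * n`. -/
structure Rates {Ω 𝒳 S : Type*} [MeasurableSpace Ω] [MeasurableSpace 𝒳] [MeasurableSpace S]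
    (M : Population Ω 𝒳) (P : Measure Ω) [IsFiniteMeasure P] (μ : Measure S)
    (Z : ℕ → S → Obs 𝒳) (Ker : ℝ → ℝ) (d κ c C : ℝ) {K : ℕ}
    (fold : ∀ n : ℕ, Fin (K * n) → Fin K) (η : NuisanceEstimator 𝒳 fold) (h ε : ℕ → ℝ) :
    Prop where
  h_pos : ∀ n, 0 < h n
  h_zero : Tendsto h atTop (𝓝 0)
  Nh_top : Tendsto (fun n : ℕ => ((K * n : ℕ) : ℝ) * h n) atTop atTop
  undersmoothing : Tendsto (fun n : ℕ => √(((K * n : ℕ) : ℝ) * h n ^ 5)) atTop (𝓝 0)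
  ε_zero : Tendsto ε atTop (𝓝 0)
  ε_h : Tendsto (fun n => (h n)⁻¹ * ε n ^ 2) atTop (𝓝 0)
  nuisance : ∀ k, Tendsto (fun n => μ {s | NuisanceGood (P.map M.X) (h n) (ε n) κ c C
    (M.eta0 P Ker (h n) d) (η.est n k (auxSample (fold n) k (firstObs Z (K * n) s)))})
    atTop (𝓝 1)

end CDiD

end

noncomputable section

namespace CDiD

/-! ### A central limit theorem for row-wise i.i.d. triangular arrays with bounded rows -/

/-! On the scale (Nh)^{-1/2} the estimator is ATT(d) plus the sample mean of a centred function of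
one observation (`influence`), and that mean obeys a central limit theorem.

Identification. Both periods share the law of (D, X), so the weight (T-λ)/(λ(1-λ)) turns Y into the
trend Y_t - Y_{t-1} in every mean against a bounded function of (D, X) (`integral_Ylam_mul`).
Parallel trends and overlap identify the untreated trend given X at dose d with `e0`, so f_D(d)
ATT(d) is a difference of two integrals of densities at d (`fD_mul_ATT`). The smoothed target θ =
`ATTh` satisfies the analogous identity with K_h(D-d) in place of evaluation at d (`fD_mul_ATTh`).
Second-order expansions make the two differ by O(h²) (`exists_ATTh_bound`); the untreated atom
enters only through the left tail of the kernel. Undersmoothing gives √(Nh) h² → 0.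

Nuisance functions. Conditioning on X shows that replacing the true nuisances by (f, g, e) changes
the mean of the estimating function only by the mean of the product (f_h - g_0 f/g)(e - e_0)
(`integral_raw_eq`). The resulting bias is O(ε²/√h) for bounded h, hence O(√N ε²) after scaling.
Cross-fitting makes the nuisance estimates independent of the fold on which they are used, so
Chebyshev's inequality applies with the estimate frozen (`measure_crossfit_mean_le`); the scaled
variance is O(ε²/h). Both vanish, which is `nuisance_effect`.

Scalar parameters. The estimate of λ has error O_p(N^{-1/2}), negligible on the scale (Nh)^{-1/2}
(`lam_effect`). The density estimate has error O_p((Nh)^{-1/2}) (`fHat_rate`) and is not negligible: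
linearizing its reciprocal produces the term -(θ/f_D)(K_h - E K_h) of `influence`. The average over
k of the leave-fold-out density estimates is the full-sample one, so this term is again a sample
mean (`mean_influence_eq`, `attHat_linear`).

Limit law. The influence function is O(1/h), while nondegeneracy bounds σ_N below by a multiple of
h^{-1/2}. The standardized summands are therefore o(√N) uniformly, and an expansion of
characteristic functions suffices (`tendstoInDistribution_triangular`). The remainder is removed by
Slutsky's theorem in `attHat_clt`. -/

theorem norm_pow_sub_pow_le {a b : ℂ} (ha : ‖a‖ ≤ 1) (hb : ‖b‖ ≤ 1) (n : ℕ) :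
    ‖a ^ n - b ^ n‖ ≤ n * ‖a - b‖ := by
  induction n with
  | zero => simp
  | succ n ih =>
    have : a ^ (n + 1) - b ^ (n + 1) = a * (a ^ n - b ^ n) + (a - b) * b ^ n := by ring
    rw [this]
    calc ‖a * (a ^ n - b ^ n) + (a - b) * b ^ n‖
        ≤ ‖a‖ * ‖a ^ n - b ^ n‖ + ‖a - b‖ * ‖b‖ ^ n := by
          refine (norm_add_le _ _).trans ?_
          rw [norm_mul, norm_mul, norm_pow]
      _ ≤ 1 * (n * ‖a - b‖) + ‖a - b‖ * 1 := by
          gcongr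
          exact pow_le_one₀ (norm_nonneg _) hb
      _ = _ := by push_cast; ring

theorem norm_exp_mul_I_sub_taylor_le {x : ℝ} (hx : |x| ≤ 1) :
    ‖Complex.exp (x * Complex.I) - (1 + x * Complex.I - (x : ℂ) ^ 2 / 2)‖ ≤ |x| ^ 3 := by
  have h := Complex.exp_bound (x := x * Complex.I) (by simpa using hx) (n := 3) (by norm_num)
  have h2 : ∑ m ∈ Finset.range 3, ((x : ℂ) * Complex.I) ^ m / (m.factorial : ℂ)
      = 1 + x * Complex.I - (x : ℂ) ^ 2 / 2 := by
    simp [Finset.sum_range_succ, Nat.factorial, mul_pow]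
    ring
  rw [h2] at h
  refine h.trans ?_
  have : ‖(x : ℂ) * Complex.I‖ = |x| := by simp
  rw [this]
  have h3 : 0 ≤ |x| ^ 3 := by positivity
  norm_num [Nat.factorial]
  nlinarith

/-- Second-order expansion of the characteristic function of a bounded standardized variable. -/
theorem norm_charFun_map_sub_le {E : Type*} [MeasurableSpace E] (ν : Measure E)
    [IsProbabilityMeasure ν] {ξ : E → ℝ} (hξ : Measurable ξ) {t b : ℝ}
    (hbd : ∀ᵐ z ∂ν, |t * ξ z| ≤ b) (hb : b ≤ 1) (h0 : ∫ z, ξ z ∂ν = 0)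
    (h1 : ∫ z, ξ z ^ 2 ∂ν = 1) :
    ‖charFun (ν.map ξ) t - (1 - (t : ℂ) ^ 2 / 2)‖ ≤ b * t ^ 2 := by
  -- A non-integrable function has Bochner integral 0, so a second moment equal to 1 already
  -- contains square integrability.
  have hi2 : Integrable (fun z => ξ z ^ 2) ν := by
    by_contra h
    rw [integral_undef h] at h1
    exact zero_ne_one h1
  have hi1 : Integrable ξ ν :=
    ((memLp_two_iff_integrable_sq hξ.aestronglyMeasurable).2 hi2).integrable (by norm_num)
  have hch : charFun (ν.map ξ) t = ∫ z, Complex.exp (((t * ξ z : ℝ) : ℂ) * Complex.I) ∂ν := by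
    rw [charFun_apply_real, integral_map hξ.aemeasurable (by fun_prop)]
    simp
  have hie : Integrable (fun z => Complex.exp (((t * ξ z : ℝ) : ℂ) * Complex.I)) ν := by
    refine (integrable_const (1 : ℝ)).mono' (by fun_prop) (ae_of_all _ fun z => ?_)
    rw [Complex.norm_exp_ofReal_mul_I]
  have hic1 : Integrable (fun z => (ξ z : ℂ)) ν := hi1.ofReal
  have hic2 : Integrable (fun z => ((ξ z ^ 2 : ℝ) : ℂ)) ν := hi2.ofReal
  have hit : Integrable (fun z => (1 : ℂ) + (t * Complex.I) * (ξ z : ℂ)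
      - ((t : ℂ) ^ 2 / 2) * ((ξ z ^ 2 : ℝ) : ℂ)) ν :=
    ((integrable_const _).add (hic1.const_mul _)).sub (hic2.const_mul _)
  have htay : ∫ z, ((1 : ℂ) + (t * Complex.I) * (ξ z : ℂ)
      - ((t : ℂ) ^ 2 / 2) * ((ξ z ^ 2 : ℝ) : ℂ)) ∂ν = 1 - (t : ℂ) ^ 2 / 2 := by
    have hia : Integrable (fun z => (1 : ℂ) + (t * Complex.I) * (ξ z : ℂ)) ν :=
      (integrable_const _).add (hic1.const_mul _)
    rw [integral_sub hia (hic2.const_mul _),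
      integral_add (integrable_const _) (hic1.const_mul _), integral_const_mul,
      integral_const_mul, integral_complex_ofReal, integral_complex_ofReal, h0, h1]
    simp
  rw [hch, ← htay, ← integral_sub hie hit]
  -- One factor of the cubic remainder |tξ|³ is absorbed by the uniform bound b, and the second
  -- moment pays for the other two. No third moment appears.
  have hbnd : ∀ᵐ z ∂ν, ‖Complex.exp (((t * ξ z : ℝ) : ℂ) * Complex.I)
      - ((1 : ℂ) + (t * Complex.I) * (ξ z : ℂ) - ((t : ℂ) ^ 2 / 2) * ((ξ z ^ 2 : ℝ) : ℂ))‖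
      ≤ b * t ^ 2 * ξ z ^ 2 := by
    filter_upwards [hbd] with z hz
    have h := norm_exp_mul_I_sub_taylor_le (hz.trans hb)
    have he : (1 : ℂ) + (t * Complex.I) * (ξ z : ℂ) - ((t : ℂ) ^ 2 / 2) * ((ξ z ^ 2 : ℝ) : ℂ)
        = 1 + ((t * ξ z : ℝ) : ℂ) * Complex.I - ((t * ξ z : ℝ) : ℂ) ^ 2 / 2 := by
      push_cast; ring
    rw [he]
    refine h.trans ?_
    have h2 : |t * ξ z| ^ 3 = |t * ξ z| * (t ^ 2 * ξ z ^ 2) := by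
      rw [pow_succ', sq_abs]; ring
    rw [h2, mul_assoc]
    gcongr
  calc _ ≤ ∫ z, b * t ^ 2 * ξ z ^ 2 ∂ν :=
        norm_integral_le_of_norm_le (hi2.const_mul _) hbnd
    _ = b * t ^ 2 := by rw [integral_const_mul, h1, mul_one]

theorem norm_exp_neg_sub_le {x : ℝ} (hx : |x| ≤ 1) :
    ‖Complex.exp (-(x : ℂ)) - (1 - (x : ℂ))‖ ≤ x ^ 2 := by
  have h := Complex.norm_exp_sub_one_sub_id_le (x := -(x : ℂ)) (by simpa using hx)
  rw [show Complex.exp (-(x : ℂ)) - (1 - (x : ℂ))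
    = Complex.exp (-(x : ℂ)) - 1 - -(x : ℂ) by ring]
  refine h.trans (by simp)

/-- Independence makes the characteristic function of the normalized sum an N-th power. The Gaussian
one is also an N-th power, of exp(-t²/(2N)), so it is enough to compare single factors to order
o(1/N). The uniform bound o(√N) on the rows takes the place of a Lindeberg condition. -/
theorem tendstoInDistribution_triangular {S E : Type*} [MeasurableSpace S] [MeasurableSpace E]
    {μ : Measure S} [IsProbabilityMeasure μ] {ν : Measure E} [IsProbabilityMeasure ν]
    {Z : ℕ → S → E} (hZ : ∀ i, Measurable (Z i)) (hind : iIndepFun Z μ)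
    (hlaw : ∀ i, μ.map (Z i) = ν) {ξ : ℕ → E → ℝ} (hξ : ∀ n, Measurable (ξ n)) {N : ℕ → ℕ}
    (hN : Tendsto N atTop atTop) {b : ℕ → ℝ} (hb : Tendsto b atTop (𝓝 0))
    (hbd : ∀ᶠ n in atTop, ∀ᵐ z ∂ν, |ξ n z| ≤ b n * √(N n))
    (h0 : ∀ᶠ n in atTop, ∫ z, ξ n z ∂ν = 0) (h1 : ∀ᶠ n in atTop, ∫ z, ξ n z ^ 2 ∂ν = 1) :
    TendstoInDistribution (fun (n : ℕ) s => (√(N n))⁻¹ * ∑ i ∈ Finset.range (N n), ξ n (Z i s))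
      atTop (id : ℝ → ℝ) (fun _ => μ) (gaussianReal 0 1) where
  forall_aemeasurable n := by
    have := fun i => (hξ n).comp (hZ i)
    simp only [Function.comp_def] at this
    fun_prop
  aemeasurable_limit := aemeasurable_id
  tendsto := by
    refine ProbabilityMeasure.tendsto_iff_tendsto_charFun.2 fun t ↦ ?_
    simp only [ProbabilityMeasure.coe_mk, Measure.map_id, charFun_gaussianReal]
    have hcf : ∀ n, charFun (μ.map (fun s => (√(N n))⁻¹ * ∑ i ∈ Finset.range (N n), ξ n (Z i s))) t
        = charFun (ν.map (ξ n)) ((√(N n))⁻¹ * t) ^ N n := by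
      intro n
      have hm : ∀ i, Measurable (fun s => ξ n (Z i s)) := fun i => (hξ n).comp (hZ i)
      have hi : iIndepFun (fun i s => ξ n (Z i s)) μ := hind.comp (fun _ => ξ n) (fun _ => hξ n)
      rw [charFun_map_mul_comp, (hi.restrict _).charFun_map_fun_finsetSum_eq_prod
        (fun i _ => (hm i).aemeasurable)]
      · have : ∀ i, μ.map (fun s => ξ n (Z i s)) = ν.map (ξ n) := fun i => by
          rw [← hlaw i, Measure.map_map (hξ n) (hZ i)]; rfl
        simp [this]
      · fun_prop
    simp_rw [hcf]
    have hNr : Tendsto (fun n => ((N n : ℕ) : ℝ)) atTop atTop :=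
      tendsto_natCast_atTop_atTop.comp hN
    -- The first term is N times the error |t| b t²/N of the summand's expansion; the second is N
    -- times the error (t²/(2N))² in expanding the Gaussian factor.
    have hlim : Tendsto (fun n => |t| * b n * t ^ 2 + t ^ 4 / 4 * ((N n : ℝ))⁻¹) atTop (𝓝 0) := by
      have := ((hb.const_mul |t|).mul_const (t ^ 2)).add
        ((tendsto_inv_atTop_zero.comp hNr).const_mul (t ^ 4 / 4))
      simpa using this
    have hg : Complex.exp (↑t * ((0 : ℝ) : ℂ) * Complex.I - ((1 : NNReal) : ℂ) * ↑t ^ 2 / 2)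
        = Complex.exp (-((t ^ 2 / 2 : ℝ) : ℂ)) := by
      congr 1; push_cast; simp
    rw [hg]
    refine tendsto_iff_norm_sub_tendsto_zero.2 (squeeze_zero' (.of_forall fun _ => norm_nonneg _)
      ?_ hlim)
    have hev1 : ∀ᶠ n in atTop, |t| * b n ≤ 1 := by
      have := hb.const_mul |t|
      rw [mul_zero] at this
      exact this.eventually (Iic_mem_nhds one_pos)
    have hev2 : ∀ᶠ n in atTop, t ^ 2 / 2 + 1 ≤ (N n : ℝ) := hNr.eventually_ge_atTop _
    filter_upwards [hbd, h0, h1, hev1, hev2] with n hbd h0 h1 h2 h3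
    have hNpos : (0 : ℝ) < N n := by nlinarith [sq_nonneg t]
    have hsq : (√(N n : ℝ))⁻¹ ^ 2 = (N n : ℝ)⁻¹ := by
      rw [inv_pow, Real.sq_sqrt hNpos.le]
    have hexp : Complex.exp (-((t ^ 2 / 2 : ℝ) : ℂ))
        = Complex.exp (-((t ^ 2 / 2 / N n : ℝ) : ℂ)) ^ N n := by
      rw [← Complex.exp_nat_mul]
      congr 1
      have : (N n : ℂ) ≠ 0 := by exact_mod_cast hNpos.ne'
      push_cast
      field_simp
    rw [hexp]
    have hbt : ∀ᵐ z ∂ν, |(√(N n))⁻¹ * t * ξ n z| ≤ |t| * b n := by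
      filter_upwards [hbd] with z hz
      rw [abs_mul, abs_mul, abs_of_nonneg (by positivity : 0 ≤ (√(N n : ℝ))⁻¹)]
      calc (√(N n))⁻¹ * |t| * |ξ n z| ≤ (√(N n))⁻¹ * |t| * (b n * √(N n)) := by gcongr
        _ = |t| * b n := by
          have : √(N n : ℝ) ≠ 0 := (Real.sqrt_pos.2 hNpos).ne'
          field_simp
    have hA := norm_charFun_map_sub_le ν (hξ n) hbt h2 h0 h1
    have hx1 : |t ^ 2 / 2 / N n| ≤ 1 := by
      rw [abs_of_nonneg (by positivity), div_le_one hNpos]; linarith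
    have hB := norm_exp_neg_sub_le hx1
    have := Measure.isProbabilityMeasure_map (μ := ν) (hξ n).aemeasurable
    refine (norm_pow_sub_pow_le (norm_charFun_le_one _) ?_ _).trans ?_
    · rw [Complex.norm_exp]
      simp only [Complex.neg_re, Complex.ofReal_re, Real.exp_le_one_iff, Left.neg_nonpos_iff]
      positivity
    · have hmid : (1 : ℂ) - (((√(N n))⁻¹ * t : ℝ) : ℂ) ^ 2 / 2
          = 1 - ((t ^ 2 / 2 / N n : ℝ) : ℂ) := by
        have : ((√(N n))⁻¹ * t) ^ 2 / 2 = t ^ 2 / 2 / N n := by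
          rw [mul_pow, hsq]; field_simp
        rw [← this]; push_cast; ring
      rw [hmid] at hA
      have hC := norm_sub_le_norm_sub_add_norm_sub
        (charFun (ν.map (ξ n)) ((√(N n))⁻¹ * t)) (1 - ((t ^ 2 / 2 / N n : ℝ) : ℂ))
        (Complex.exp (-((t ^ 2 / 2 / N n : ℝ) : ℂ)))
      rw [norm_sub_rev (1 - ((t ^ 2 / 2 / N n : ℝ) : ℂ))] at hC
      rw [mul_pow, hsq] at hA
      calc (N n : ℝ) * _ ≤ N n * (|t| * b n * ((N n : ℝ)⁻¹ * t ^ 2) + (t ^ 2 / 2 / N n) ^ 2) := by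
            gcongr; linarith
        _ = _ := by field_simp; ring

/-! ### Stochastic orders of magnitude -/

section StochasticOrder

variable {S : Type*} [MeasurableSpace S] {μ : Measure S}

/-- `X n = o_p(1)`. -/
def SmallInProb (μ : Measure S) (X : ℕ → S → ℝ) : Prop :=
  ∀ δ : ℝ, 0 < δ → Tendsto (fun n => μ {s | δ ≤ |X n s|}) atTop (𝓝 0)

/-- `X n = O_p(1)`. -/
def BoundedInProb (μ : Measure S) (X : ℕ → S → ℝ) : Prop :=
  ∀ δ : ℝ, 0 < δ → ∃ B : ℝ, ∀ᶠ n in atTop, μ {s | B < |X n s|} ≤ ENNReal.ofReal δ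

theorem SmallInProb.tendstoInMeasure {X : ℕ → S → ℝ} (hX : SmallInProb μ X) :
    TendstoInMeasure μ X atTop (fun _ => 0) := by
  rw [tendstoInMeasure_iff_norm]
  intro δ hδ
  simpa using hX δ hδ

theorem SmallInProb.eventually_le {X : ℕ → S → ℝ} (hX : SmallInProb μ X) {δ γ : ℝ} (hδ : 0 < δ)
    (hγ : 0 < γ) : ∀ᶠ n in atTop, μ {s | δ ≤ |X n s|} ≤ ENNReal.ofReal γ :=
  (hX δ hδ).eventually (Iic_mem_nhds (by simpa using hγ))

theorem smallInProb_of_eventually_le {X : ℕ → S → ℝ}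
    (h : ∀ δ : ℝ, 0 < δ → ∀ γ : ℝ, 0 < γ → ∀ᶠ n in atTop, μ {s | δ ≤ |X n s|} ≤ ENNReal.ofReal γ) :
    SmallInProb μ X := by
  intro δ hδ
  rw [ENNReal.tendsto_nhds_zero]
  intro e he
  by_cases htop : e = ⊤
  · simp [htop]
  filter_upwards [h δ hδ e.toReal (ENNReal.toReal_pos he.ne' htop)] with n hn
  rwa [ENNReal.ofReal_toReal htop] at hn

/-- Transfer along events whose probability tends to one. -/
theorem SmallInProb.of_eventually_bad {X Y : ℕ → S → ℝ} {bad : ℕ → Set S}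
    (hbad : Tendsto (fun n => μ (bad n)) atTop (𝓝 0)) (hX : SmallInProb μ X)
    (h : ∀ᶠ n in atTop, ∀ s, s ∉ bad n → |Y n s| ≤ |X n s|) : SmallInProb μ Y := by
  intro δ hδ
  have hlim := (hX δ hδ).add hbad
  rw [add_zero] at hlim
  refine tendsto_of_tendsto_of_tendsto_of_le_of_le' tendsto_const_nhds hlim
    (.of_forall fun _ => zero_le) ?_
  filter_upwards [h] with n hn
  refine (measure_mono (t := {s | δ ≤ |X n s|} ∪ bad n) fun s hs => ?_).trans
    (measure_union_le _ _)
  by_cases hb : s ∈ bad n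
  · exact Or.inr hb
  · exact Or.inl (le_trans hs (hn s hb))

theorem SmallInProb.mono {X Y : ℕ → S → ℝ} (hX : SmallInProb μ X)
    (h : ∀ᶠ n in atTop, ∀ s, |Y n s| ≤ |X n s|) : SmallInProb μ Y :=
  hX.of_eventually_bad (bad := fun _ => ∅) (by simp) (h.mono fun _ hn s _ => hn s)

theorem SmallInProb.add {X Y : ℕ → S → ℝ} (hX : SmallInProb μ X) (hY : SmallInProb μ Y) :
    SmallInProb μ (fun n s => X n s + Y n s) := by
  intro δ hδ
  have hlim := (hX (δ / 2) (by positivity)).add (hY (δ / 2) (by positivity))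
  rw [add_zero] at hlim
  refine tendsto_of_tendsto_of_tendsto_of_le_of_le tendsto_const_nhds hlim
    (fun _ => zero_le) fun n => ?_
  refine (measure_mono (t := {s | δ / 2 ≤ |X n s|} ∪ {s | δ / 2 ≤ |Y n s|}) fun s hs => ?_).trans
    (measure_union_le _ _)
  by_contra hc
  simp only [mem_union, mem_ofPred_eq, not_or, not_le] at hc hs
  have := abs_add_le (X n s) (Y n s)
  linarith

theorem smallInProb_of_tendsto {x : ℕ → ℝ} (hx : Tendsto x atTop (𝓝 0)) :
    SmallInProb μ (fun n _ => x n) := by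
  intro δ hδ
  refine tendsto_const_nhds.congr' ?_
  have := (tendsto_zero_iff_abs_tendsto_zero _).1 hx
  filter_upwards [this.eventually (Iio_mem_nhds hδ)] with n hn
  have : ¬ δ ≤ |x n| := not_le.2 hn
  simp [this]

theorem SmallInProb.sum {ι : Type*} (s : Finset ι) {X : ι → ℕ → S → ℝ}
    (hX : ∀ i, SmallInProb μ (X i)) : SmallInProb μ (fun n ω => ∑ i ∈ s, X i n ω) := by
  classical
  induction s using Finset.induction_on with
  | empty => simpa using smallInProb_of_tendsto (μ := μ) (x := fun _ => 0) tendsto_const_nhds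
  | insert a s ha ih =>
    simp_rw [Finset.sum_insert ha]
    exact (hX a).add ih

theorem BoundedInProb.mul_small {X Y : ℕ → S → ℝ} (hX : BoundedInProb μ X)
    (hY : SmallInProb μ Y) : SmallInProb μ (fun n s => X n s * Y n s) := by
  refine smallInProb_of_eventually_le fun δ hδ γ hγ => ?_
  obtain ⟨B, hB⟩ := hX (γ / 2) (by positivity)
  -- The bound B may be zero or negative, so |B| + 1 serves as the divisor.
  have hB1 : 0 < |B| + 1 := by positivity
  filter_upwards [hB, hY.eventually_le (div_pos hδ hB1) (half_pos hγ)] with n h1 h2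
  calc μ {s | δ ≤ |X n s * Y n s|}
      ≤ μ ({s | B < |X n s|} ∪ {s | δ / (|B| + 1) ≤ |Y n s|}) := by
        refine measure_mono fun s hs => ?_
        by_contra hc
        simp only [mem_union, mem_ofPred_eq, not_or, not_le, not_lt] at hc hs
        rw [abs_mul] at hs
        have h3 : |X n s| * |Y n s| ≤ (|B| + 1) * |Y n s| := by
          gcongr
          linarith [hc.1, le_abs_self B]
        have h4 := (lt_div_iff₀ hB1).1 hc.2
        linarith
    _ ≤ ENNReal.ofReal (γ / 2) + ENNReal.ofReal (γ / 2) :=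
        (measure_union_le _ _).trans (add_le_add h1 h2)
    _ = ENNReal.ofReal γ := by
        rw [← ENNReal.ofReal_add (by positivity) (by positivity), add_halves]

theorem BoundedInProb.add {X Y : ℕ → S → ℝ} (hX : BoundedInProb μ X)
    (hY : BoundedInProb μ Y) : BoundedInProb μ (fun n s => X n s + Y n s) := by
  intro γ hγ
  obtain ⟨B, hB⟩ := hX (γ / 2) (by positivity)
  obtain ⟨B', hB'⟩ := hY (γ / 2) (by positivity)
  refine ⟨B + B', ?_⟩
  filter_upwards [hB, hB'] with n h1 h2
  calc μ {s | B + B' < |X n s + Y n s|}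
      ≤ μ ({s | B < |X n s|} ∪ {s | B' < |Y n s|}) := by
        refine measure_mono fun s hs => ?_
        by_contra hc
        simp only [mem_union, mem_ofPred_eq, not_or, not_lt] at hc hs
        have := abs_add_le (X n s) (Y n s)
        linarith
    _ ≤ ENNReal.ofReal (γ / 2) + ENNReal.ofReal (γ / 2) :=
        (measure_union_le _ _).trans (add_le_add h1 h2)
    _ = ENNReal.ofReal γ := by
        rw [← ENNReal.ofReal_add (by positivity) (by positivity), add_halves]

theorem SmallInProb.boundedInProb {X : ℕ → S → ℝ} (hX : SmallInProb μ X) :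
    BoundedInProb μ X := by
  intro γ hγ
  refine ⟨1, ?_⟩
  filter_upwards [hX.eventually_le one_pos hγ] with n hn
  exact (measure_mono (t := {s | 1 ≤ |X n s|}) fun s (hs : 1 < |X n s|) => hs.le).trans hn

theorem boundedInProb_of_eventually_le {x : ℕ → ℝ} {B : ℝ} (hx : ∀ᶠ n in atTop, |x n| ≤ B) :
    BoundedInProb μ (fun n _ => x n) := by
  intro γ hγ
  refine ⟨B, ?_⟩
  filter_upwards [hx] with n hn
  simp [not_lt.2 hn]

theorem BoundedInProb.mono {X Y : ℕ → S → ℝ} (hX : BoundedInProb μ X)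
    (h : ∀ᶠ n in atTop, ∀ s, |Y n s| ≤ |X n s|) : BoundedInProb μ Y := by
  intro γ hγ
  obtain ⟨B, hB⟩ := hX γ hγ
  refine ⟨B, ?_⟩
  filter_upwards [hB, h] with n h1 h2
  exact (measure_mono fun s hs => lt_of_lt_of_le hs (h2 s)).trans h1

/-- Off the event |X - a| ≥ |a|/2, whose probability vanishes, inversion is Lipschitz at a with
constant 2/a². -/
theorem SmallInProb.inv_sub {X : ℕ → S → ℝ} {a : ℝ} (ha : a ≠ 0)
    (hX : SmallInProb μ (fun n s => X n s - a)) :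
    SmallInProb μ (fun n s => (X n s)⁻¹ - a⁻¹) := by
  have hap : 0 < |a| := abs_pos.2 ha
  have h1 : SmallInProb μ (fun n s => (2 / a ^ 2) * (X n s - a)) :=
    (boundedInProb_of_eventually_le (x := fun _ => 2 / a ^ 2) (.of_forall fun _ => le_rfl)).mul_small
      hX
  refine h1.of_eventually_bad (hX (|a| / 2) (by positivity)) (.of_forall fun n s hs => ?_)
  simp only [mem_ofPred_eq, not_le] at hs
  have h2 : |a| / 2 ≤ |X n s| := by
    have := abs_sub_abs_le_abs_sub a (X n s)
    rw [abs_sub_comm] at this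
    linarith
  have hne : X n s ≠ 0 := abs_pos.1 (by linarith)
  have h3 : (X n s)⁻¹ - a⁻¹ = (a - X n s) / (X n s * a) := by field_simp
  rw [h3, abs_div, abs_mul, abs_mul, abs_sub_comm, div_eq_inv_mul]
  gcongr
  rw [abs_of_nonneg (by positivity : 0 ≤ 2 / a ^ 2), ← sq_abs a, inv_eq_one_div,
    div_le_div_iff₀ (by positivity) (by positivity)]
  nlinarith

end StochasticOrder

/-! ### Chebyshev bounds for cross-fitted averages -/

section Chebyshev

variable {S E A : Type*} [MeasurableSpace S] [MeasurableSpace E] [MeasurableSpace A]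

/-- Chebyshev's inequality for an average whose mean is only known to be at most b in absolute
value: the mean is moved into the threshold δ + b, and the variance is bounded by the second moment.
-/
theorem measure_pi_mean_le {I : Type*} [Fintype I] [Nonempty I] (ν : Measure E)
    [IsProbabilityMeasure ν] {u : E → ℝ} (hu : MemLp u 2 ν) {V b δ : ℝ} (hδ : 0 < δ)
    (hV : ∫ z, u z ^ 2 ∂ν ≤ V) (hb : |∫ z, u z ∂ν| ≤ b) :
    Measure.pi (fun _ : I => ν) {z | δ + b ≤ |(Fintype.card I : ℝ)⁻¹ * ∑ i, u (z i)|}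
      ≤ ENNReal.ofReal (V / Fintype.card I / δ ^ 2) := by
  set c : ℝ := (Fintype.card I : ℝ)⁻¹ with hc
  have hcard : (0 : ℝ) < Fintype.card I := by exact_mod_cast Fintype.card_pos
  have hci : c * Fintype.card I = 1 := inv_mul_cancel₀ hcard.ne'
  set Y : (I → E) → ℝ := ∑ i, fun z => u (z i) with hY
  have hYa : ∀ z, Y z = ∑ i, u (z i) := fun z => by simp [hY]
  have hui : ∀ i : I, MemLp (fun z : I → E => u (z i)) 2 (Measure.pi fun _ => ν) := fun i =>
    hu.comp_measurePreserving (measurePreserving_eval (fun _ : I => ν) i)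
  have hYm : MemLp Y 2 (Measure.pi fun _ => ν) := memLp_finsetSum' _ fun i _ => hui i
  have hXm : MemLp (fun z => c * Y z) 2 (Measure.pi fun _ => ν) := hYm.const_mul c
  have hmean : ∫ z, c * Y z ∂(Measure.pi fun _ : I => ν) = ∫ z, u z ∂ν := by
    rw [integral_const_mul]
    simp_rw [hYa]
    rw [integral_finsetSum _ fun i _ => (hui i).integrable (by norm_num)]
    have : ∀ i : I, ∫ z, u (z i) ∂(Measure.pi fun _ : I => ν) = ∫ z, u z ∂ν := fun i =>
      by
      have h := measurePreserving_eval (fun _ : I => ν) i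
      conv_rhs => rw [← h.map_eq]
      rw [integral_map h.measurable.aemeasurable (by rw [h.map_eq]; exact hu.aestronglyMeasurable)]
    simp [this, ← mul_assoc, hci]
  have hvar : Var[fun z => c * Y z; Measure.pi fun _ : I => ν] ≤ V / Fintype.card I := by
    rw [variance_const_mul, hY, variance_sum_pi fun _ => hu]
    simp only [Finset.sum_const, Finset.card_univ, nsmul_eq_mul]
    have h1 : Var[u; ν] ≤ V := (variance_le_expectation_sq hu.aestronglyMeasurable).trans hV
    calc c ^ 2 * (Fintype.card I * Var[u; ν]) = c * (c * Fintype.card I) * Var[u; ν] := by ring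
      _ = c * Var[u; ν] := by rw [hci, mul_one]
      _ ≤ c * V := by gcongr
      _ = _ := by rw [hc, div_eq_inv_mul]
  refine (measure_mono fun z hz => ?_).trans ((meas_ge_le_variance_div_sq hXm hδ).trans
    (ENNReal.ofReal_le_ofReal (by gcongr)))
  simp only [mem_ofPred_eq, hmean] at hz ⊢
  rw [hYa]
  have := abs_sub_abs_le_abs_sub (c * ∑ i, u (z i)) (∫ z, u z ∂ν)
  linarith

/-- Independence makes the joint law of the auxiliary variable and the averaged observations a
product. By Tonelli the auxiliary value can be frozen, and Chebyshev's bound, being uniform in that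
value, integrates to itself. This is where cross-fitting is used; no complexity condition on the
class of nuisance estimates is needed. -/
theorem measure_crossfit_mean_le {μ : Measure S} [IsProbabilityMeasure μ] {ν : Measure E}
    [IsProbabilityMeasure ν] {I : Type*} {T : Finset I} (hT : T.Nonempty)
    {Z : I → S → E} (hZ : ∀ i, Measurable (Z i)) (hind : iIndepFun Z μ)
    (hlaw : ∀ i, μ.map (Z i) = ν) {α : S → A} (hα : Measurable α)
    (hαZ : IndepFun α (fun s (i : T) => Z i s) μ) {u : A → E → ℝ}
    (hu : Measurable (Function.uncurry u)) {V b δ : ℝ} (hδ : 0 < δ)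
    (hL2 : ∀ a, MemLp (u a) 2 ν) (hV : ∀ a, ∫ z, u a z ^ 2 ∂ν ≤ V)
    (hb : ∀ a, |∫ z, u a z ∂ν| ≤ b) :
    μ {s | δ + b ≤ |(T.card : ℝ)⁻¹ * ∑ i ∈ T, u (α s) (Z i s)|}
      ≤ ENNReal.ofReal (V / T.card / δ ^ 2) := by
  have : Nonempty T := hT.to_subtype
  have hZm : Measurable (fun s (i : T) => Z i s) := measurable_pi_lambda _ fun i => hZ i
  have hmap : μ.map (fun s => (α s, fun i : T => Z i s))
      = (μ.map α).prod (Measure.pi fun _ : T => ν) := by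
    rw [hαZ.map_prod_eq_prod_map_map hα.aemeasurable hZm.aemeasurable]
    congr 1
    rw [(iIndepFun_iff_map_fun_eq_pi_map (fun i : T => (hZ i).aemeasurable)).1
      (hind.precomp (g := ((↑) : T → I)) Subtype.val_injective)]
    simp [hlaw]
  have hfun : Measurable (fun p : A × (T → E) => (T.card : ℝ)⁻¹ * ∑ i, u p.1 (p.2 i)) := by
    refine Measurable.const_mul (Finset.measurable_sum _ fun i _ => ?_) _
    exact hu.comp (measurable_fst.prodMk ((measurable_pi_apply i).comp measurable_snd))
  have hset : MeasurableSet {p : A × (T → E) |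
      δ + b ≤ |(T.card : ℝ)⁻¹ * ∑ i, u p.1 (p.2 i)|} :=
    measurableSet_le measurable_const (continuous_abs.measurable.comp hfun)
  have hpre : {s | δ + b ≤ |(T.card : ℝ)⁻¹ * ∑ i ∈ T, u (α s) (Z i s)|}
      = (fun s => (α s, fun i : T => Z i s)) ⁻¹' {p : A × (T → E) |
        δ + b ≤ |(T.card : ℝ)⁻¹ * ∑ i, u p.1 (p.2 i)|} := by
    ext s
    simp only [mem_ofPred_eq, mem_preimage]
    rw [Finset.sum_coe_sort T (fun i => u (α s) (Z i s))]
  have hprob : IsProbabilityMeasure (μ.map α) := Measure.isProbabilityMeasure_map hα.aemeasurable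
  rw [hpre, ← Measure.map_apply (hα.prodMk hZm) hset, hmap, Measure.prod_apply hset]
  calc _ ≤ ∫⁻ _, ENNReal.ofReal (V / T.card / δ ^ 2) ∂(μ.map α) := by
        refine lintegral_mono fun a => ?_
        have := measure_pi_mean_le (I := T) ν (hL2 a) hδ (hV a) (hb a)
        rw [Fintype.card_coe] at this
        exact this
    _ = _ := by simp

/-- Data of a sequence of cross-fitted averages: the averages run over `T n`, and `α n` is
independent of the observations in `T n`. -/
structure CrossFit (μ : Measure S) (ν : Measure E) (Z : ℕ → S → E) (T : ℕ → Finset ℕ)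
    {A : ℕ → Type*} [∀ n, MeasurableSpace (A n)] (α : ∀ n, S → A n) : Prop where
  measurable : ∀ i, Measurable (Z i)
  indep : iIndepFun Z μ
  law : ∀ i, μ.map (Z i) = ν
  card_top : Tendsto (fun n => ((T n).card : ℝ)) atTop atTop
  measurable_aux : ∀ n, Measurable (α n)
  indep_aux : ∀ n, IndepFun (α n) (fun s (i : T n) => Z i s) μ

variable {μ : Measure S} {ν : Measure E}
  {Z : ℕ → S → E} {T : ℕ → Finset ℕ} {A : ℕ → Type*} [∀ n, MeasurableSpace (A n)]
  {α : ∀ n, S → A n}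

theorem CrossFit.eventually_nonempty (hc : CrossFit μ ν Z T α) : ∀ᶠ n in atTop, (T n).Nonempty := by
  filter_upwards [hc.card_top.eventually_ge_atTop 1] with n hn
  exact Finset.card_pos.1 (by exact_mod_cast one_pos.trans_le hn)

variable [IsProbabilityMeasure μ] [IsProbabilityMeasure ν]

theorem CrossFit.smallInProb (hc : CrossFit μ ν Z T α) {u : ∀ n, A n → E → ℝ}
    (hu : ∀ n, Measurable (Function.uncurry (u n))) {V b : ℕ → ℝ}
    (hL2 : ∀ᶠ n in atTop, ∀ a, MemLp (u n a) 2 ν)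
    (hV : ∀ᶠ n in atTop, ∀ a, ∫ z, u n a z ^ 2 ∂ν ≤ V n)
    (hb : ∀ᶠ n in atTop, ∀ a, |∫ z, u n a z ∂ν| ≤ b n)
    (hV0 : Tendsto (fun n => V n / (T n).card) atTop (𝓝 0)) (hb0 : Tendsto b atTop (𝓝 0)) :
    SmallInProb μ (fun n s => ((T n).card : ℝ)⁻¹ * ∑ i ∈ T n, u n (α n s) (Z i s)) := by
  intro δ hδ
  have hlim : Tendsto (fun n => ENNReal.ofReal (V n / (T n).card / (δ / 2) ^ 2)) atTop (𝓝 0) := by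
    have := ENNReal.tendsto_ofReal (hV0.div_const ((δ / 2) ^ 2))
    simpa using this
  refine tendsto_of_tendsto_of_tendsto_of_le_of_le' tendsto_const_nhds hlim
    (.of_forall fun _ => zero_le) ?_
  filter_upwards [hL2, hV, hb, hb0.eventually (Iic_mem_nhds (half_pos hδ)),
    hc.eventually_nonempty] with n h1 h2 h3 h4 h5
  refine (measure_mono fun s hs => ?_).trans (measure_crossfit_mean_le h5 hc.measurable hc.indep
    hc.law (hc.measurable_aux n) (hc.indep_aux n) (hu n) (half_pos hδ) h1 h2 h3)
  simp only [mem_ofPred_eq] at hs h4 ⊢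
  linarith

theorem CrossFit.boundedInProb (hc : CrossFit μ ν Z T α) {u : ∀ n, A n → E → ℝ}
    (hu : ∀ n, Measurable (Function.uncurry (u n))) {V : ℕ → ℝ} {b B : ℝ}
    (hL2 : ∀ᶠ n in atTop, ∀ a, MemLp (u n a) 2 ν)
    (hV : ∀ᶠ n in atTop, ∀ a, ∫ z, u n a z ^ 2 ∂ν ≤ V n)
    (hb : ∀ᶠ n in atTop, ∀ a, |∫ z, u n a z ∂ν| ≤ b)
    (hVB : ∀ᶠ n in atTop, V n / (T n).card ≤ B) :
    BoundedInProb μ (fun n s => ((T n).card : ℝ)⁻¹ * ∑ i ∈ T n, u n (α n s) (Z i s)) := by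
  intro γ hγ
  -- Chosen so that Chebyshev's bound B/δ² is at most γ.
  set δ : ℝ := √((|B| + 1) / γ) with hδ'
  have hδ : 0 < δ := Real.sqrt_pos.2 (by positivity)
  have hδ2 : δ ^ 2 = (|B| + 1) / γ := Real.sq_sqrt (by positivity)
  refine ⟨δ + b, ?_⟩
  filter_upwards [hL2, hV, hb, hVB, hc.eventually_nonempty] with n h1 h2 h3 h4 h5
  refine (measure_mono (t := {s | δ + b ≤ |((T n).card : ℝ)⁻¹ * ∑ i ∈ T n, u n (α n s) (Z i s)|})
    fun s hs => ?_).trans ((measure_crossfit_mean_le h5 hc.measurable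
    hc.indep hc.law (hc.measurable_aux n) (hc.indep_aux n) (hu n) hδ h1 h2 h3).trans
    (ENNReal.ofReal_le_ofReal ?_))
  · exact le_of_lt (mem_ofPred_eq ▸ hs)
  rw [hδ2, div_div_eq_mul_div, div_le_iff₀ (by positivity), mul_comm]
  gcongr
  linarith [le_abs_self B]

end Chebyshev

/-! ### Taylor expansions of parametric integrals -/

/-- Two applications of the mean value inequality: the derivative is Lipschitz with constant B,
hence x ↦ g x - g'(s) x has derivative at most B|t - s| between s and t. The optimal factor 1/2 is
not needed. -/
theorem abs_taylor_le {g : ℝ → ℝ} {dL dH B : ℝ} (hg : ContDiffOn ℝ 2 g (Ioo dL dH))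
    (hB : ∀ s ∈ Ioo dL dH, |iteratedDeriv 2 g s| ≤ B) {s t : ℝ} (hs : s ∈ Ioo dL dH)
    (ht : t ∈ Ioo dL dH) : |g t - g s - deriv g s * (t - s)| ≤ B * (t - s) ^ 2 := by
  have hcd : ∀ x ∈ Ioo dL dH, ContDiffAt ℝ 2 g x := fun x hx =>
    hg.contDiffAt (isOpen_Ioo.mem_nhds hx)
  have hd1 : ∀ x ∈ Ioo dL dH, DifferentiableAt ℝ g x := fun x hx =>
    (hcd x hx).differentiableAt (by norm_num)
  have hd2 : ∀ x ∈ Ioo dL dH, DifferentiableAt ℝ (deriv g) x := fun x hx => by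
    have := hg.deriv_of_isOpen (m := 1) isOpen_Ioo (by norm_num)
    exact (this.contDiffAt (isOpen_Ioo.mem_nhds hx)).differentiableAt (by norm_num)
  have hderiv : ∀ x ∈ Ioo dL dH, |deriv g x - deriv g s| ≤ B * |x - s| := fun x hx => by
    have := (convex_Ioo dL dH).norm_image_sub_le_of_norm_deriv_le hd2
      (fun y hy => by simpa [iteratedDeriv_succ, iteratedDeriv_zero] using hB y hy) hs hx
    simpa using this
  have hseg : uIcc s t ⊆ Ioo dL dH := (convex_Ioo dL dH).ordConnected.uIcc_subset hs ht
  have hB0 : 0 ≤ B := (abs_nonneg _).trans (hB s hs)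
  have h := (convex_uIcc s t).norm_image_sub_le_of_norm_hasDerivWithin_le
    (f := fun x => g x - deriv g s * x) (f' := fun x => deriv g x - deriv g s)
    (C := B * |t - s|)
    (fun x hx => (((hd1 x (hseg hx)).hasDerivAt.sub
      (by simpa using (hasDerivAt_id x).const_mul (deriv g s)))).hasDerivWithinAt)
    (fun x hx => (hderiv x (hseg hx)).trans (by
      gcongr ?_ * ?_
      exact abs_sub_left_of_mem_uIcc hx)) left_mem_uIcc right_mem_uIcc
  rw [Real.norm_eq_abs, Real.norm_eq_abs] at h
  calc |g t - g s - deriv g s * (t - s)|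
      = |(g t - deriv g s * t) - (g s - deriv g s * s)| := by congr 1; ring
    _ ≤ B * |t - s| * |t - s| := h
    _ = _ := by rw [mul_assoc, abs_mul_abs_self, sq]

section Parametric

variable {E : Type*} [MeasurableSpace E] {ν : Measure E} [IsFiniteMeasure ν] {φ : E → ℝ → ℝ}
  {dL dH B : ℝ}

/-- Fubini gives integrable sections only at almost every dose. Two such doses p < q suffice:
expanding φ y p and φ y q around s and eliminating the derivative expresses φ y s through two
integrable sections and two bounded remainders. -/
theorem integrable_section_of_ae (hφ : Measurable (Function.uncurry φ)) (hlt : dL < dH)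
    (hC2 : ∀ᵐ y ∂ν, ContDiffOn ℝ 2 (φ y) (Ioo dL dH))
    (hB : ∀ᵐ y ∂ν, ∀ s ∈ Ioo dL dH, |iteratedDeriv 2 (φ y) s| ≤ B)
    (hint : ∀ᵐ s ∂volume.restrict (Ioo dL dH), Integrable (fun y => φ y s) ν) {s : ℝ}
    (hs : s ∈ Ioo dL dH) : Integrable (fun y => φ y s) ν := by
  -- A set of full measure meets every nonempty open subinterval, so p can be taken in the left half
  -- of the interval and q in the right half.
  have hpick : ∀ a b, dL ≤ a → a < b → b ≤ dH → ∃ r ∈ Ioo a b, Integrable (fun y => φ y r) ν := by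
    intro a b ha hab hb
    have h1 : ∀ᵐ r ∂volume.restrict (Ioo a b), Integrable (fun y => φ y r) ν :=
      ae_restrict_of_ae_restrict_of_subset (Ioo_subset_Ioo ha hb) hint
    rw [ae_restrict_iff' measurableSet_Ioo] at h1
    by_contra hcon
    push Not at hcon
    have h2 : volume (Ioo a b) = 0 := by
      refine measure_mono_null (fun r hr => ?_) h1
      simp only [mem_compl_iff, mem_ofPred_eq, not_forall]
      exact ⟨hr, hcon r hr⟩
    rw [Real.volume_Ioo] at h2
    simp at h2
    linarith
  obtain ⟨p, hp, hpi⟩ := hpick dL ((dL + dH) / 2) le_rfl (by linarith) (by linarith)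
  obtain ⟨q, hq, hqi⟩ := hpick ((dL + dH) / 2) dH (by linarith) (by linarith) le_rfl
  have hpq : 0 < q - p := by linarith [hp.2, hq.1]
  have hp' : p ∈ Ioo dL dH := ⟨hp.1, by linarith [hp.2]⟩
  have hq' : q ∈ Ioo dL dH := ⟨by linarith [hq.1], hq.2⟩
  have hdom : Integrable (fun y => (q - p)⁻¹ * (|q - s| * |φ y p| + |p - s| * |φ y q|
      + (|q - s| * (B * (p - s) ^ 2) + |p - s| * (B * (q - s) ^ 2)))) ν :=
    ((((hpi.abs.const_mul _).add (hqi.abs.const_mul _))).add (integrable_const _)).const_mul _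
  refine hdom.mono' (hφ.comp (measurable_id.prodMk measurable_const)).aestronglyMeasurable ?_
  filter_upwards [hC2, hB] with y h1 h2
  have hP := abs_taylor_le h1 h2 hs hp'
  have hQ := abs_taylor_le h1 h2 hs hq'
  set P := φ y p - φ y s - deriv (φ y) s * (p - s)
  set Q := φ y q - φ y s - deriv (φ y) s * (q - s)
  -- The combination (q - s)·[expansion at p] - (p - s)·[expansion at q] in which the unknown
  -- derivative at s cancels.
  have heq : φ y s = (q - p)⁻¹ * ((q - s) * φ y p - (p - s) * φ y q - ((q - s) * P - (p - s) * Q)) := by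
    rw [eq_inv_mul_iff_mul_eq₀ hpq.ne']
    simp only [P, Q]
    ring
  rw [Real.norm_eq_abs, heq, abs_mul, abs_of_pos (inv_pos.2 hpq)]
  have t1 := abs_sub ((q - s) * φ y p - (p - s) * φ y q) ((q - s) * P - (p - s) * Q)
  have t2 := abs_sub ((q - s) * φ y p) ((p - s) * φ y q)
  have t3 := abs_sub ((q - s) * P) ((p - s) * Q)
  simp only [abs_mul] at t1 t2 t3
  have t4 : |q - s| * |P| ≤ |q - s| * (B * (p - s) ^ 2) := by gcongr
  have t5 : |p - s| * |Q| ≤ |p - s| * (B * (q - s) ^ 2) := by gcongr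
  gcongr
  linarith

/-- Integrating the pointwise expansion against w preserves its form; the slope is ∫ w φ'(d) and the
remainder constant is the integral of W B. The work lies in showing that the derivative at d is an
integrable function of y. -/
theorem exists_taylor_integral (hφ : Measurable (Function.uncurry φ)) {w : E → ℝ}
    (hw : Measurable w) {W : ℝ} (hwb : ∀ᵐ y ∂ν, |w y| ≤ W)
    (hC2 : ∀ᵐ y ∂ν, ContDiffOn ℝ 2 (φ y) (Ioo dL dH))
    (hB : ∀ᵐ y ∂ν, ∀ s ∈ Ioo dL dH, |iteratedDeriv 2 (φ y) s| ≤ B)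
    (hint : ∀ᵐ s ∂volume.restrict (Ioo dL dH), Integrable (fun y => φ y s) ν) {d : ℝ}
    (hd : d ∈ Ioo dL dH) :
    ∃ L B' : ℝ, ∀ s ∈ Ioo dL dH,
      |∫ y, w y * φ y s ∂ν - ∫ y, w y * φ y d ∂ν - L * (s - d)| ≤ B' * (s - d) ^ 2 := by
  have hlt : dL < dH := hd.1.trans hd.2
  have hI : ∀ s ∈ Ioo dL dH, Integrable (fun y => φ y s) ν := fun s hs =>
    integrable_section_of_ae hφ hlt hC2 hB hint hs
  have hwI : ∀ f : E → ℝ, Integrable f ν → Integrable (fun y => w y * f y) ν := fun f hf =>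
    hf.bdd_mul hw.aestronglyMeasurable hwb
  set r : ℝ := (dH - d) / 2 with hr
  have hr0 : 0 < r := by rw [hr]; linarith [hd.2]
  have hmem : ∀ n : ℕ, d + r / (n + 1) ∈ Ioo dL dH := fun n => by
    have h0 : 0 < r / (n + 1) := by positivity
    have h1 : r / (n + 1) ≤ r := div_le_self hr0.le (by linarith [n.cast_nonneg (α := ℝ)])
    exact ⟨by linarith [hd.1], by linarith⟩
  -- The derivative is an almost everywhere limit of measurable difference quotients along points d
  -- + r/(n+1) that stay inside the interval.
  have hDm : AEStronglyMeasurable (fun y => deriv (φ y) d) ν := by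
    refine aestronglyMeasurable_of_tendsto_ae atTop
      (f := fun (n : ℕ) y => (φ y (d + r / (n + 1)) - φ y d) / (r / (n + 1))) (fun n => ?_) ?_
    · exact ((hφ.comp (measurable_id.prodMk measurable_const)).sub
        (hφ.comp (measurable_id.prodMk measurable_const))).div_const _ |>.aestronglyMeasurable
    · filter_upwards [hC2, hB] with y h1 h2
      have hlim : Tendsto (fun n : ℕ => B * (r / ((n : ℝ) + 1))) atTop (𝓝 0) := by
        have := (tendsto_one_div_add_atTop_nhds_zero_nat (𝕜 := ℝ)).const_mul (B * r)
        rw [mul_zero] at this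
        refine this.congr fun n => by ring
      refine tendsto_iff_norm_sub_tendsto_zero.2 (squeeze_zero (fun _ => norm_nonneg _)
        (fun n => ?_) hlim)
      have h0 : 0 < r / ((n : ℝ) + 1) := by positivity
      have h := abs_taylor_le h1 h2 hd (hmem n)
      rw [add_sub_cancel_left] at h
      rw [Real.norm_eq_abs]
      have he : (φ y (d + r / (n + 1)) - φ y d) / (r / (n + 1)) - deriv (φ y) d
          = (φ y (d + r / (n + 1)) - φ y d - deriv (φ y) d * (r / (n + 1))) / (r / (n + 1)) := by
        field_simp
      rw [he, abs_div, abs_of_pos h0, div_le_iff₀ h0]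
      linarith [h]
  -- Solving the expansion at a single further point p for the derivative bounds it by two
  -- integrable sections and a constant.
  have hDi : Integrable (fun y => deriv (φ y) d) ν := by
    have hm := hmem 0
    set p := d + r / ((0 : ℕ) + 1)
    have hp : 0 < p - d := by simp [p]; positivity
    have hdom : Integrable (fun y => (p - d)⁻¹ * (|φ y p| + |φ y d| + B * (p - d) ^ 2)) ν :=
      (((hI p hm).abs.add (hI d hd).abs).add (integrable_const _)).const_mul _
    refine hdom.mono' hDm ?_
    filter_upwards [hC2, hB] with y h1 h2
    have h := abs_taylor_le h1 h2 hd hm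
    rw [Real.norm_eq_abs, ← div_eq_inv_mul, le_div_iff₀ hp]
    rw [← abs_of_pos hp, ← abs_mul, abs_of_pos hp]
    have t1 := abs_sub (φ y p - φ y d) (φ y p - φ y d - deriv (φ y) d * (p - d))
    rw [sub_sub_cancel] at t1
    have t2 := abs_sub (φ y p) (φ y d)
    linarith
  refine ⟨∫ y, w y * deriv (φ y) d ∂ν, ∫ _, W * B ∂ν, fun s hs => ?_⟩
  have hs' := hwI _ (hI s hs)
  have hd' := hwI _ (hI d hd)
  have hD' := hwI _ hDi
  have hsd : Integrable (fun y => w y * φ y s - w y * φ y d) ν := hs'.sub hd'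
  rw [← integral_sub hs' hd', ← integral_mul_const, ← integral_mul_const,
    ← integral_sub hsd (hD'.mul_const _)]
  rw [← Real.norm_eq_abs]
  refine norm_integral_le_of_norm_le ((integrable_const _)) ?_
  filter_upwards [hwb, hC2, hB] with y h0 h1 h2
  have h := abs_taylor_le h1 h2 hd hs
  rw [show w y * φ y s - w y * φ y d - w y * deriv (φ y) d * (s - d)
    = w y * (φ y s - φ y d - deriv (φ y) d * (s - d)) by ring, Real.norm_eq_abs, abs_mul, mul_assoc]
  have hB0 : 0 ≤ B := (abs_nonneg _).trans (h2 s hs)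
  gcongr
  exact (abs_nonneg _).trans h0

end Parametric

theorem continuousAt_of_taylor {G : ℝ → ℝ} {dL dH d L B : ℝ} (hd : d ∈ Ioo dL dH)
    (h : ∀ s ∈ Ioo dL dH, |G s - G d - L * (s - d)| ≤ B * (s - d) ^ 2) : ContinuousAt G d := by
  have hlim : Tendsto (fun s => |L * (s - d)| + B * (s - d) ^ 2) (𝓝 d) (𝓝 0) := by
    have : Continuous (fun s => |L * (s - d)| + B * (s - d) ^ 2) := by fun_prop
    simpa using this.tendsto d
  refine tendsto_iff_norm_sub_tendsto_zero.2 (squeeze_zero' (.of_forall fun _ => norm_nonneg _)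
    ?_ hlim)
  filter_upwards [isOpen_Ioo.mem_nhds hd] with s hs
  have h1 := h s hs
  have h2 := abs_add_le (G s - G d - L * (s - d)) (L * (s - d))
  rw [sub_add_cancel] at h2
  rw [Real.norm_eq_abs]
  linarith

/-! ### Kernel smoothing -/

theorem integral_rescale_mul (Ker G : ℝ → ℝ) {h : ℝ} (hh : 0 < h) (d : ℝ) :
    ∫ s, rescale Ker h (s - d) * G s = ∫ u, Ker u * G (d + h * u) := by
  rw [← integral_add_left_eq_self (fun s => rescale Ker h (s - d) * G s) d]
  have := Measure.integral_comp_mul_left (fun s => rescale Ker h (d + s - d) * G (d + s)) h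
  rw [abs_of_pos (inv_pos.2 hh), smul_eq_mul, eq_inv_mul_iff_mul_eq₀ hh.ne'] at this
  rw [← this, ← integral_const_mul]
  refine integral_congr_ae (ae_of_all _ fun u => ?_)
  simp only [rescale, add_sub_cancel_left]
  rw [mul_div_cancel_left₀ _ hh.ne']
  field_simp

namespace Population.KernelAssumption

variable {Ker : ℝ → ℝ}

theorem measurable (hk : KernelAssumption Ker) : Measurable Ker :=
  hk.differentiable.continuous.measurable

theorem measurable_rescale (hk : KernelAssumption Ker) (h : ℝ) : Measurable (rescale Ker h) :=
  (hk.measurable.comp (measurable_id.div_const h)).const_mul _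

theorem integrable_mul_self (hk : KernelAssumption Ker) : Integrable (fun u => u * Ker u) := by
  refine (hk.integrable.abs.add hk.integrable_sq.abs).mono'
    (measurable_id.mul hk.measurable).aestronglyMeasurable (ae_of_all _ fun u => ?_)
  simp only [Real.norm_eq_abs, Pi.add_apply, abs_mul, abs_pow, sq_abs]
  have : |u| ≤ 1 + u ^ 2 := by nlinarith [sq_abs u, sq_nonneg (|u| - 1)]
  nlinarith [abs_nonneg (Ker u)]

theorem exists_bound (hk : KernelAssumption Ker) :
    ∃ B > 0, ∀ h > 0, ∀ u, |rescale Ker h u| ≤ B / h := by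
  obtain ⟨B, hB⟩ := hk.bounded
  refine ⟨|B| + 1, by positivity, fun h hh u => ?_⟩
  rw [rescale, abs_mul, abs_of_pos (inv_pos.2 hh), ← div_eq_inv_mul]
  gcongr
  linarith [hB (u / h), le_abs_self B]

/-- The cubic tail gives K(-d/h) = O(h³) for small h, and the prefactor 1/h leaves h². For large h
the crude bound B/h is enough, since h is then bounded below by d/v. The estimate thus holds for
every h > 0. -/
theorem exists_tail_bound (hk : KernelAssumption Ker) {d : ℝ} (hd : 0 < d) :
    ∃ B ≥ 0, ∀ h > 0, |rescale Ker h (0 - d)| ≤ B * h ^ 2 := by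
  obtain ⟨B, hB0, hB⟩ := hk.exists_bound
  obtain ⟨c, hc⟩ := hk.tail.bound
  obtain ⟨u₀, hu₀⟩ := eventually_atBot.1 hc
  set v : ℝ := |u₀| + 1 with hv
  have hv0 : 0 < v := by positivity
  refine ⟨max (|c| / d ^ 3) (B * v ^ 3 / d ^ 3), by positivity, fun h hh => ?_⟩
  by_cases hcase : v ≤ d / h
  · have hu : (0 - d) / h ≤ u₀ := by
      have : (0 - d) / h = -(d / h) := by ring
      rw [this]
      linarith [neg_abs_le u₀]
    have h1 := hu₀ _ hu
    simp only [Real.norm_eq_abs, abs_one, mul_one, abs_mul, abs_pow] at h1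
    have h2 : |(0 - d) / h| = d / h := by
      rw [zero_sub, abs_div, abs_neg, abs_of_pos hd, abs_of_pos hh]
    rw [h2] at h1
    have h3 : |Ker ((0 - d) / h)| ≤ |c| / d ^ 3 * h ^ 3 := by
      rw [div_mul_eq_mul_div, le_div_iff₀ (by positivity)]
      calc |Ker ((0 - d) / h)| * d ^ 3 = ((d / h) ^ 3 * |Ker ((0 - d) / h)|) * h ^ 3 := by
            field_simp
        _ ≤ |c| * h ^ 3 := by gcongr; exact h1.trans (le_abs_self c)
    rw [rescale, abs_mul, abs_of_pos (inv_pos.2 hh)]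
    calc h⁻¹ * |Ker ((0 - d) / h)| ≤ h⁻¹ * (|c| / d ^ 3 * h ^ 3) := by gcongr
      _ = |c| / d ^ 3 * h ^ 2 := by field_simp
      _ ≤ _ := by gcongr; exact le_max_left _ _
  · have h1 : d ≤ v * h := by
      rw [not_le, div_lt_iff₀ hh] at hcase
      exact hcase.le
    calc |rescale Ker h (0 - d)| ≤ B / h := hB h hh _
      _ = B / (h * d ^ 3) * d ^ 3 := by field_simp
      _ ≤ B / (h * d ^ 3) * (v * h) ^ 3 := by gcongr
      _ = B * v ^ 3 / d ^ 3 * h ^ 2 := by field_simp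
      _ ≤ _ := by gcongr; exact le_max_right _ _

theorem integrable_rescale (hk : KernelAssumption Ker) {h : ℝ} (hh : 0 < h) (d : ℝ) :
    Integrable (fun s => rescale Ker h (s - d)) :=
  ((hk.integrable.comp_div hh.ne').const_mul _).comp_sub_right d

theorem integral_abs_rescale {h : ℝ} (hh : 0 < h) (d : ℝ) :
    ∫ s, |rescale Ker h (s - d)| = ∫ u, |Ker u| := by
  have := integral_rescale_mul (fun u => |Ker u|) (fun _ => 1) hh d
  simp only [mul_one] at this
  rw [← this]
  refine integral_congr_ae (ae_of_all _ fun s => ?_)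
  simp [rescale, abs_mul, abs_of_pos hh]

/-- After the substitution s = d + hu, ∫ K = 1 reproduces G d, ∫ uK = 0 kills the linear term, and
integrability of u²K bounds the remainder by a multiple of h². Extending G by zero lets the moments
over the whole line be used. -/
theorem exists_smoothing_bound (hk : KernelAssumption Ker) {dL dH d : ℝ} (hd : d ∈ Ioo dL dH)
    {G : ℝ → ℝ} (hG : Measurable G) {L B : ℝ}
    (hT : ∀ s ∈ Ioo dL dH, |G s - G d - L * (s - d)| ≤ B * (s - d) ^ 2) :
    ∃ C ≥ 0, ∀ h > 0, |(∫ s in Ioo dL dH, rescale Ker h (s - d) * G s) - G d| ≤ C * h ^ 2 := by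
  set G' : ℝ → ℝ := (Ioo dL dH).indicator G with hG'
  set r : ℝ := min (d - dL) (dH - d)
  have hr : 0 < r := lt_min (by linarith [hd.1]) (by linarith [hd.2])
  -- Outside the interval |s - d| ≥ r, so the constant and linear parts of the expansion are
  -- themselves multiples of (s - d)². With this larger constant the expansion of the zero extension
  -- is global.
  set B' : ℝ := |B| + |G d| / r ^ 2 + |L| / r with hB'
  have hB'0 : 0 ≤ B' := by positivity
  have hT' : ∀ s, |G' s - G d - L * (s - d)| ≤ B' * (s - d) ^ 2 := by
    intro s
    by_cases hs : s ∈ Ioo dL dH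
    · rw [hG', indicator_of_mem hs]
      refine (hT s hs).trans ?_
      gcongr
      have : 0 ≤ |G d| / r ^ 2 + |L| / r := by positivity
      linarith [le_abs_self B]
    · rw [hG', indicator_of_notMem hs]
      have hrs : r ≤ |s - d| := by
        rw [mem_Ioo, not_and_or, not_lt, not_lt] at hs
        rcases hs with hs | hs
        · rw [abs_of_nonpos (by linarith [hd.1])]
          linarith [min_le_left (d - dL) (dH - d)]
        · rw [abs_of_nonneg (by linarith [hd.2])]
          linarith [min_le_right (d - dL) (dH - d)]
      have h1 : |G d| ≤ |G d| / r ^ 2 * (s - d) ^ 2 := by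
        rw [div_mul_eq_mul_div, le_div_iff₀ (by positivity), ← sq_abs (s - d)]
        gcongr
      have h2 : |L| * |s - d| ≤ |L| / r * (s - d) ^ 2 := by
        rw [div_mul_eq_mul_div, le_div_iff₀ hr, ← sq_abs (s - d), mul_assoc, sq]
        gcongr
      have h3 : |0 - G d - L * (s - d)| ≤ |G d| + |L| * |s - d| := by
        rw [zero_sub, ← abs_mul, ← abs_neg (G d)]
        exact abs_sub _ _
      have h4 : 0 ≤ |B| * (s - d) ^ 2 := by positivity
      rw [hB', add_mul, add_mul]
      linarith
  have hi2 : Integrable (fun u => |u ^ 2 * Ker u|) := hk.integrable_sq.abs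
  refine ⟨B' * ∫ u, |u ^ 2 * Ker u|, mul_nonneg hB'0 (integral_nonneg fun _ => abs_nonneg _),
    fun h hh => ?_⟩
  have hbd : ∀ u, ‖Ker u * (G' (d + h * u) - G d - L * (h * u))‖
      ≤ B' * h ^ 2 * |u ^ 2 * Ker u| := by
    intro u
    have := hT' (d + h * u)
    rw [add_sub_cancel_left] at this
    rw [Real.norm_eq_abs, abs_mul, abs_mul, abs_of_nonneg (sq_nonneg u)]
    calc |Ker u| * |G' (d + h * u) - G d - L * (h * u)| ≤ |Ker u| * (B' * (h * u) ^ 2) := by gcongr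
      _ = _ := by ring
  have hG'm : Measurable G' := hG.indicator measurableSet_Ioo
  have hint : Integrable (fun u => Ker u * (G' (d + h * u) - G d - L * (h * u))) := by
    refine (hi2.const_mul (B' * h ^ 2)).mono' ?_ (ae_of_all _ hbd)
    have : Measurable (fun u => G' (d + h * u)) := hG'm.comp (by fun_prop)
    exact (hk.measurable.mul ((this.sub_const _).sub (by fun_prop))).aestronglyMeasurable
  have h1 : ∫ s in Ioo dL dH, rescale Ker h (s - d) * G s = ∫ u, Ker u * G' (d + h * u) := by
    rw [← integral_rescale_mul Ker G' hh d, ← integral_indicator measurableSet_Ioo]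
    refine integral_congr_ae (ae_of_all _ fun s => ?_)
    simp only [hG', indicator_apply]
    split_ifs <;> simp
  have h2 : ∫ u, Ker u * G' (d + h * u)
      = (∫ u, Ker u * (G' (d + h * u) - G d - L * (h * u))) + G d := by
    have e : (fun u => Ker u * G' (d + h * u)) = fun u =>
        Ker u * (G' (d + h * u) - G d - L * (h * u)) + (G d * Ker u + L * h * (u * Ker u)) := by
      funext u; ring
    have hlin : Integrable (fun u => G d * Ker u + L * h * (u * Ker u)) :=
      (hk.integrable.const_mul _).add (hk.integrable_mul_self.const_mul _)
    rw [e, integral_add hint hlin,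
      integral_add (hk.integrable.const_mul _) (hk.integrable_mul_self.const_mul _),
      integral_const_mul, integral_const_mul, hk.integral_eq_one, hk.first_moment]
    ring
  rw [h1, h2, add_sub_cancel_right, ← Real.norm_eq_abs]
  refine (norm_integral_le_of_norm_le (hi2.const_mul (B' * h ^ 2)) (ae_of_all _ hbd)).trans ?_
  rw [integral_const_mul]
  apply le_of_eq
  ring

end Population.KernelAssumption

/-! ### Variables with a smooth joint density with the dose -/

/-- On `{D ∈ (d_L, d_H)}` the pair `(U, D)` has density `φ` with respect to `ν ⊗ volume`, and `φ`
is `C²` in the dose with a uniformly bounded second derivative. -/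
structure JointDensity {Ω E : Type*} [MeasurableSpace Ω] [MeasurableSpace E] (P : Measure Ω)
    (D : Ω → ℝ) (U : Ω → E) (ν : Measure E) (φ : E → ℝ → ℝ) (dL dH : ℝ) : Prop where
  measurable_dose : Measurable D
  measurable_var : Measurable U
  measurable_density : Measurable (Function.uncurry φ)
  nonneg : ∀ u, ∀ s ∈ Ioo dL dH, 0 ≤ φ u s
  law : (P.map (fun ω => (U ω, D ω))).restrict (univ ×ˢ Ioo dL dH)
    = (ν.prod (volume.restrict (Ioo dL dH))).withDensity (fun p => ENNReal.ofReal (φ p.1 p.2))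
  contDiffOn : ∀ᵐ u ∂ν, ContDiffOn ℝ 2 (φ u) (Ioo dL dH)
  deriv_bound : ∃ B, ∀ᵐ u ∂ν, ∀ s ∈ Ioo dL dH, |iteratedDeriv 2 (φ u) s| ≤ B

namespace JointDensity

variable {Ω E : Type*} [MeasurableSpace Ω] [MeasurableSpace E] {P : Measure Ω}
  {D : Ω → ℝ} {U : Ω → E} {ν : Measure E} {φ : E → ℝ → ℝ} {dL dH : ℝ}

theorem integrable [IsFiniteMeasure P] (hJ : JointDensity P D U ν φ dL dH) :
    Integrable (fun p : E × ℝ => φ p.1 p.2) (ν.prod (volume.restrict (Ioo dL dH))) := by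
  have hm : Measurable (fun p : E × ℝ => φ p.1 p.2) := hJ.measurable_density
  have hlt : ∫⁻ p, ENNReal.ofReal (φ p.1 p.2) ∂(ν.prod (volume.restrict (Ioo dL dH))) < ⊤ := by
    rw [← setLIntegral_univ, ← withDensity_apply _ MeasurableSet.univ, ← hJ.law]
    exact measure_lt_top _ _
  have hnn : ∀ᵐ p ∂(ν.prod (volume.restrict (Ioo dL dH))), 0 ≤ φ p.1 p.2 := by
    have h2 : ∀ᵐ s ∂volume.restrict (Ioo dL dH), s ∈ Ioo dL dH :=
      ae_restrict_mem measurableSet_Ioo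
    have h3 : ∀ᵐ p ∂(ν.prod (volume.restrict (Ioo dL dH))), p.2 ∈ Ioo dL dH :=
      Measure.quasiMeasurePreserving_snd.ae h2
    filter_upwards [h3] with p hp
    exact hJ.nonneg _ _ hp
  refine ⟨hm.aestronglyMeasurable, ?_⟩
  rwa [hasFiniteIntegral_iff_ofReal hnn]

theorem measurable_integral [IsFiniteMeasure ν] (hJ : JointDensity P D U ν φ dL dH) {w : E → ℝ}
    (hw : Measurable w) : Measurable (fun s => ∫ u, w u * φ u s ∂ν) := by
  have : Measurable (fun p : ℝ × E => w p.2 * φ p.2 p.1) :=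
    (hw.comp measurable_snd).mul (hJ.measurable_density.comp measurable_swap)
  exact this.stronglyMeasurable.integral_prod_right'.measurable

theorem integrable_mul [IsFiniteMeasure P] (hJ : JointDensity P D U ν φ dL dH) {w : E → ℝ}
    (hw : Measurable w) {W : ℝ} (hwb : ∀ᵐ u ∂ν, |w u| ≤ W) :
    Integrable (fun p : E × ℝ => w p.1 * φ p.1 p.2) (ν.prod (volume.restrict (Ioo dL dH))) :=
  hJ.integrable.bdd_mul (hw.comp measurable_fst).aestronglyMeasurable
    (Measure.quasiMeasurePreserving_fst.ae hwb)

variable [IsFiniteMeasure P] [IsFiniteMeasure ν]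

theorem ae_integrable_section (hJ : JointDensity P D U ν φ dL dH) :
    ∀ᵐ s ∂volume.restrict (Ioo dL dH), Integrable (fun u => φ u s) ν :=
  hJ.integrable.prod_left_ae

theorem integrable_section (hJ : JointDensity P D U ν φ dL dH) {s : ℝ} (hs : s ∈ Ioo dL dH) :
    Integrable (fun u => φ u s) ν := by
  obtain ⟨B, hB⟩ := hJ.deriv_bound
  exact integrable_section_of_ae hJ.measurable_density (hs.1.trans hs.2) hJ.contDiffOn hB
    hJ.ae_integrable_section hs

theorem setIntegral_eq (hJ : JointDensity P D U ν φ dL dH) {w : E → ℝ} (hw : Measurable w) {W : ℝ}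
    (hwb : ∀ᵐ u ∂ν, |w u| ≤ W) {χ : ℝ → ℝ} (hχ : Measurable χ) {B : ℝ} (hB : ∀ s, |χ s| ≤ B) :
    ∫ ω in D ⁻¹' Ioo dL dH, w (U ω) * χ (D ω) ∂P
      = ∫ s in Ioo dL dH, χ s * ∫ u, w u * φ u s ∂ν := by
  have hUD : Measurable (fun ω => (U ω, D ω)) := hJ.measurable_var.prodMk hJ.measurable_dose
  have hset : MeasurableSet ((univ : Set E) ×ˢ Ioo dL dH) := MeasurableSet.univ.prod measurableSet_Ioo
  have hpre : D ⁻¹' Ioo dL dH = (fun ω => (U ω, D ω)) ⁻¹' (univ ×ˢ Ioo dL dH) := by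
    ext; simp
  have hwχ : Measurable (fun p : E × ℝ => w p.1 * χ p.2) :=
    (hw.comp measurable_fst).mul (hχ.comp measurable_snd)
  have hdm : Measurable (fun p : E × ℝ => ENNReal.ofReal (φ p.1 p.2)) :=
    ENNReal.measurable_ofReal.comp hJ.measurable_density
  rw [hpre, ← setIntegral_map hset hwχ.aestronglyMeasurable hUD.aemeasurable, hJ.law,
    integral_withDensity_eq_integral_toReal_smul hdm (by simp)]
  have hint : Integrable (fun p : E × ℝ => χ p.2 * (w p.1 * φ p.1 p.2))
      (ν.prod (volume.restrict (Ioo dL dH))) :=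
    (hJ.integrable_mul hw hwb).bdd_mul (c := B) (hχ.comp measurable_snd).aestronglyMeasurable
      (ae_of_all _ fun p => hB p.2)
  have h3 : ∀ᵐ p ∂(ν.prod (volume.restrict (Ioo dL dH))), p.2 ∈ Ioo dL dH :=
    Measure.quasiMeasurePreserving_snd.ae
      (ae_restrict_mem measurableSet_Ioo : ∀ᵐ s ∂volume.restrict (Ioo dL dH), s ∈ Ioo dL dH)
  rw [integral_congr_ae (g := fun p : E × ℝ => χ p.2 * (w p.1 * φ p.1 p.2)),
    integral_prod_symm _ hint]
  · exact integral_congr_ae (ae_of_all _ fun s => integral_const_mul (χ s) _)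
  · filter_upwards [h3] with p hp
    rw [ENNReal.toReal_ofReal (hJ.nonneg _ _ hp), smul_eq_mul]
    ring

theorem exists_taylor (hJ : JointDensity P D U ν φ dL dH) {w : E → ℝ} (hw : Measurable w) {W : ℝ}
    (hwb : ∀ᵐ u ∂ν, |w u| ≤ W) {d : ℝ} (hd : d ∈ Ioo dL dH) :
    ∃ L B' : ℝ, ∀ s ∈ Ioo dL dH,
      |∫ y, w y * φ y s ∂ν - ∫ y, w y * φ y d ∂ν - L * (s - d)| ≤ B' * (s - d) ^ 2 := by
  obtain ⟨B, hB⟩ := hJ.deriv_bound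
  exact exists_taylor_integral hJ.measurable_density hw hwb hJ.contDiffOn hB
    hJ.ae_integrable_section hd

theorem continuousOn_integral (hJ : JointDensity P D U ν φ dL dH) {w : E → ℝ} (hw : Measurable w)
    {W : ℝ} (hwb : ∀ᵐ u ∂ν, |w u| ≤ W) :
    ContinuousOn (fun s => ∫ u, w u * φ u s ∂ν) (Ioo dL dH) := by
  intro s hs
  obtain ⟨L, B', h⟩ := hJ.exists_taylor hw hwb hs
  exact (continuousAt_of_taylor (G := fun s => ∫ u, w u * φ u s ∂ν) hs h).continuousWithinAt

/-- Kernel smoothing of a moment at an interior dose has a bias of order `h²`. -/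
theorem exists_smoothing_bound (hJ : JointDensity P D U ν φ dL dH) {Ker : ℝ → ℝ}
    (hk : Population.KernelAssumption Ker) {w : E → ℝ} (hw : Measurable w) {W : ℝ}
    (hwb : ∀ᵐ u ∂ν, |w u| ≤ W) {d : ℝ} (hd : d ∈ Ioo dL dH) :
    ∃ C ≥ 0, ∀ h > 0, |(∫ ω in D ⁻¹' Ioo dL dH, w (U ω) * rescale Ker h (D ω - d) ∂P)
      - ∫ u, w u * φ u d ∂ν| ≤ C * h ^ 2 := by
  obtain ⟨L, B', h⟩ := hJ.exists_taylor hw hwb hd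
  obtain ⟨C, hC0, hC⟩ := hk.exists_smoothing_bound hd (hJ.measurable_integral hw) h
  obtain ⟨B, _, hB⟩ := hk.exists_bound
  refine ⟨C, hC0, fun h hh => ?_⟩
  rw [hJ.setIntegral_eq hw hwb (χ := fun s => rescale Ker h (s - d))
    ((hk.measurable_rescale h).comp (measurable_id.sub_const d)) (fun s => hB h hh _)]
  exact hC h hh

/-- Two versions of a regression on the dose agree at every interior dose if both are
continuous. -/
theorem integral_eq_of_regression (hJ : JointDensity P D U ν φ dL dH) {w : E → ℝ}
    (hw : Measurable w) {W : ℝ} (hwb : ∀ᵐ u ∂ν, |w u| ≤ W) {fD : ℝ → ℝ} (hfm : Measurable fD)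
    (hf0 : ∀ s ∈ Ioo dL dH, 0 ≤ fD s) (hfc : ContinuousOn fD (Ioo dL dH))
    (hfD : (P.map D).restrict (Ioo dL dH)
      = (volume.restrict (Ioo dL dH)).withDensity (fun s => ENNReal.ofReal (fD s)))
    {Q : Kernel ℝ Ω} [IsMarkovKernel Q]
    (hQ : (P.map D) ⊗ₘ Q = P.map (fun ω => (D ω, ω))) {F : Ω → ℝ} (hF : Integrable F P)
    (hFm : Measurable F) (hFc : ContinuousOn (fun s => ∫ ω, F ω ∂(Q s)) (Ioo dL dH))
    (hE : ∀ B, MeasurableSet B → B ⊆ Ioo dL dH →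
      ∫ ω in D ⁻¹' B, w (U ω) ∂P = ∫ ω in D ⁻¹' B, F ω ∂P) {s : ℝ} (hs : s ∈ Ioo dL dH) :
    ∫ u, w u * φ u s ∂ν = fD s * ∫ ω, F ω ∂(Q s) := by
  have hD := hJ.measurable_dose
  have hDi : Measurable (fun ω => (D ω, ω)) := hD.prodMk measurable_id
  have hofm : Measurable (fun s => ENNReal.ofReal (fD s)) := ENNReal.measurable_ofReal.comp hfm
  have hFi : Integrable (fun p : ℝ × Ω => F p.2) ((P.map D) ⊗ₘ Q) := by
    rw [hQ]
    exact (integrable_map_measure (hFm.comp measurable_snd).aestronglyMeasurable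
      hDi.aemeasurable).2 hF
  have hreg : Integrable (fun s => ∫ ω, F ω ∂(Q s)) (P.map D) := by
    have := Integrable.integral_compProd (κ := Kernel.const Unit (P.map D))
      (η := Kernel.prodMkLeft Unit Q) (a := ()) hFi
    simpa using this
  have hreg2 : Integrable (fun s => fD s * ∫ ω, F ω ∂(Q s)) (volume.restrict (Ioo dL dH)) := by
    have h1 := hreg.restrict (s := Ioo dL dH)
    rw [hfD, integrable_withDensity_iff_integrable_smul' hofm (by simp)] at h1
    refine h1.congr ?_
    filter_upwards [ae_restrict_mem measurableSet_Ioo] with s hs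
    rw [ENNReal.toReal_ofReal (hf0 s hs), smul_eq_mul]
  have hG : Integrable (fun s => ∫ u, w u * φ u s ∂ν) (volume.restrict (Ioo dL dH)) :=
    (hJ.integrable_mul hw hwb).integral_prod_right
  -- Both functions are tested against Borel sets B. The joint density turns one side, and the
  -- disintegration of P along D the other, into integrals over {D ∈ B} that `hE` equates.
  have hae : (fun s => ∫ u, w u * φ u s ∂ν) =ᵐ[volume.restrict (Ioo dL dH)]
      (fun s => fD s * ∫ ω, F ω ∂(Q s)) := by
    refine Integrable.ae_eq_of_forall_setIntegral_eq _ _ hG hreg2 fun B hB _ => ?_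
    have hBI : MeasurableSet (B ∩ Ioo dL dH) := hB.inter measurableSet_Ioo
    have h1 := hE _ hBI inter_subset_right
    have h2 := hJ.setIntegral_eq hw hwb (χ := B.indicator 1) (measurable_one.indicator hB) (B := 1)
      (fun s => by by_cases h : s ∈ B <;> simp [h])
    have h3 : ∫ ω in D ⁻¹' Ioo dL dH, w (U ω) * B.indicator 1 (D ω) ∂P
        = ∫ ω in D ⁻¹' (B ∩ Ioo dL dH), w (U ω) ∂P := by
      rw [preimage_inter, inter_comm, ← setIntegral_indicator (hD hB)]
      refine integral_congr_ae (ae_of_all _ fun ω => ?_)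
      by_cases h : D ω ∈ B <;> simp [h]
    have h4 : ∫ s in Ioo dL dH, B.indicator 1 s * ∫ u, w u * φ u s ∂ν
        = ∫ s in B, (∫ u, w u * φ u s ∂ν) ∂(volume.restrict (Ioo dL dH)) := by
      rw [← integral_indicator hB]
      refine integral_congr_ae (ae_of_all _ fun s => ?_)
      by_cases h : s ∈ B <;> simp [h]
    have h5 : ∫ ω in D ⁻¹' (B ∩ Ioo dL dH), F ω ∂P
        = ∫ s in B ∩ Ioo dL dH, (∫ ω, F ω ∂(Q s)) ∂(P.map D) := by
      have := Measure.setIntegral_compProd (μ := P.map D) (κ := Q) (f := fun p : ℝ × Ω => F p.2)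
        hBI MeasurableSet.univ hFi.integrableOn
      have hFs : Measurable (fun p : ℝ × Ω => F p.2) := hFm.comp measurable_snd
      rw [hQ, setIntegral_map (hBI.prod MeasurableSet.univ) hFs.aestronglyMeasurable
        hDi.aemeasurable] at this
      simp only [Measure.restrict_univ] at this
      rw [← this]
      congr 2
      ext; simp
    have h6 : ∫ s in B ∩ Ioo dL dH, (∫ ω, F ω ∂(Q s)) ∂(P.map D)
        = ∫ s in B, (fD s * ∫ ω, F ω ∂(Q s)) ∂(volume.restrict (Ioo dL dH)) := by
      rw [← Measure.restrict_restrict hB, hfD, restrict_withDensity hB,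
        integral_withDensity_eq_integral_toReal_smul hofm (by simp)]
      refine integral_congr_ae ?_
      filter_upwards [ae_restrict_of_ae (ae_restrict_mem measurableSet_Ioo)] with s hs
      rw [ENNReal.toReal_ofReal (hf0 s hs), smul_eq_mul]
    rw [← h4, ← h2, h3, h1, h5, h6]
  -- Continuous functions that agree almost everywhere on an open set agree at each of its points.
  -- This is what gives a meaning to conditioning on the null event D = s.
  exact Measure.eqOn_open_of_ae_eq hae isOpen_Ioo (hJ.continuousOn_integral hw hwb)
    (hfc.mul hFc) hs

end JointDensity

/-! ### Mixtures of a point mass at zero and a density -/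

theorem restrict_of_eq_dirac_add {m : Measure ℝ} {a : ENNReal} {f : ℝ → ENNReal} {dL dH : ℝ}
    (hdL : 0 < dL)
    (hm : m = a • Measure.dirac 0 + (volume.restrict (Icc dL dH)).withDensity f) :
    m.restrict (Ioo dL dH) = (volume.restrict (Ioo dL dH)).withDensity f := by
  have h0 : (0 : ℝ) ∉ Ioo dL dH := fun h => by linarith [h.1]
  rw [hm, Measure.restrict_add, Measure.restrict_smul, restrict_withDensity measurableSet_Ioo,
    Measure.restrict_restrict measurableSet_Ioo, inter_eq_left.2 Ioo_subset_Icc_self,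
    restrict_dirac' measurableSet_Ioo, if_neg h0, smul_zero, zero_add]

/-- The end points of [d_L, d_H] are Lebesgue null, so the open interval, where smoothness is
assumed, carries all treated mass. -/
theorem ae_of_eq_dirac_add {m : Measure ℝ} {a : ENNReal} {f : ℝ → ENNReal} {dL dH : ℝ}
    (hm : m = a • Measure.dirac 0 + (volume.restrict (Icc dL dH)).withDensity f) :
    ∀ᵐ s ∂m, s = 0 ∨ s ∈ Ioo dL dH := by
  rw [hm, ae_add_measure_iff]
  constructor
  · exact Measure.ae_smul_measure ((ae_dirac_iff (measurableSet_eq.union measurableSet_Ioo)).2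
      (Or.inl rfl)) _
  · refine (withDensity_absolutelyContinuous _ _).ae_le ?_
    rw [← restrict_Ioo_eq_restrict_Icc]
    filter_upwards [ae_restrict_mem measurableSet_Ioo] with s hs using Or.inr hs

theorem restrict_compProd_eq_withDensity {E : Type*} [MeasurableSpace E] {ν : Measure E}
    [IsFiniteMeasure ν] {k : Kernel E ℝ} [IsFiniteKernel k] {φ : E → ℝ → ℝ}
    (hφ : Measurable (Function.uncurry φ)) {dL dH : ℝ}
    (h : ∀ᵐ x ∂ν, (k x).restrict (Ioo dL dH)
      = (volume.restrict (Ioo dL dH)).withDensity (fun s => ENNReal.ofReal (φ x s))) :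
    (ν ⊗ₘ k).restrict (univ ×ˢ Ioo dL dH)
      = (ν.prod (volume.restrict (Ioo dL dH))).withDensity
        (fun p => ENNReal.ofReal (φ p.1 p.2)) := by
  ext s hs
  have hI : MeasurableSet ((univ : Set E) ×ˢ Ioo dL dH) :=
    MeasurableSet.univ.prod measurableSet_Ioo
  have hm : Measurable (fun p : E × ℝ => ENNReal.ofReal (φ p.1 p.2)) :=
    ENNReal.measurable_ofReal.comp hφ
  rw [Measure.restrict_apply hs, Measure.compProd_apply (hs.inter hI), withDensity_apply _ hs,
    ← lintegral_indicator hs, lintegral_prod _ (hm.indicator hs).aemeasurable]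
  refine lintegral_congr_ae ?_
  filter_upwards [h] with x hx
  have hsec : MeasurableSet (Prod.mk x ⁻¹' s) := measurable_prodMk_left hs
  have he : Prod.mk x ⁻¹' (s ∩ univ ×ˢ Ioo dL dH) = Prod.mk x ⁻¹' s ∩ Ioo dL dH := by
    ext; simp
  rw [he, ← Measure.restrict_apply hsec, hx, withDensity_apply _ hsec, ← lintegral_indicator hsec]
  rfl

/-- The tower property, written with `condDistrib` so that it speaks about the versions in which
`g0`, `fh0` and `e0` are defined. -/
theorem integral_condDistrib_mul {Ω 𝒳 : Type*} [MeasurableSpace Ω] [MeasurableSpace 𝒳]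
    {m : Measure Ω} [IsFiniteMeasure m] {U : Ω → ℝ} {X : Ω → 𝒳} (hU : Measurable U)
    (hX : Measurable X) {ψ : ℝ → ℝ} (hψ : Measurable ψ) {φ : 𝒳 → ℝ} (hφ : Measurable φ)
    (hi : Integrable (fun ω => ψ (U ω) * φ (X ω)) m) :
    ∫ ω, ψ (U ω) * φ (X ω) ∂m
      = ∫ ω, (∫ u, ψ u ∂(condDistrib U X m (X ω))) * φ (X ω) ∂m := by
  have hm : Measurable (fun p : 𝒳 × ℝ => ψ p.2 * φ p.1) :=
    (hψ.comp measurable_snd).mul (hφ.comp measurable_fst)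
  have hXU : Measurable (fun ω => (X ω, U ω)) := hX.prodMk hU
  have hi' : Integrable (fun p : 𝒳 × ℝ => ψ p.2 * φ p.1) (m.map X ⊗ₘ condDistrib U X m) := by
    rw [compProd_map_condDistrib hU.aemeasurable]
    exact (integrable_map_measure hm.aestronglyMeasurable hXU.aemeasurable).2 hi
  have h1 := Measure.integral_compProd hi'
  rw [compProd_map_condDistrib hU.aemeasurable,
    integral_map hXU.aemeasurable hm.aestronglyMeasurable] at h1
  rw [h1]
  simp_rw [integral_mul_const]
  have h2 : Measurable (fun x => (∫ u, ψ u ∂(condDistrib U X m x)) * φ x) :=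
    (hψ.stronglyMeasurable.integral_kernel.measurable).mul hφ
  rw [integral_map hX.aemeasurable h2.aestronglyMeasurable]

theorem integral_cond_eq {Ω : Type*} [MeasurableSpace Ω] (m : Measure Ω) [IsFiniteMeasure m]
    (A : Set Ω) (F : Ω → ℝ) : ∫ ω, F ω ∂(cond m A) = (m.real A)⁻¹ * ∫ ω in A, F ω ∂m := by
  rw [ProbabilityTheory.cond, integral_smul_measure, smul_eq_mul, ENNReal.toReal_inv]
  rfl

/-! ### Consequences of the population assumptions: joint densities, outcome bounds, reweighting -/

namespace Population

variable {Ω 𝒳 : Type*} [MeasurableSpace Ω] [MeasurableSpace 𝒳] {M : Population Ω 𝒳}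

theorem measurable_Y (M : Population Ω 𝒳) : Measurable M.Y :=
  ((measurable_const.sub M.measurable_T).mul M.measurable_Ypre).add
    (M.measurable_T.mul M.measurable_Ypost)

theorem measurable_obs (M : Population Ω 𝒳) : Measurable M.obs :=
  M.measurable_Y.prodMk (M.measurable_T.prodMk (M.measurable_D.prodMk M.measurable_X))

theorem measurable_Ylam (M : Population Ω 𝒳) (P : Measure Ω) : Measurable (M.Ylam P) :=
  ((M.measurable_T.sub_const _).div_const _).mul M.measurable_Y

theorem measurable_e0 (M : Population Ω 𝒳) (P : Measure Ω) : Measurable (M.e0 P) :=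
  (measurable_id.stronglyMeasurable.integral_kernel).measurable

section

variable (M) (P : Measure Ω) [IsFiniteMeasure P]

theorem measurable_g0 : Measurable (M.g0 P) :=
  (Kernel.measurable_coe (condDistrib M.D M.X P) (measurableSet_singleton 0)).ennreal_toReal

theorem measurable_fh0 {Ker : ℝ → ℝ} (hk : KernelAssumption Ker) (h d : ℝ) :
    Measurable (M.fh0 P Ker h d) :=
  (((hk.measurable_rescale h).comp
    (measurable_id.sub_const d)).stronglyMeasurable.integral_kernel).measurable

end

theorem real_T_eq_zero (M : Population Ω 𝒳) (P : Measure Ω) [IsProbabilityMeasure P] :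
    P.real {ω | M.T ω = 0} = 1 - M.lam P := by
  have h1 : MeasurableSet {ω | M.T ω = 1} := measurableSet_eq_fun M.measurable_T measurable_const
  have : {ω | M.T ω = 0} = {ω | M.T ω = 1}ᶜ := by
    ext ω
    rcases M.T_binary ω with h | h <;> simp [h]
  rw [this, probReal_compl_eq_one_sub h1]
  rfl

/-- The assumptions on the population, the kernel and the bandwidth. -/
structure Assumptions (M : Population Ω 𝒳) (P : Measure Ω) [IsProbabilityMeasure P]
    (Q : Kernel ℝ Ω) (Ker : ℝ → ℝ) (h : ℕ → ℝ) (dL dH κ c C : ℝ)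
    (fD : ℝ → ℝ) (fDX : 𝒳 → ℝ → ℝ) (fYD : ℝ → ℝ → ℝ) : Prop where
  condProb : M.IsCondProbGivenDose P Q dL dH
  version : M.ContinuousVersion Q dL dH
  densities : M.HasDensities P dL dH fD fDX fYD
  crossSections : M.RepeatedCrossSections P
  support : M.Support P dL dH κ fDX
  noAnticipation : M.NoAnticipation
  trends : M.ParallelTrends Q dL dH
  kernel : KernelAssumption Ker
  bounds : M.BoundsSmoothness P Ker h dL dH c C fD fDX fYD

namespace Assumptions

variable {P : Measure Ω} [IsProbabilityMeasure P] {Q : Kernel ℝ Ω} {Ker : ℝ → ℝ} {h : ℕ → ℝ}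
  {dL dH κ c C d : ℝ} {fD : ℝ → ℝ} {fDX : 𝒳 → ℝ → ℝ} {fYD : ℝ → ℝ → ℝ}

theorem ae_dose (hA : M.Assumptions P Q Ker h dL dH κ c C fD fDX fYD) :
    ∀ᵐ ω ∂P, M.D ω = 0 ∨ M.D ω ∈ Ioo dL dH :=
  ae_of_ae_map M.measurable_D.aemeasurable (ae_of_eq_dirac_add hA.densities.law_dose)

theorem zero_notMem (hA : M.Assumptions P Q Ker h dL dH κ c C fD fDX fYD) :
    (0 : ℝ) ∉ Ioo dL dH := fun h => by linarith [h.1, hA.support.dL_pos]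

theorem integral_eq_add (hA : M.Assumptions P Q Ker h dL dH κ c C fD fDX fYD) {F : Ω → ℝ}
    (hF : Integrable F P) :
    ∫ ω, F ω ∂P = (∫ ω in M.D ⁻¹' Ioo dL dH, F ω ∂P) + ∫ ω in M.D ⁻¹' {0}, F ω ∂P := by
  have hm0 : MeasurableSet (M.D ⁻¹' {0}) := M.measurable_D (measurableSet_singleton 0)
  have hdisj : Disjoint (M.D ⁻¹' Ioo dL dH) (M.D ⁻¹' {0}) := by
    refine Disjoint.preimage _ (Set.disjoint_singleton_right.2 hA.zero_notMem)
  rw [← setIntegral_union hdisj hm0 hF.integrableOn hF.integrableOn,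
    Measure.restrict_eq_self_of_ae_mem]
  filter_upwards [hA.ae_dose] with ω hω
  exact hω.symm

theorem restrict_dose (hA : M.Assumptions P Q Ker h dL dH κ c C fD fDX fYD) :
    (P.map M.D).restrict (Ioo dL dH)
      = (volume.restrict (Ioo dL dH)).withDensity (fun s => ENNReal.ofReal (fD s)) :=
  restrict_of_eq_dirac_add hA.support.dL_pos hA.densities.law_dose

theorem jointX (hA : M.Assumptions P Q Ker h dL dH κ c C fD fDX fYD) :
    JointDensity P M.D M.X (P.map M.X) fDX dL dH where
  measurable_dose := M.measurable_D
  measurable_var := M.measurable_X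
  measurable_density := hA.densities.measurable_fDX
  nonneg x s hs := hA.densities.fDX_nonneg x s (Ioo_subset_Icc_self hs)
  law := by
    rw [← compProd_map_condDistrib M.measurable_D.aemeasurable]
    refine restrict_compProd_eq_withDensity hA.densities.measurable_fDX ?_
    filter_upwards [hA.densities.law_doseGiven] with x hx
    exact restrict_of_eq_dirac_add hA.support.dL_pos hx
  contDiffOn := hA.bounds.fDX_C2
  deriv_bound := hA.bounds.fDX_deriv

/-- A bound for `|Y^λ|`. -/
def boundYlam (M : Population Ω 𝒳) (P : Measure Ω) (C : ℝ) : ℝ := C / (M.lam P * (1 - M.lam P))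

theorem lam_mul_pos (hA : M.Assumptions P Q Ker h dL dH κ c C fD fDX fYD) :
    0 < M.lam P * (1 - M.lam P) :=
  mul_pos hA.crossSections.lam_pos (sub_pos.2 hA.crossSections.lam_lt_one)

theorem ae_Ylam_le (hA : M.Assumptions P Q Ker h dL dH κ c C fD fDX fYD) :
    ∀ᵐ ω ∂P, |M.Ylam P ω| ≤ boundYlam M P C := by
  filter_upwards [hA.bounds.Y_bound] with ω hω
  have h0 := hA.crossSections.lam_pos
  have h1 := hA.crossSections.lam_lt_one
  have hT : |M.T ω - M.lam P| ≤ 1 := by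
    rcases M.T_binary ω with h | h <;> rw [h, abs_le] <;> constructor <;> linarith
  rw [Ylam, boundYlam, abs_mul, abs_div, abs_of_pos hA.lam_mul_pos, div_mul_eq_mul_div]
  have h2 := hA.lam_mul_pos
  gcongr
  calc |M.T ω - M.lam P| * |M.Y ω| ≤ 1 * C := by gcongr
    _ = C := one_mul C

theorem boundYlam_pos (hA : M.Assumptions P Q Ker h dL dH κ c C fD fDX fYD) :
    0 < boundYlam M P C := div_pos hA.bounds.C_pos hA.lam_mul_pos

theorem support_Ylam_subset (hA : M.Assumptions P Q Ker h dL dH κ c C fD fDX fYD) :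
    (P.map (M.Ylam P)).support ⊆ Icc (-boundYlam M P C) (boundYlam M P C) := by
  refine Measure.support_subset_of_isClosed isClosed_Icc ?_
  refine (ae_map_iff (M.measurable_Ylam P).aemeasurable measurableSet_Icc).2 ?_
  filter_upwards [hA.ae_Ylam_le] with ω hω using abs_le.1 hω

/-- The support of Y^λ lies in a bounded interval because Y is bounded and λ is neither 0 nor 1. -/
theorem isFiniteMeasure_support (hA : M.Assumptions P Q Ker h dL dH κ c C fD fDX fYD) :
    IsFiniteMeasure (volume.restrict (P.map (M.Ylam P)).support) := by
  refine ⟨?_⟩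
  rw [Measure.restrict_apply_univ]
  exact (measure_mono hA.support_Ylam_subset).trans_lt measure_Icc_lt_top

theorem ae_support_Ylam_le (hA : M.Assumptions P Q Ker h dL dH κ c C fD fDX fYD) :
    ∀ᵐ y ∂(volume.restrict (P.map (M.Ylam P)).support), |id y| ≤ boundYlam M P C := by
  filter_upwards [ae_restrict_mem Measure.isClosed_support.measurableSet] with y hy
  exact abs_le.2 (hA.support_Ylam_subset hy)

/-- The reference measure is Lebesgue measure on the support of Y^λ, not on the line: the joint
density is assumed smooth only for outcomes in the support, and boundedness of the support makes the
measure finite, as the expansion of parametric integrals requires. -/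
theorem jointY (hA : M.Assumptions P Q Ker h dL dH κ c C fD fDX fYD) :
    JointDensity P M.D (M.Ylam P) (volume.restrict (P.map (M.Ylam P)).support) fYD dL dH where
  measurable_dose := M.measurable_D
  measurable_var := M.measurable_Ylam P
  measurable_density := hA.densities.measurable_fYD
  nonneg := hA.densities.fYD_nonneg
  law := by
    have hK : MeasurableSet (P.map (M.Ylam P)).support := Measure.isClosed_support.measurableSet
    -- The joint law already lives over the support of Y^λ, so restricting it there changes nothing
    -- and moves the restriction onto the reference measure.
    have hae : ∀ᵐ p ∂(P.map (fun ω => (M.Ylam P ω, M.D ω))).restrict (univ ×ˢ Ioo dL dH),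
        p ∈ (P.map (M.Ylam P)).support ×ˢ (univ : Set ℝ) := by
      refine ae_restrict_of_ae ((ae_map_iff ((M.measurable_Ylam P).prodMk
        M.measurable_D).aemeasurable (hK.prod MeasurableSet.univ)).2 ?_)
      filter_upwards [ae_of_ae_map (M.measurable_Ylam P).aemeasurable
        (Measure.support_mem_ae (μ := P.map (M.Ylam P)))] with ω hω
      exact ⟨hω, mem_univ _⟩
    rw [← Measure.restrict_eq_self_of_ae_mem hae, hA.densities.law_joint,
      restrict_withDensity (hK.prod MeasurableSet.univ),
      Measure.restrict_restrict (hK.prod MeasurableSet.univ), prod_inter_prod, inter_univ,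
      univ_inter, Measure.volume_eq_prod, ← Measure.prod_restrict]
  contDiffOn := by
    filter_upwards [ae_restrict_mem Measure.isClosed_support.measurableSet] with y hy
    exact hA.bounds.fYD_C2 y hy
  deriv_bound := by
    obtain ⟨B, hB⟩ := hA.bounds.fYD_deriv
    refine ⟨B, ?_⟩
    filter_upwards [ae_restrict_mem Measure.isClosed_support.measurableSet] with y hy
    exact hB y hy

/-- Only the pooled outcome is assumed bounded. The bound survives conditioning on T = 1 by absolute
continuity, and the sampling assumption identifies the resulting law with that of Y_t in the whole
population. -/
theorem ae_Ypost_lt (hA : M.Assumptions P Q Ker h dL dH κ c C fD fDX fYD) :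
    ∀ᵐ ω ∂P, |M.Ypost ω| < C := by
  have hs : MeasurableSet {p : ℝ × ℝ × 𝒳 | |p.1| < C} :=
    measurableSet_lt (continuous_abs.measurable.comp measurable_fst) measurable_const
  have h1 : ∀ᵐ p ∂((cond P {ω | M.T ω = 1}).map (fun ω => (M.Y ω, M.D ω, M.X ω))), |p.1| < C :=
    (ae_map_iff (M.measurable_Y.prodMk (M.measurable_D.prodMk M.measurable_X)).aemeasurable hs).2
      (cond_absolutelyContinuous.ae_le hA.bounds.Y_bound)
  rw [hA.crossSections.law_post] at h1
  exact ae_of_ae_map (M.measurable_Ypost.prodMk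
    (M.measurable_D.prodMk M.measurable_X)).aemeasurable h1

theorem ae_Ypre_lt (hA : M.Assumptions P Q Ker h dL dH κ c C fD fDX fYD) :
    ∀ᵐ ω ∂P, |M.Ypre ω| < C := by
  have hs : MeasurableSet {p : ℝ × ℝ × 𝒳 | |p.1| < C} :=
    measurableSet_lt (continuous_abs.measurable.comp measurable_fst) measurable_const
  have h1 : ∀ᵐ p ∂((cond P {ω | M.T ω = 0}).map (fun ω => (M.Y ω, M.D ω, M.X ω))), |p.1| < C :=
    (ae_map_iff (M.measurable_Y.prodMk (M.measurable_D.prodMk M.measurable_X)).aemeasurable hs).2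
      (cond_absolutelyContinuous.ae_le hA.bounds.Y_bound)
  rw [hA.crossSections.law_pre] at h1
  exact ae_of_ae_map (M.measurable_Ypre.prodMk
    (M.measurable_D.prodMk M.measurable_X)).aemeasurable h1

theorem integrable_trend (hA : M.Assumptions P Q Ker h dL dH κ c C fD fDX fYD) :
    Integrable (fun ω => M.Ypost ω - M.Ypre ω) P := by
  refine (integrable_const (C + C)).mono'
    (M.measurable_Ypost.sub M.measurable_Ypre).aestronglyMeasurable ?_
  filter_upwards [hA.ae_Ypost_lt, hA.ae_Ypre_lt] with ω h1 h2
  exact (abs_sub _ _).trans (by linarith)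

/-- Reweighting by `T` recovers the outcome trend given dose and covariates. -/
theorem integral_Ylam_mul (hA : M.Assumptions P Q Ker h dL dH κ c C fD fDX fYD)
    {φ : ℝ × 𝒳 → ℝ} (hφ : Measurable φ) {B : ℝ} (hB : ∀ p, |φ p| ≤ B) :
    ∫ ω, M.Ylam P ω * φ (M.D ω, M.X ω) ∂P
      = ∫ ω, (M.Ypost ω - M.Ypre ω) * φ (M.D ω, M.X ω) ∂P := by
  have h0 := hA.crossSections.lam_pos
  have h1 : 0 < 1 - M.lam P := sub_pos.2 hA.crossSections.lam_lt_one
  have hDX : Measurable (fun ω => (M.D ω, M.X ω)) := M.measurable_D.prodMk M.measurable_X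
  have hφ' : Measurable (fun ω => φ (M.D ω, M.X ω)) := hφ.comp hDX
  have hg : Measurable (fun p : ℝ × ℝ × 𝒳 => p.1 * φ p.2) :=
    measurable_fst.mul (hφ.comp measurable_snd)
  have hint : ∀ {F : Ω → ℝ} {b : ℝ}, Measurable F → (∀ᵐ ω ∂P, |F ω| ≤ b) →
      Integrable (fun ω => F ω * φ (M.D ω, M.X ω)) P := fun {F b} hF hb => by
    refine (integrable_const (b * B)).mono' (hF.mul hφ').aestronglyMeasurable ?_
    filter_upwards [hb] with ω hω
    rw [Real.norm_eq_abs, abs_mul]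
    have := (abs_nonneg _).trans hω
    gcongr
    exact hB _
  have hpost : ∫ ω in {ω | M.T ω = 1}, M.Y ω * φ (M.D ω, M.X ω) ∂P
      = M.lam P * ∫ ω, M.Ypost ω * φ (M.D ω, M.X ω) ∂P := by
    have e := congrArg (fun m => ∫ p, p.1 * φ p.2 ∂m) hA.crossSections.law_post
    rw [integral_map (M.measurable_Y.prodMk hDX).aemeasurable hg.aestronglyMeasurable,
      integral_map (M.measurable_Ypost.prodMk hDX).aemeasurable hg.aestronglyMeasurable,
      integral_cond_eq, show P.real {ω | M.T ω = 1} = M.lam P from rfl,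
      inv_mul_eq_iff_eq_mul₀ h0.ne'] at e
    exact e
  have hpre : ∫ ω in {ω | M.T ω = 1}ᶜ, M.Y ω * φ (M.D ω, M.X ω) ∂P
      = (1 - M.lam P) * ∫ ω, M.Ypre ω * φ (M.D ω, M.X ω) ∂P := by
    have hc : {ω | M.T ω = 1}ᶜ = {ω | M.T ω = 0} := by
      ext ω
      rcases M.T_binary ω with h | h <;> simp [h]
    have e := congrArg (fun m => ∫ p, p.1 * φ p.2 ∂m) hA.crossSections.law_pre
    rw [integral_map (M.measurable_Y.prodMk hDX).aemeasurable hg.aestronglyMeasurable,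
      integral_map (M.measurable_Ypre.prodMk hDX).aemeasurable hg.aestronglyMeasurable,
      integral_cond_eq, real_T_eq_zero, inv_mul_eq_iff_eq_mul₀ h1.ne'] at e
    rw [hc]
    exact e
  have hm1 : MeasurableSet {ω | M.T ω = 1} := measurableSet_eq_fun M.measurable_T measurable_const
  rw [← integral_add_compl hm1 (hint (M.measurable_Ylam P) hA.ae_Ylam_le)]
  -- On {T = 1} the weight is 1/λ, on {T = 0} it is -1/(1-λ). These cancel the cell probabilities in
  -- `hpost` and `hpre`, leaving the mean for Y_t minus the mean for Y_{t-1}.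
  have e1 : ∫ ω in {ω | M.T ω = 1}, M.Ylam P ω * φ (M.D ω, M.X ω) ∂P
      = (M.lam P)⁻¹ * ∫ ω in {ω | M.T ω = 1}, M.Y ω * φ (M.D ω, M.X ω) ∂P := by
    rw [← integral_const_mul]
    refine setIntegral_congr_fun hm1 fun ω hω => ?_
    have hT : M.T ω = 1 := hω
    simp only [Ylam, hT]
    field_simp
  have e2 : ∫ ω in {ω | M.T ω = 1}ᶜ, M.Ylam P ω * φ (M.D ω, M.X ω) ∂P
      = -(1 - M.lam P)⁻¹ * ∫ ω in {ω | M.T ω = 1}ᶜ, M.Y ω * φ (M.D ω, M.X ω) ∂P := by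
    rw [← integral_const_mul]
    refine setIntegral_congr_fun hm1.compl fun ω hω => ?_
    have hT : M.T ω = 0 := (M.T_binary ω).resolve_right hω
    simp only [Ylam, hT]
    field_simp
    ring
  rw [e1, e2, hpost, hpre]
  simp_rw [sub_mul]
  rw [integral_sub (hint M.measurable_Ypost (hA.ae_Ypost_lt.mono fun _ h => h.le))
    (hint M.measurable_Ypre (hA.ae_Ypre_lt.mono fun _ h => h.le))]
  field_simp
  ring

end Assumptions

end Population

/-! ### Conditioning on covariates and dose, and identification of ATT(d) -/

namespace Population

variable {Ω 𝒳 : Type*} [MeasurableSpace Ω] [MeasurableSpace 𝒳] {M : Population Ω 𝒳}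

theorem integral_comp_dose_mul (M : Population Ω 𝒳) (P : Measure Ω) [IsFiniteMeasure P]
    {ψ : ℝ → ℝ} (hψ : Measurable ψ) {B : ℝ}
    (hB : ∀ s, |ψ s| ≤ B) {φ : 𝒳 → ℝ} (hφ : Measurable φ)
    (hi : Integrable (fun ω => φ (M.X ω)) P) :
    ∫ ω, ψ (M.D ω) * φ (M.X ω) ∂P
      = ∫ ω, (∫ s, ψ s ∂(M.doseGiven P (M.X ω))) * φ (M.X ω) ∂P :=
  integral_condDistrib_mul M.measurable_D M.measurable_X hψ hφ
    (hi.bdd_mul (hψ.comp M.measurable_D).aestronglyMeasurable (ae_of_all _ fun _ => hB _))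

theorem integral_indicator_mul (M : Population Ω 𝒳) (P : Measure Ω) [IsFiniteMeasure P]
    {φ : 𝒳 → ℝ} (hφ : Measurable φ)
    (hi : Integrable (fun ω => φ (M.X ω)) P) :
    ∫ ω, ({0} : Set ℝ).indicator 1 (M.D ω) * φ (M.X ω) ∂P
      = ∫ ω, M.g0 P (M.X ω) * φ (M.X ω) ∂P := by
  rw [M.integral_comp_dose_mul P (ψ := ({0} : Set ℝ).indicator 1)
    (measurable_one.indicator (measurableSet_singleton 0)) (B := 1)
    (fun s => by by_cases h : s = 0 <;> simp [h]) hφ hi]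
  simp_rw [integral_indicator_one (measurableSet_singleton (0 : ℝ))]
  rfl

theorem integral_rescale_dose_mul (M : Population Ω 𝒳) (P : Measure Ω) [IsFiniteMeasure P]
    {Ker : ℝ → ℝ} (hk : KernelAssumption Ker) {h : ℝ} (hh : 0 < h) (d : ℝ) {φ : 𝒳 → ℝ}
    (hφ : Measurable φ) (hi : Integrable (fun ω => φ (M.X ω)) P) :
    ∫ ω, rescale Ker h (M.D ω - d) * φ (M.X ω) ∂P
      = ∫ ω, M.fh0 P Ker h d (M.X ω) * φ (M.X ω) ∂P := by
  obtain ⟨B, _, hB⟩ := hk.exists_bound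
  exact M.integral_comp_dose_mul P (ψ := fun s => rescale Ker h (s - d))
    ((hk.measurable_rescale h).comp (measurable_id.sub_const d)) (fun s => hB h hh _) hφ hi

namespace Assumptions

variable {P : Measure Ω} [IsProbabilityMeasure P] {Q : Kernel ℝ Ω} {Ker : ℝ → ℝ} {h : ℕ → ℝ}
  {dL dH κ c C d : ℝ} {fD : ℝ → ℝ} {fDX : 𝒳 → ℝ → ℝ} {fYD : ℝ → ℝ → ℝ}

theorem ae_e0_le (hA : M.Assumptions P Q Ker h dL dH κ c C fD fDX fYD) :
    ∀ᵐ ω ∂P, |M.e0 P (M.X ω)| ≤ C :=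
  (ae_of_ae_map M.measurable_X.aemeasurable hA.bounds.e0_bound).mono fun _ h => h.le

theorem ae_g0 (hA : M.Assumptions P Q Ker h dL dH κ c C fD fDX fYD) :
    ∀ᵐ ω ∂P, κ < M.g0 P (M.X ω) ∧ M.g0 P (M.X ω) < 1 - κ :=
  (ae_of_ae_map M.measurable_X.aemeasurable hA.support.overlap).mono fun _ h => ⟨h.1, h.2.1⟩

/-- `e0` is the regression of Y^λ on X under the law conditioned on D = 0, so the two are
exchangeable against functions of X carried by that event. -/
theorem integral_Ylam_indicator_mul (hA : M.Assumptions P Q Ker h dL dH κ c C fD fDX fYD)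
    {φ : 𝒳 → ℝ} (hφ : Measurable φ) (hi : Integrable (fun ω => φ (M.X ω)) P) :
    ∫ ω, M.Ylam P ω * (({0} : Set ℝ).indicator 1 (M.D ω) * φ (M.X ω)) ∂P
      = ∫ ω, M.e0 P (M.X ω) * (({0} : Set ℝ).indicator 1 (M.D ω) * φ (M.X ω)) ∂P := by
  have hs : MeasurableSet {ω | M.D ω = 0} := measurableSet_eq_fun M.measurable_D measurable_const
  have hset : ∀ F : Ω → ℝ, ∫ ω, F ω * (({0} : Set ℝ).indicator 1 (M.D ω) * φ (M.X ω)) ∂P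
      = ∫ ω in {ω | M.D ω = 0}, F ω * φ (M.X ω) ∂P := fun F => by
    rw [← integral_indicator hs]
    refine integral_congr_ae (ae_of_all _ fun ω => ?_)
    by_cases h0 : M.D ω = 0 <;> simp [h0]
  have hiY : Integrable (fun ω => M.Ylam P ω * φ (M.X ω)) P :=
    hi.bdd_mul (M.measurable_Ylam P).aestronglyMeasurable hA.ae_Ylam_le
  rw [hset, hset]
  -- If the event is null both sides are zero; otherwise the normalizing constant of the conditional
  -- law can be cancelled.
  by_cases hp : P {ω | M.D ω = 0} = 0
  · rw [setIntegral_measure_zero _ hp, setIntegral_measure_zero _ hp]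
  have hpr : P.real {ω | M.D ω = 0} ≠ 0 := (measureReal_ne_zero_iff (by finiteness)).2 hp
  have hi0 : Integrable (fun ω => M.Ylam P ω * φ (M.X ω)) (ProbabilityTheory.cond P {ω | M.D ω = 0}) := by
    rw [ProbabilityTheory.cond]
    exact hiY.restrict.smul_measure (ENNReal.inv_ne_top.2 hp)
  have h1 := integral_condDistrib_mul (M.measurable_Ylam P) M.measurable_X measurable_id hφ hi0
  have h2 : ∫ ω, M.Ylam P ω * φ (M.X ω) ∂(ProbabilityTheory.cond P {ω | M.D ω = 0})
      = ∫ ω, M.e0 P (M.X ω) * φ (M.X ω) ∂(ProbabilityTheory.cond P {ω | M.D ω = 0}) := h1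
  rw [integral_cond_eq, integral_cond_eq] at h2
  exact mul_left_cancel₀ (inv_ne_zero hpr) h2

/-- The regression lemma with w = F = 1. Continuity upgrades the mixture formula for densities from
almost every dose to every interior dose. -/
theorem fD_eq_integral [IsMarkovKernel Q]
    (hA : M.Assumptions P Q Ker h dL dH κ c C fD fDX fYD) {s : ℝ}
    (hs : s ∈ Ioo dL dH) : ∫ x, fDX x s ∂(P.map M.X) = fD s := by
  have := hA.jointX.integral_eq_of_regression (w := fun _ => 1) measurable_const (W := 1)
    (by simp) hA.densities.measurable_fD
    (fun s hs => hA.densities.fD_nonneg s (Ioo_subset_Icc_self hs)) hA.bounds.fD_C2.continuousOn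
    hA.restrict_dose hA.condProb.disintegration (F := fun _ => 1) (integrable_const _)
    measurable_const (by simpa using continuousOn_const) (fun _ _ _ => rfl) hs
  simpa using this

/-- Averaging the overlap bound on the conditional density over X. It is the source of the
positivity of f_D(d) used in all later divisions. -/
theorem κ_le_fD [IsMarkovKernel Q] (hA : M.Assumptions P Q Ker h dL dH κ c C fD fDX fYD) {s : ℝ}
    (hs : s ∈ Ioo dL dH) : κ ≤ fD s := by
  have := Measure.isProbabilityMeasure_map (μ := P) M.measurable_X.aemeasurable
  rw [← hA.fD_eq_integral hs]
  calc κ = ∫ _, κ ∂(P.map M.X) := by simp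
    _ ≤ _ := by
      refine integral_mono_ae (integrable_const _) (hA.jointX.integrable_section hs) ?_
      filter_upwards [hA.support.overlap] with x hx
      exact (hx.2.2 s (Ioo_subset_Icc_self hs)).le

theorem fD_pos [IsMarkovKernel Q] (hA : M.Assumptions P Q Ker h dL dH κ c C fD fDX fYD) {s : ℝ}
    (hs : s ∈ Ioo dL dH) : 0 < fD s := hA.support.κ_pos.trans_le (hA.κ_le_fD hs)

/-- The right-hand probability is the integral of g_0(X) over {X ∈ A}, and overlap bounds g_0 below
by κ. -/
theorem κ_mul_le (hA : M.Assumptions P Q Ker h dL dH κ c C fD fDX fYD) {A : Set 𝒳}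
    (hAm : MeasurableSet A) :
    κ * P.real (M.X ⁻¹' A) ≤ P.real ({ω | M.D ω = 0} ∩ M.X ⁻¹' A) := by
  have hs : MeasurableSet {ω | M.D ω = 0} := measurableSet_eq_fun M.measurable_D measurable_const
  have hXA := M.measurable_X hAm
  have hi : Integrable (fun ω => A.indicator (1 : 𝒳 → ℝ) (M.X ω)) P := by
    refine (integrable_const 1).mono' ((measurable_one.indicator hAm).comp
      M.measurable_X).aestronglyMeasurable (ae_of_all _ fun ω => ?_)
    by_cases hx : M.X ω ∈ A <;> simp [hx]
  have h1 := M.integral_indicator_mul P (measurable_one.indicator hAm) hi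
  have h2 : ∫ ω, ({0} : Set ℝ).indicator 1 (M.D ω) * A.indicator 1 (M.X ω) ∂P
      = P.real ({ω | M.D ω = 0} ∩ M.X ⁻¹' A) := by
    rw [← integral_indicator_one (hs.inter hXA)]
    refine integral_congr_ae (ae_of_all _ fun ω => ?_)
    by_cases h0 : M.D ω = 0 <;> by_cases hx : M.X ω ∈ A <;> simp [h0, hx]
  have h3 : κ * P.real (M.X ⁻¹' A) = ∫ ω, κ * A.indicator 1 (M.X ω) ∂P := by
    rw [integral_const_mul, ← integral_indicator_one hXA]
    rfl
  rw [← h2, h1, h3]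
  refine integral_mono_ae (hi.const_mul _) (hi.bdd_mul (c := 1)
    ((M.measurable_g0 P).comp M.measurable_X).aestronglyMeasurable ?_) ?_
  · filter_upwards [hA.ae_g0] with ω hω
    rw [Real.norm_eq_abs, abs_le]
    constructor <;> linarith [hω.1, hω.2, hA.support.κ_pos]
  · filter_upwards [hA.ae_g0] with ω hω
    by_cases hx : M.X ω ∈ A <;> simp [hx, hω.1.le]

theorem dose_zero_pos (hA : M.Assumptions P Q Ker h dL dH κ c C fD fDX fYD) :
    0 < P.real {ω | M.D ω = 0} := by
  have := hA.κ_mul_le MeasurableSet.univ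
  simp only [preimage_univ, inter_univ, probReal_univ, mul_one] at this
  exact hA.support.κ_pos.trans_le this

/-- Overlap makes the law of X absolutely continuous with respect to its restriction to the
untreated, so what is learned from the untreated about functions of X holds for all covariates. -/
theorem ae_of_ae_dose_zero (hA : M.Assumptions P Q Ker h dL dH κ c C fD fDX fYD) {p : 𝒳 → Prop}
    (hp : MeasurableSet {x | p x}) (hae : ∀ᵐ ω ∂P, M.D ω = 0 → p (M.X ω)) :
    ∀ᵐ x ∂(P.map M.X), p x := by
  rw [ae_map_iff M.measurable_X.aemeasurable hp, ae_iff]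
  have h1 := hA.κ_mul_le hp.compl
  have h2 : P ({ω | M.D ω = 0} ∩ M.X ⁻¹' {x | p x}ᶜ) = 0 := by
    rw [ae_iff] at hae
    convert hae using 2
    ext ω
    simp
  rw [measureReal_def, measureReal_def, h2, ENNReal.toReal_zero] at h1
  have h3 : (P (M.X ⁻¹' {x | p x}ᶜ)).toReal = 0 :=
    le_antisymm (by
      by_contra hcon
      push Not at hcon
      nlinarith [mul_pos hA.support.κ_pos hcon]) ENNReal.toReal_nonneg
  rw [ENNReal.toReal_eq_zero_iff] at h3
  exact h3.resolve_right (measure_ne_top _ _)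

/-- The regular conditional probability at the atom `D = 0` is the elementary one. -/
theorem condProb_zero [IsMarkovKernel Q]
    (hA : M.Assumptions P Q Ker h dL dH κ c C fD fDX fYD) :
    Q 0 = ProbabilityTheory.cond P {ω | M.D ω = 0} := by
  have hs : MeasurableSet {ω | M.D ω = 0} := measurableSet_eq_fun M.measurable_D measurable_const
  have hp : P {ω | M.D ω = 0} ≠ 0 := fun h0 => by
    have := hA.dose_zero_pos
    rw [measureReal_def, h0] at this
    simp at this
  have hmap : (P.map M.D) {0} = P {ω | M.D ω = 0} :=
    Measure.map_apply M.measurable_D (measurableSet_singleton 0)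
  have hDi : Measurable (fun ω => (M.D ω, ω)) := M.measurable_D.prodMk measurable_id
  ext A hAm
  -- At an atom the disintegration determines the kernel exactly: testing it on {0} × A leaves Q 0 A
  -- multiplied by P(D = 0).
  have h1 := congrArg (fun m => m (({0} : Set ℝ) ×ˢ A)) hA.condProb.disintegration
  rw [Measure.compProd_apply_prod (measurableSet_singleton _) hAm, lintegral_singleton, hmap,
    Measure.map_apply hDi ((measurableSet_singleton _).prod hAm)] at h1
  have h2 : (fun ω => (M.D ω, ω)) ⁻¹' (({0} : Set ℝ) ×ˢ A) = {ω | M.D ω = 0} ∩ A := by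
    ext; simp
  rw [h2] at h1
  rw [cond_apply hs, ← h1, mul_comm (Q 0 A), ← mul_assoc,
    ENNReal.inv_mul_cancel hp (measure_ne_top _ _), one_mul]

theorem ae_dose_of_mem (hA : M.Assumptions P Q Ker h dL dH κ c C fD fDX fYD) {s : ℝ}
    (hs : s ∈ Ioo dL dH) : ∀ᵐ ω ∂(Q s), M.D ω = s :=
  hA.condProb.proper s (Or.inr (Ioo_subset_Icc_self hs))

/-- Under parallel trends the conditional mean of the untreated trend at any treated dose is
`𝓔_{λY}`. -/
theorem trend_ae_eq_e0 [IsMarkovKernel Q]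
    (hA : M.Assumptions P Q Ker h dL dH κ c C fD fDX fYD) {m : 𝒳 → ℝ} (hm : Measurable m)
    (hm0 : (Q 0)[fun ω => M.potPost 0 ω - M.potPre 0 ω | MeasurableSpace.comap M.X inferInstance]
      =ᵐ[Q 0] (fun ω => m (M.X ω))) : ∀ᵐ x ∂(P.map M.X), m x = M.e0 P x := by
  have hs : MeasurableSet {ω | M.D ω = 0} := measurableSet_eq_fun M.measurable_D measurable_const
  have hQ0 := hA.condProb_zero
  have hac : Q 0 ≪ P := by rw [hQ0]; exact cond_absolutelyContinuous
  have hD0 : ∀ᵐ ω ∂(Q 0), M.D ω = 0 := hA.condProb.proper 0 (Or.inl rfl)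
  -- Among the untreated Y_t(0) is the realized outcome, so the untreated trend is observed there.
  have hΔ : (fun ω => M.potPost 0 ω - M.potPre 0 ω) =ᵐ[Q 0] fun ω => M.Ypost ω - M.Ypre ω := by
    filter_upwards [hD0] with ω hω
    rw [hA.noAnticipation.post, hA.noAnticipation.pre, hω]
  have htr : Integrable (fun ω => M.Ypost ω - M.Ypre ω) (Q 0) := by
    refine (integrable_const (C + C)).mono'
      (M.measurable_Ypost.sub M.measurable_Ypre).aestronglyMeasurable ?_
    filter_upwards [hac.ae_le hA.ae_Ypost_lt, hac.ae_le hA.ae_Ypre_lt] with ω h1 h2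
    exact (abs_sub _ _).trans (by linarith)
  have hce : (fun ω => M.e0 P (M.X ω)) =ᵐ[Q 0]
      (Q 0)[fun ω => M.potPost 0 ω - M.potPre 0 ω
        | MeasurableSpace.comap M.X inferInstance] := by
    have hei : Integrable (fun ω => M.e0 P (M.X ω)) (Q 0) :=
      (integrable_const C).mono' ((M.measurable_e0 P).comp M.measurable_X).aestronglyMeasurable
        (hac.ae_le hA.ae_e0_le)
    -- On sets {X ∈ A}, the integrals of `e0` and of the observed trend under Q 0 become, after
    -- multiplication by P(D = 0), the integral of Y^λ over {D = 0, X ∈ A}: one by the definition of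
    -- `e0`, the other by reweighting.
    refine ae_eq_condExp_of_forall_setIntegral_eq M.measurable_X.comap_le
      (htr.congr hΔ.symm) (fun s _ _ => hei.integrableOn) ?_ ?_
    · rintro _ ⟨A, hAm, rfl⟩ _
      have hXA : MeasurableSet (M.X ⁻¹' A) := M.measurable_X hAm
      have hi : Integrable (fun ω => A.indicator (1 : 𝒳 → ℝ) (M.X ω)) P := by
        refine (integrable_const 1).mono' ((measurable_one.indicator hAm).comp
          M.measurable_X).aestronglyMeasurable (ae_of_all _ fun ω => ?_)
        by_cases hx : M.X ω ∈ A <;> simp [hx]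
      have h1 := hA.integral_Ylam_indicator_mul (measurable_one.indicator hAm) hi
      have h2 := hA.integral_Ylam_mul
        (φ := fun p => ({0} : Set ℝ).indicator 1 p.1 * A.indicator 1 p.2)
        (((measurable_one.indicator (measurableSet_singleton 0)).comp measurable_fst).mul
          ((measurable_one.indicator hAm).comp measurable_snd)) (B := 1)
        (fun p => by by_cases h0 : p.1 = 0 <;> by_cases hx : p.2 ∈ A <;> simp [h0, hx])
      have hset : ∀ F : Ω → ℝ,
          ∫ ω, F ω * (({0} : Set ℝ).indicator 1 (M.D ω) * A.indicator 1 (M.X ω)) ∂P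
          = P.real {ω | M.D ω = 0} * ∫ ω in M.X ⁻¹' A, F ω ∂(Q 0) := fun F => by
        rw [hQ0, ← integral_indicator hXA, integral_cond_eq,
          mul_inv_cancel_left₀ hA.dose_zero_pos.ne', ← integral_indicator hs]
        refine integral_congr_ae (ae_of_all _ fun ω => ?_)
        by_cases h0 : M.D ω = 0 <;> by_cases hx : M.X ω ∈ A <;> simp [h0, hx]
      rw [setIntegral_congr_ae hXA (hΔ.mono fun ω hω _ => hω)]
      refine mul_left_cancel₀ hA.dose_zero_pos.ne' ?_
      rw [← hset, ← hset, ← h1, h2]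
    · exact ((M.measurable_e0 P).comp (comap_measurable M.X)).aestronglyMeasurable
  -- The equality is known only among the untreated; overlap extends it to the whole law of X,
  -- including the covariates met at treated doses.
  refine hA.ae_of_ae_dose_zero (measurableSet_eq_fun hm (M.measurable_e0 P)) ?_
  have h3 : ∀ᵐ ω ∂(Q 0), m (M.X ω) = M.e0 P (M.X ω) := (hce.trans hm0).symm
  rw [hQ0, ProbabilityTheory.cond, Measure.ae_ennreal_smul_measure_iff
    (by simp), ae_restrict_iff' hs] at h3
  exact h3

/-- Bayes' rule at a single dose. It comes from the regression lemma applied to indicators of sets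
of covariates; continuity of s ↦ P(X ∈ A | D = s) is what makes it valid at d itself. -/
theorem map_cov_eq_withDensity [IsMarkovKernel Q]
    (hA : M.Assumptions P Q Ker h dL dH κ c C fD fDX fYD) (hd : d ∈ Ioo dL dH) :
    ENNReal.ofReal (fD d) • (Q d).map M.X
      = (P.map M.X).withDensity (fun x => ENNReal.ofReal (fDX x d)) := by
  ext A hAm
  have hcov : (fun s => ∫ ω, A.indicator (1 : 𝒳 → ℝ) (M.X ω) ∂(Q s))
      = fun s => (Q s).real (M.X ⁻¹' A) := by
    funext s
    rw [← integral_indicator_one (M.measurable_X hAm)]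
    rfl
  have hi : Integrable (fun ω => A.indicator (1 : 𝒳 → ℝ) (M.X ω)) P := by
    refine (integrable_const 1).mono' ((measurable_one.indicator hAm).comp
      M.measurable_X).aestronglyMeasurable (ae_of_all _ fun ω => ?_)
    by_cases hx : M.X ω ∈ A <;> simp [hx]
  have h1 := hA.jointX.integral_eq_of_regression (w := A.indicator 1)
    (measurable_one.indicator hAm) (W := 1)
    (ae_of_all _ fun x => by by_cases hx : x ∈ A <;> simp [hx]) hA.densities.measurable_fD
    (fun s hs => hA.densities.fD_nonneg s (Ioo_subset_Icc_self hs)) hA.bounds.fD_C2.continuousOn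
    hA.restrict_dose hA.condProb.disintegration (F := fun ω => A.indicator 1 (M.X ω))
    hi ((measurable_one.indicator hAm).comp M.measurable_X)
    (by rw [hcov]; exact hA.version.continuousOn_cov A hAm) (fun _ _ _ => rfl) hd
  have h2 : ∫ ω, A.indicator (1 : 𝒳 → ℝ) (M.X ω) ∂(Q d) = (Q d).real (M.X ⁻¹' A) := congrFun hcov d
  have h3 : ∫ x, A.indicator 1 x * fDX x d ∂(P.map M.X) = ∫ x in A, fDX x d ∂(P.map M.X) := by
    rw [← integral_indicator hAm]
    refine integral_congr_ae (ae_of_all _ fun x => ?_)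
    by_cases hx : x ∈ A <;> simp [hx]
  rw [h2, h3] at h1
  rw [Measure.smul_apply, smul_eq_mul, Measure.map_apply M.measurable_X hAm,
    withDensity_apply _ hAm, ← ofReal_integral_eq_lintegral_ofReal
    (hA.jointX.integrable_section hd).integrableOn
    (ae_of_all _ fun x => hA.densities.fDX_nonneg x d (Ioo_subset_Icc_self hd)), h1,
    ENNReal.ofReal_mul (hA.fD_pos hd).le, ofReal_measureReal]

/-- Identification of `ATT(d)` from the smooth regression functions. -/
theorem fD_mul_ATT [IsMarkovKernel Q]
    (hA : M.Assumptions P Q Ker h dL dH κ c C fD fDX fYD) (hd : d ∈ Ioo dL dH) :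
    fD d * M.ATT Q d = (∫ y, id y * fYD y d ∂(volume.restrict (P.map (M.Ylam P)).support))
      - ∫ x, M.e0 P x * fDX x d ∂(P.map M.X) := by
  have hfin := hA.isFiniteMeasure_support
  have hd' := Ioo_subset_Icc_self hd
  have hmapd := hA.map_cov_eq_withDensity hd
  -- The regression of the observed trend on the dose, read off from the joint density of (Y^λ, D);
  -- its hypothesis on sets {D ∈ B} is the reweighting identity with a function of the dose alone.
  have h1 := hA.jointY.integral_eq_of_regression (w := id) measurable_id hA.ae_support_Ylam_le
    hA.densities.measurable_fD
    (fun s hs => hA.densities.fD_nonneg s (Ioo_subset_Icc_self hs)) hA.bounds.fD_C2.continuousOn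
    hA.restrict_dose hA.condProb.disintegration (F := fun ω => M.Ypost ω - M.Ypre ω)
    hA.integrable_trend (M.measurable_Ypost.sub M.measurable_Ypre)
    hA.version.continuousOn_trend (fun B hB _ => by
      have h2 := hA.integral_Ylam_mul (φ := fun p => B.indicator 1 p.1)
        ((measurable_one.indicator hB).comp measurable_fst) (B := 1)
        (fun p => by by_cases h0 : p.1 ∈ B <;> simp [h0])
      have hset : ∀ F : Ω → ℝ, ∫ ω in M.D ⁻¹' B, F ω ∂P
          = ∫ ω, F ω * B.indicator 1 (M.D ω) ∂P := fun F => by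
        rw [← integral_indicator (M.measurable_D hB)]
        refine integral_congr_ae (ae_of_all _ fun ω => ?_)
        by_cases h0 : M.D ω ∈ B <;> simp [h0]
      rw [hset, hset]
      exact h2) hd
  obtain ⟨m, hm, hmd, hm0⟩ := hA.trends d hd'
  have hme := hA.trend_ae_eq_e0 hm hm0
  -- By Bayes' rule the law of X given D = d, up to the positive factor f_D(d), has a density with
  -- respect to the law of X, so null sets carry over.
  have hmeQ : ∀ᵐ x ∂((Q d).map M.X), m x = M.e0 P x := by
    have h3 := (withDensity_absolutelyContinuous (P.map M.X)
      (fun x => ENNReal.ofReal (fDX x d))).ae_le hme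
    rw [← hmapd] at h3
    have := (Measure.ae_ennreal_smul_measure_iff (by simpa using hA.fD_pos hd)).1 h3
    exact this
  have hDd := hA.ae_dose_of_mem hd
  have hΔi : Integrable (fun ω => M.potPost 0 ω - M.potPre 0 ω) (Q d) :=
    (hA.version.integrable_untreated d hd').sub (hA.version.integrable_pre d hd')
  have hTi : Integrable (fun ω => M.potPost d ω - M.potPre 0 ω) (Q d) :=
    (hA.version.integrable_treated d hd').sub (hA.version.integrable_pre d hd')
  -- Y_{t-1}(0) is subtracted from both potential outcomes. The treated difference is observed at D
  -- = d, and parallel trends turn the untreated one into `e0`.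
  have h4 : M.ATT Q d = (∫ ω, (M.Ypost ω - M.Ypre ω) ∂(Q d)) - ∫ x, M.e0 P x ∂((Q d).map M.X) := by
    have h5 : ∫ ω, (M.Ypost ω - M.Ypre ω) ∂(Q d) = ∫ ω, (M.potPost d ω - M.potPre 0 ω) ∂(Q d) := by
      refine integral_congr_ae ?_
      filter_upwards [hDd] with ω hω
      rw [hA.noAnticipation.post, hA.noAnticipation.pre, hω]
    have h6 : ∫ x, M.e0 P x ∂((Q d).map M.X) = ∫ ω, (M.potPost 0 ω - M.potPre 0 ω) ∂(Q d) := by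
      rw [← integral_condExp M.measurable_X.comap_le, integral_congr_ae hmd,
        ← integral_congr_ae hmeQ, integral_map M.measurable_X.aemeasurable
        hm.aestronglyMeasurable]
    rw [h5, h6, ← integral_sub hTi hΔi, ATT]
    refine integral_congr_ae (ae_of_all _ fun ω => ?_)
    ring
  have h7 : ∫ x, M.e0 P x * fDX x d ∂(P.map M.X) = fD d * ∫ x, M.e0 P x ∂((Q d).map M.X) := by
    have h8 := congrArg (fun m => ∫ x, M.e0 P x ∂m) hmapd
    have hfm : Measurable (fun x => ENNReal.ofReal (fDX x d)) := ENNReal.measurable_ofReal.comp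
      (hA.densities.measurable_fDX.comp (measurable_id.prodMk measurable_const))
    simp only [integral_smul_measure] at h8
    rw [integral_withDensity_eq_integral_toReal_smul hfm (by simp),
      ENNReal.toReal_ofReal (hA.fD_pos hd).le, smul_eq_mul] at h8
    rw [h8]
    refine integral_congr_ae (ae_of_all _ fun x => ?_)
    simp only
    rw [ENNReal.toReal_ofReal (hA.densities.fDX_nonneg x d hd'), smul_eq_mul, mul_comm]
  rw [h4, h7, h1]
  ring

end Assumptions

end Population

/-! ### Kernel moments, mean of the estimating function, and smoothing bias -/

theorem integrable_of_ae_abs_le {Ω : Type*} [MeasurableSpace Ω] {m : Measure Ω}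
    [IsFiniteMeasure m] {F : Ω → ℝ} (hF : Measurable F) {b : ℝ} (hb : ∀ᵐ ω ∂m, |F ω| ≤ b) :
    Integrable F m := (integrable_const b).mono' hF.aestronglyMeasurable hb

theorem abs_indicator_one_le (s : Set ℝ) (x : ℝ) : |s.indicator (1 : ℝ → ℝ) x| ≤ 1 := by
  by_cases h : x ∈ s <;> simp [h]

namespace Population

variable {Ω 𝒳 : Type*} [MeasurableSpace Ω] [MeasurableSpace 𝒳] {M : Population Ω 𝒳}

theorem measurable_rescale_dose (M : Population Ω 𝒳) {Ker : ℝ → ℝ} (hk : KernelAssumption Ker)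
    (h d : ℝ) : Measurable (fun ω => rescale Ker h (M.D ω - d)) :=
  (hk.measurable_rescale h).comp (M.measurable_D.sub_const d)

theorem measurable_indicator_dose (M : Population Ω 𝒳) :
    Measurable (fun ω => ({0} : Set ℝ).indicator (1 : ℝ → ℝ) (M.D ω)) :=
  (measurable_one.indicator (measurableSet_singleton 0)).comp M.measurable_D

namespace Assumptions

variable {P : Measure Ω} [IsProbabilityMeasure P] {Q : Kernel ℝ Ω} {Ker : ℝ → ℝ} {h : ℕ → ℝ}
  {dL dH κ c C d : ℝ} {fD : ℝ → ℝ} {fDX : 𝒳 → ℝ → ℝ} {fYD : ℝ → ℝ → ℝ}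

/-- The treated part is handled by smoothing a density at an interior point. The untreated are an
atom at distance d from the dose of interest, and the kernel tail makes their contribution O(h²) as
well. -/
theorem exists_smoothing_bound (hA : M.Assumptions P Q Ker h dL dH κ c C fD fDX fYD)
    {E : Type*} [MeasurableSpace E] {U : Ω → E} {ν : Measure E} [IsFiniteMeasure ν]
    {φ : E → ℝ → ℝ} (hJ : JointDensity P M.D U ν φ dL dH) {w : E → ℝ} (hw : Measurable w) {W : ℝ}
    (hwb : ∀ᵐ u ∂ν, |w u| ≤ W) (hwP : ∀ᵐ ω ∂P, |w (U ω)| ≤ W) (hd : d ∈ Ioo dL dH) :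
    ∃ C' ≥ 0, ∀ h > 0, |(∫ ω, w (U ω) * rescale Ker h (M.D ω - d) ∂P) - ∫ u, w u * φ u d ∂ν|
      ≤ C' * h ^ 2 := by
  obtain ⟨C₁, hC₁, h1⟩ := hJ.exists_smoothing_bound hA.kernel hw hwb hd
  obtain ⟨C₂, hC₂, h2⟩ := hA.kernel.exists_tail_bound (hA.support.dL_pos.trans hd.1)
  obtain ⟨B, hB0, hB⟩ := hA.kernel.exists_bound
  refine ⟨C₁ + |W| * C₂, by positivity, fun h hh => ?_⟩
  have hwU : Integrable (fun ω => w (U ω)) P :=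
    integrable_of_ae_abs_le (hw.comp hJ.measurable_var) hwP
  have hint : Integrable (fun ω => w (U ω) * rescale Ker h (M.D ω - d)) P :=
    hwU.mul_bdd (c := B / h) (M.measurable_rescale_dose hA.kernel h d).aestronglyMeasurable
      (ae_of_all _ fun ω => hB h hh _)
  have hm0 : MeasurableSet (M.D ⁻¹' {0}) := M.measurable_D (measurableSet_singleton 0)
  have h3 : |∫ ω in M.D ⁻¹' {0}, w (U ω) * rescale Ker h (M.D ω - d) ∂P| ≤ |W| * C₂ * h ^ 2 := by
    rw [← Real.norm_eq_abs]
    refine (norm_setIntegral_le_of_norm_le_const_ae' (C := |W| * (C₂ * h ^ 2))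
      (measure_lt_top _ _) ?_).trans ?_
    · filter_upwards [hwP] with ω hω h0
      have h0' : M.D ω = 0 := h0
      rw [h0', Real.norm_eq_abs, abs_mul]
      exact mul_le_mul (hω.trans (le_abs_self W)) (h2 h hh) (abs_nonneg _) (abs_nonneg _)
    · rw [← mul_assoc]
      exact mul_le_of_le_one_right (by positivity) measureReal_le_one
  rw [hA.integral_eq_add hint]
  have h4 := h1 h hh
  rw [abs_le] at h3 h4 ⊢
  constructor <;> linarith [h3.1, h3.2, h4.1, h4.2]

theorem exists_mean_rescale_bound [IsMarkovKernel Q]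
    (hA : M.Assumptions P Q Ker h dL dH κ c C fD fDX fYD) (hd : d ∈ Ioo dL dH) :
    ∃ C' ≥ 0, ∀ h > 0, |(∫ ω, rescale Ker h (M.D ω - d) ∂P) - fD d| ≤ C' * h ^ 2 := by
  obtain ⟨C', h0, h1⟩ := hA.exists_smoothing_bound hA.jointX (w := fun _ => 1) measurable_const
    (W := 1) (by simp) (by simp) hd
  refine ⟨C', h0, fun h hh => ?_⟩
  have := h1 h hh
  simp only [one_mul] at this
  rwa [hA.fD_eq_integral hd] at this

/-- The L¹ norm of K_h does not depend on h, and f_D is bounded on the interval by its own expansion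
at d. The atom at 0 adds at most C₂ when h ≤ 1. -/
theorem exists_abs_rescale_bound [IsMarkovKernel Q]
    (hA : M.Assumptions P Q Ker h dL dH κ c C fD fDX fYD) (hd : d ∈ Ioo dL dH) :
    ∃ C' > 0, ∀ h > 0, h ≤ 1 → ∫ ω, |rescale Ker h (M.D ω - d)| ∂P ≤ C' := by
  obtain ⟨C₂, hC₂, h2⟩ := hA.kernel.exists_tail_bound (hA.support.dL_pos.trans hd.1)
  obtain ⟨B, hB0, hB⟩ := hA.kernel.exists_bound
  obtain ⟨L, B', hT⟩ := hA.jointX.exists_taylor (w := fun _ => 1) measurable_const (W := 1)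
    (by simp) hd
  simp only [one_mul] at hT
  set F : ℝ := |fD d| + |L| * (dH - dL) + |B'| * (dH - dL) ^ 2 with hF
  have hlt : 0 < dH - dL := by linarith [hd.1, hd.2]
  have hF0 : 0 ≤ F := by positivity
  have hFb : ∀ s ∈ Ioo dL dH, |∫ u, 1 * fDX u s ∂(P.map M.X)| ≤ F := fun s hs => by
    have hsd : |s - d| ≤ dH - dL := by
      rw [abs_le]; constructor <;> linarith [hs.1, hs.2, hd.1, hd.2]
    have h1 := hT s hs
    simp only [one_mul]
    rw [hA.fD_eq_integral hs, hA.fD_eq_integral hd] at h1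
    rw [hA.fD_eq_integral hs]
    have e : fD s = fD d + L * (s - d) + (fD s - fD d - L * (s - d)) := by ring
    rw [e, hF]
    refine (abs_add_three _ _ _).trans ?_
    rw [abs_mul]
    have h3 : B' * (s - d) ^ 2 ≤ |B'| * (dH - dL) ^ 2 := by
      rw [← sq_abs (s - d)]
      have := le_abs_self B'
      gcongr
    gcongr
    exact h1.trans h3
  have hKint : 0 ≤ ∫ u, |Ker u| := integral_nonneg fun _ => abs_nonneg _
  refine ⟨F * (∫ u, |Ker u|) + C₂ + 1, by positivity, fun h hh hh1 => ?_⟩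
  have hKm := M.measurable_rescale_dose hA.kernel h d
  have hint : Integrable (fun ω => |rescale Ker h (M.D ω - d)|) P :=
    (integrable_of_ae_abs_le hKm (ae_of_all _ fun ω => hB h hh _)).abs
  have hm0 : MeasurableSet (M.D ⁻¹' {0}) := M.measurable_D (measurableSet_singleton 0)
  rw [hA.integral_eq_add hint]
  have h3 : ∫ ω in M.D ⁻¹' {0}, |rescale Ker h (M.D ω - d)| ∂P ≤ C₂ := by
    calc _ ≤ ∫ ω in M.D ⁻¹' {0}, C₂ ∂P := by
          refine setIntegral_mono_on hint.integrableOn (integrable_const _) hm0 fun ω h0 => ?_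
          have h0' : M.D ω = 0 := h0
          rw [h0']
          refine (h2 h hh).trans (mul_le_of_le_one_right hC₂ (pow_le_one₀ hh.le hh1))
      _ ≤ C₂ := by
          rw [setIntegral_const, smul_eq_mul]
          exact mul_le_of_le_one_left hC₂ measureReal_le_one
  have h4 : ∫ ω in M.D ⁻¹' Ioo dL dH, |rescale Ker h (M.D ω - d)| ∂P ≤ F * ∫ u, |Ker u| := by
    have h5 := hA.jointX.setIntegral_eq (w := fun _ => 1) measurable_const (W := 1) (by simp)
      (χ := fun s => |rescale Ker h (s - d)|)
      (continuous_abs.measurable.comp ((hA.kernel.measurable_rescale h).comp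
        (measurable_id.sub_const d))) (B := B / h) (fun s => by rw [abs_abs]; exact hB h hh _)
    simp only [one_mul] at h5 hFb
    rw [h5]
    have hKi : Integrable (fun s => |rescale Ker h (s - d)|) :=
      (hA.kernel.integrable_rescale hh d).abs
    refine (le_abs_self _).trans ?_
    rw [← Real.norm_eq_abs]
    calc _ ≤ ∫ s in Ioo dL dH, F * |rescale Ker h (s - d)| := by
          refine norm_integral_le_of_norm_le (hKi.const_mul F).integrableOn ?_
          filter_upwards [ae_restrict_mem measurableSet_Ioo] with s hs
          rw [norm_mul, Real.norm_eq_abs, abs_abs, mul_comm]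
          gcongr
          exact hFb s hs
      _ ≤ ∫ s, F * |rescale Ker h (s - d)| :=
          setIntegral_le_integral (hKi.const_mul F)
            (ae_of_all _ fun s => mul_nonneg hF0 (abs_nonneg _))
      _ = F * ∫ u, |Ker u| := by
          rw [integral_const_mul, KernelAssumption.integral_abs_rescale hh]
  linarith

/-- One factor K_h is at most B/h and the other has bounded mean. This 1/h is the reason why Nh is
the effective sample size. -/
theorem exists_rescale_sq_bound [IsMarkovKernel Q]
    (hA : M.Assumptions P Q Ker h dL dH κ c C fD fDX fYD) (hd : d ∈ Ioo dL dH) :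
    ∃ C' > 0, ∀ h > 0, h ≤ 1 → ∫ ω, rescale Ker h (M.D ω - d) ^ 2 ∂P ≤ C' / h := by
  obtain ⟨C₁, hC₁, h1⟩ := hA.exists_abs_rescale_bound hd
  obtain ⟨B, hB0, hB⟩ := hA.kernel.exists_bound
  refine ⟨B * C₁, by positivity, fun h hh hh1 => ?_⟩
  have hKm := M.measurable_rescale_dose hA.kernel h d
  have hint : Integrable (fun ω => |rescale Ker h (M.D ω - d)|) P :=
    (integrable_of_ae_abs_le hKm (ae_of_all _ fun ω => hB h hh _)).abs
  calc ∫ ω, rescale Ker h (M.D ω - d) ^ 2 ∂P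
      ≤ ∫ ω, B / h * |rescale Ker h (M.D ω - d)| ∂P := by
        refine integral_mono_of_nonneg (ae_of_all _ fun ω => sq_nonneg _) (hint.const_mul _)
          (ae_of_all _ fun ω => ?_)
        simp only
        rw [← sq_abs, sq]
        gcongr
        exact hB h hh _
    _ ≤ B / h * C₁ := by
        rw [integral_const_mul]
        gcongr
        exact h1 h hh hh1
    _ = _ := by ring

theorem abs_fh0_le (M : Population Ω 𝒳) (P : Measure Ω) [IsFiniteMeasure P]
    (hk : KernelAssumption Ker) : ∃ B > 0, ∀ h > 0, ∀ d x, |M.fh0 P Ker h d x| ≤ B / h := by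
  obtain ⟨B, hB0, hB⟩ := hk.exists_bound
  refine ⟨B, hB0, fun h hh d x => ?_⟩
  have : IsProbabilityMeasure (M.doseGiven P x) := by
    unfold doseGiven; infer_instance
  have := norm_integral_le_of_norm_le_const (μ := M.doseGiven P x)
    (f := fun s => rescale Ker h (s - d)) (C := B / h) (ae_of_all _ fun s => hB h hh _)
  simpa [fh0] using this

/-- The mean of the estimating function at arbitrary nuisance values: its dependence on the
nuisances is a product of two errors. -/
theorem integral_raw_eq (hA : M.Assumptions P Q Ker h dL dH κ c C fD fDX fYD) {b : ℝ} (hb : 0 < b)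
    {r e : 𝒳 → ℝ} (hr : Measurable r) (he : Measurable e) {R : ℝ}
    (hR : ∀ᵐ ω ∂P, |r (M.X ω)| ≤ R) (hei : Integrable (fun ω => e (M.X ω)) P) :
    ∫ ω, (rescale Ker b (M.D ω - d) - ({0} : Set ℝ).indicator 1 (M.D ω) * r (M.X ω))
        * (M.Ylam P ω - e (M.X ω)) ∂P
      = (∫ ω, M.Ylam P ω * rescale Ker b (M.D ω - d) ∂P)
        - (∫ ω, M.e0 P (M.X ω) * rescale Ker b (M.D ω - d) ∂P)
        - ∫ ω, (M.fh0 P Ker b d (M.X ω) - M.g0 P (M.X ω) * r (M.X ω))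
          * (e (M.X ω) - M.e0 P (M.X ω)) ∂P := by
  obtain ⟨B, hB0, hB⟩ := hA.kernel.exists_bound
  obtain ⟨B', hB'0, hB'⟩ := abs_fh0_le M P hA.kernel
  have hX := M.measurable_X
  have mK := (M.measurable_rescale_dose hA.kernel b d).aestronglyMeasurable (μ := P)
  have mI := M.measurable_indicator_dose.aestronglyMeasurable (μ := P)
  have mr := (hr.comp hX).aestronglyMeasurable (μ := P)
  have mf := ((M.measurable_fh0 P hA.kernel b d).comp hX).aestronglyMeasurable (μ := P)
  have mg := ((M.measurable_g0 P).comp hX).aestronglyMeasurable (μ := P)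
  have bK : ∀ᵐ ω ∂P, ‖rescale Ker b (M.D ω - d)‖ ≤ B / b := ae_of_all _ fun ω => hB b hb _
  have bI : ∀ᵐ ω ∂P, ‖({0} : Set ℝ).indicator (1 : ℝ → ℝ) (M.D ω)‖ ≤ 1 :=
    ae_of_all _ fun ω => abs_indicator_one_le _ _
  have bf : ∀ᵐ ω ∂P, ‖M.fh0 P Ker b d (M.X ω)‖ ≤ B' / b := ae_of_all _ fun ω => hB' b hb d _
  have bg : ∀ᵐ ω ∂P, ‖M.g0 P (M.X ω)‖ ≤ 1 := by
    filter_upwards [hA.ae_g0] with ω hω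
    rw [Real.norm_eq_abs, abs_le]
    constructor <;> linarith [hω.1, hω.2, hA.support.κ_pos]
  have iY : Integrable (M.Ylam P) P :=
    integrable_of_ae_abs_le (M.measurable_Ylam P) hA.ae_Ylam_le
  have ie0 : Integrable (fun ω => M.e0 P (M.X ω)) P :=
    integrable_of_ae_abs_le ((M.measurable_e0 P).comp hX) hA.ae_e0_le
  have ir : Integrable (fun ω => r (M.X ω)) P := integrable_of_ae_abs_le (hr.comp hX) hR
  have ire : Integrable (fun ω => r (M.X ω) * e (M.X ω)) P := hei.bdd_mul mr hR
  have ire0 : Integrable (fun ω => r (M.X ω) * M.e0 P (M.X ω)) P := ie0.bdd_mul mr hR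
  have irY : Integrable (fun ω => r (M.X ω) * M.Ylam P ω) P := iY.bdd_mul mr hR
  have i1 : Integrable (fun ω => M.Ylam P ω * rescale Ker b (M.D ω - d)) P := by
    refine (iY.bdd_mul mK bK).congr (ae_of_all _ fun ω => ?_)
    simp only; ring
  have i2 : Integrable (fun ω => rescale Ker b (M.D ω - d) * e (M.X ω)) P := hei.bdd_mul mK bK
  have i3 : Integrable (fun ω => M.Ylam P ω
      * (({0} : Set ℝ).indicator 1 (M.D ω) * r (M.X ω))) P := by
    refine (irY.bdd_mul mI bI).congr (ae_of_all _ fun ω => ?_)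
    simp only; ring
  have i4 : Integrable (fun ω => ({0} : Set ℝ).indicator 1 (M.D ω)
      * (r (M.X ω) * e (M.X ω))) P := ire.bdd_mul mI bI
  have e1 : ∫ ω, (rescale Ker b (M.D ω - d) - ({0} : Set ℝ).indicator 1 (M.D ω) * r (M.X ω))
        * (M.Ylam P ω - e (M.X ω)) ∂P
      = ∫ ω, (M.Ylam P ω * rescale Ker b (M.D ω - d) - rescale Ker b (M.D ω - d) * e (M.X ω)
        - M.Ylam P ω * (({0} : Set ℝ).indicator 1 (M.D ω) * r (M.X ω))
        + ({0} : Set ℝ).indicator 1 (M.D ω) * (r (M.X ω) * e (M.X ω))) ∂P :=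
    integral_congr_ae (ae_of_all _ fun ω => by simp only; ring)
  have i12 : Integrable (fun ω => M.Ylam P ω * rescale Ker b (M.D ω - d)
    - rescale Ker b (M.D ω - d) * e (M.X ω)) P := i1.sub i2
  have i123 : Integrable (fun ω => M.Ylam P ω * rescale Ker b (M.D ω - d)
    - rescale Ker b (M.D ω - d) * e (M.X ω)
    - M.Ylam P ω * (({0} : Set ℝ).indicator 1 (M.D ω) * r (M.X ω))) P := i12.sub i3
  -- Conditioning on X replaces K_h by f_h^0 in the term with e, and 1{D=0} by g_0 in the term with
  -- r e; conditioning on X within {D = 0} replaces Y^λ by e_0. The leftovers factor into the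
  -- product of errors.
  rw [e1, integral_add i123 i4, integral_sub i12 i3, integral_sub i1 i2,
    M.integral_rescale_dose_mul P hA.kernel hb d he hei,
    hA.integral_Ylam_indicator_mul hr ir,
    M.integral_indicator_mul P (φ := fun x => r x * e x) (hr.mul he) ire]
  have e2 : ∫ ω, M.e0 P (M.X ω) * (({0} : Set ℝ).indicator 1 (M.D ω) * r (M.X ω)) ∂P
      = ∫ ω, M.g0 P (M.X ω) * (r (M.X ω) * M.e0 P (M.X ω)) ∂P := by
    rw [← M.integral_indicator_mul P (φ := fun x => r x * M.e0 P x)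
      (hr.mul (M.measurable_e0 P)) ire0]
    exact integral_congr_ae (ae_of_all _ fun ω => by simp only; ring)
  have e3 : ∫ ω, M.e0 P (M.X ω) * rescale Ker b (M.D ω - d) ∂P
      = ∫ ω, M.fh0 P Ker b d (M.X ω) * M.e0 P (M.X ω) ∂P := by
    rw [← M.integral_rescale_dose_mul P hA.kernel hb d (M.measurable_e0 P) ie0]
    exact integral_congr_ae (ae_of_all _ fun ω => by simp only; ring)
  have j1 : Integrable (fun ω => M.fh0 P Ker b d (M.X ω) * e (M.X ω)) P := hei.bdd_mul mf bf
  have j2 : Integrable (fun ω => M.fh0 P Ker b d (M.X ω) * M.e0 P (M.X ω)) P := ie0.bdd_mul mf bf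
  have j3 : Integrable (fun ω => M.g0 P (M.X ω) * (r (M.X ω) * e (M.X ω))) P := ire.bdd_mul mg bg
  have j4 : Integrable (fun ω => M.g0 P (M.X ω) * (r (M.X ω) * M.e0 P (M.X ω))) P :=
    ire0.bdd_mul mg bg
  have e4 : ∫ ω, (M.fh0 P Ker b d (M.X ω) - M.g0 P (M.X ω) * r (M.X ω))
          * (e (M.X ω) - M.e0 P (M.X ω)) ∂P
      = (∫ ω, M.fh0 P Ker b d (M.X ω) * e (M.X ω) ∂P)
        - (∫ ω, M.fh0 P Ker b d (M.X ω) * M.e0 P (M.X ω) ∂P)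
        - (∫ ω, M.g0 P (M.X ω) * (r (M.X ω) * e (M.X ω)) ∂P)
        + ∫ ω, M.g0 P (M.X ω) * (r (M.X ω) * M.e0 P (M.X ω)) ∂P := by
    have j12 : Integrable (fun ω => M.fh0 P Ker b d (M.X ω) * e (M.X ω)
      - M.fh0 P Ker b d (M.X ω) * M.e0 P (M.X ω)) P := j1.sub j2
    have j123 : Integrable (fun ω => M.fh0 P Ker b d (M.X ω) * e (M.X ω)
      - M.fh0 P Ker b d (M.X ω) * M.e0 P (M.X ω)
      - M.g0 P (M.X ω) * (r (M.X ω) * e (M.X ω))) P := j12.sub j3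
    rw [← integral_sub j1 j2, ← integral_sub j12 j3, ← integral_add j123 j4]
    exact integral_congr_ae (ae_of_all _ fun ω => by simp only; ring)
  rw [e2, e3, e4]
  ring

/-- The weight defining `ATTh` is the case e = 0 of the general mean formula with the true ratio r =
f_h^0/g_0. That ratio annihilates the first factor of the product term, so a wrong e does no harm.
-/
theorem fD_mul_ATTh (hA : M.Assumptions P Q Ker h dL dH κ c C fD fDX fYD) {b fd : ℝ} (hb : 0 < b)
    (hfd : fd ≠ 0) :
    fd * M.ATTh P Ker b d fd = (∫ ω, M.Ylam P ω * rescale Ker b (M.D ω - d) ∂P)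
        - ∫ ω, M.e0 P (M.X ω) * rescale Ker b (M.D ω - d) ∂P := by
  obtain ⟨B, hB0, hB⟩ := abs_fh0_le M P hA.kernel
  have hr : Measurable (fun x => M.fh0 P Ker b d x / M.g0 P x) :=
    (M.measurable_fh0 P hA.kernel b d).div (M.measurable_g0 P)
  have hκ := hA.support.κ_pos
  have hR : ∀ᵐ ω ∂P, |M.fh0 P Ker b d (M.X ω) / M.g0 P (M.X ω)| ≤ B / b / κ := by
    filter_upwards [hA.ae_g0] with ω hω
    rw [abs_div, abs_of_pos (hκ.trans hω.1)]
    have := hω.1.le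
    gcongr
    exact hB b hb d _
  have h1 := hA.integral_raw_eq (d := d) hb hr (e := fun _ => 0) measurable_const hR
    (integrable_zero _ _ _)
  have h2 : ∫ ω, (M.fh0 P Ker b d (M.X ω)
      - M.g0 P (M.X ω) * (M.fh0 P Ker b d (M.X ω) / M.g0 P (M.X ω)))
          * (0 - M.e0 P (M.X ω)) ∂P = 0 := by
    rw [← integral_zero Ω ℝ (μ := P)]
    refine integral_congr_ae ?_
    filter_upwards [hA.ae_g0] with ω hω
    have := (hκ.trans hω.1).ne'
    field_simp
    ring
  rw [h2, sub_zero] at h1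
  rw [← h1, ATTh, ← integral_const_mul]
  refine integral_congr_ae ?_
  filter_upwards [hA.ae_g0] with ω hω
  have := (hκ.trans hω.1).ne'
  field_simp
  ring

/-- The smoothing bias of the target is of order `h²`. -/
theorem exists_ATTh_bound [IsMarkovKernel Q]
    (hA : M.Assumptions P Q Ker h dL dH κ c C fD fDX fYD) (hd : d ∈ Ioo dL dH) :
    ∃ C' ≥ 0, ∀ h > 0, |M.ATTh P Ker h d (fD d) - M.ATT Q d| ≤ C' * h ^ 2 := by
  have hfin := hA.isFiniteMeasure_support
  have hfd := hA.fD_pos hd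
  obtain ⟨C₁, hC₁, h1⟩ := hA.exists_smoothing_bound hA.jointY measurable_id
    hA.ae_support_Ylam_le hA.ae_Ylam_le hd
  obtain ⟨C₂, hC₂, h2⟩ := hA.exists_smoothing_bound hA.jointX (M.measurable_e0 P)
    (hA.bounds.e0_bound.mono fun _ h => h.le) hA.ae_e0_le hd
  refine ⟨(C₁ + C₂) / fD d, by positivity, fun h hh => ?_⟩
  have h3 := h1 h hh
  have h4 := h2 h hh
  -- The two identification formulas match term by term, so the bias is the difference of two
  -- smoothing errors, one for Y^λ and one for e_0.
  have h5 : fD d * (M.ATTh P Ker h d (fD d) - M.ATT Q d)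
      = ((∫ ω, id (M.Ylam P ω) * rescale Ker h (M.D ω - d) ∂P)
        - ∫ y, id y * fYD y d ∂(volume.restrict (P.map (M.Ylam P)).support))
        - ((∫ ω, M.e0 P (M.X ω) * rescale Ker h (M.D ω - d) ∂P)
        - ∫ x, M.e0 P x * fDX x d ∂(P.map M.X)) := by
    rw [mul_sub, hA.fD_mul_ATTh hh hfd.ne', hA.fD_mul_ATT hd]
    simp only [id]
    ring
  rw [div_mul_eq_mul_div, le_div_iff₀ hfd]
  rw [← abs_of_pos hfd, ← abs_mul, mul_comm, abs_of_pos hfd, h5]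
  refine (abs_sub _ _).trans ?_
  rw [add_mul]
  exact add_le_add h3 h4

end Assumptions

end Population

/-! ### Estimating functions and nuisance errors -/

section Weight

variable {𝒳 : Type*}

/-- The weight `(K_h(D-d) g(X) - 1{D=0} f_h(d|X)) / g(X)`. -/
def weight (Ker : ℝ → ℝ) (h d : ℝ) (η : Nuisance 𝒳) (z : Obs 𝒳) : ℝ :=
  (rescale Ker h (z.dose - d) * η.g z.cov - ({0} : Set ℝ).indicator 1 z.dose * η.f z.cov)
    / η.g z.cov

/-- The estimating function without the density of the dose in the denominator. -/
def rawSignal (Ker : ℝ → ℝ) (h d lam : ℝ) (η : Nuisance 𝒳) (z : Obs 𝒳) : ℝ :=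
  weight Ker h d η z * ((z.t - lam) / (lam * (1 - lam)) * z.y - η.e z.cov)

theorem signal_eq (Ker : ℝ → ℝ) (h d lam fd : ℝ) (η : Nuisance 𝒳) (z : Obs 𝒳) :
    signal Ker h d lam fd η z = fd⁻¹ * rawSignal Ker h d lam η z := by
  rw [signal, rawSignal, weight, mul_comm fd, ← div_div, div_eq_inv_mul _ fd, mul_assoc]

variable [MeasurableSpace 𝒳]

theorem Obs.measurable_y : Measurable (Obs.y : Obs 𝒳 → ℝ) := measurable_fst

theorem Obs.measurable_t : Measurable (Obs.t : Obs 𝒳 → ℝ) := measurable_fst.comp measurable_snd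

theorem Obs.measurable_dose : Measurable (Obs.dose : Obs 𝒳 → ℝ) :=
  measurable_fst.comp (measurable_snd.comp measurable_snd)

theorem Obs.measurable_cov : Measurable (Obs.cov : Obs 𝒳 → 𝒳) :=
  measurable_snd.comp (measurable_snd.comp measurable_snd)

variable {A : Type*} [MeasurableSpace A] {η : A → Nuisance 𝒳} {Ker : ℝ → ℝ} {h d lam : ℝ}

theorem measurable_weight (hk : Population.KernelAssumption Ker)
    (hf : Measurable (fun p : A × 𝒳 => (η p.1).f p.2))
    (hg : Measurable (fun p : A × 𝒳 => (η p.1).g p.2)) :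
    Measurable (fun p : A × Obs 𝒳 => weight Ker h d (η p.1) p.2) := by
  have hc : Measurable (fun p : A × Obs 𝒳 => (p.1, p.2.cov)) :=
    measurable_fst.prodMk (Obs.measurable_cov.comp measurable_snd)
  have hd : Measurable (fun p : A × Obs 𝒳 => p.2.dose) := Obs.measurable_dose.comp measurable_snd
  exact ((((hk.measurable_rescale h).comp (hd.sub_const d)).mul (hg.comp hc)).sub
    (((measurable_one.indicator (measurableSet_singleton 0)).comp hd).mul (hf.comp hc))).div
    (hg.comp hc)

theorem measurable_rawSignal (hk : Population.KernelAssumption Ker)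
    (hf : Measurable (fun p : A × 𝒳 => (η p.1).f p.2))
    (hg : Measurable (fun p : A × 𝒳 => (η p.1).g p.2))
    (he : Measurable (fun p : A × 𝒳 => (η p.1).e p.2)) :
    Measurable (fun p : A × Obs 𝒳 => rawSignal Ker h d lam (η p.1) p.2) := by
  have hc : Measurable (fun p : A × Obs 𝒳 => (p.1, p.2.cov)) :=
    measurable_fst.prodMk (Obs.measurable_cov.comp measurable_snd)
  exact (measurable_weight hk hf hg).mul (((((Obs.measurable_t.comp measurable_snd).sub_const
    _).div_const _).mul (Obs.measurable_y.comp measurable_snd)).sub (he.comp hc))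

theorem measurable_weight_single {η : Nuisance 𝒳} (hk : Population.KernelAssumption Ker)
    (hf : Measurable η.f) (hg : Measurable η.g) : Measurable (weight Ker h d η) := by
  have hgc := hg.comp (Obs.measurable_cov (𝒳 := 𝒳))
  exact ((((hk.measurable_rescale h).comp (Obs.measurable_dose.sub_const d)).mul hgc).sub
    (((measurable_one.indicator (measurableSet_singleton 0)).comp Obs.measurable_dose).mul
      (hf.comp Obs.measurable_cov))).div hgc

theorem measurable_rawSignal_single {η : Nuisance 𝒳} (hk : Population.KernelAssumption Ker)
    (hf : Measurable η.f) (hg : Measurable η.g) (he : Measurable η.e) :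
    Measurable (rawSignal Ker h d lam η) :=
  (measurable_weight_single hk hf hg).mul ((((Obs.measurable_t.sub_const _).div_const _).mul
    Obs.measurable_y).sub (he.comp Obs.measurable_cov))

end Weight

theorem integral_sq_le_of_eLpNorm_le {E : Type*} [MeasurableSpace E] {m : Measure E} {F : E → ℝ}
    (hF : Measurable F) {δ : ℝ} (h : eLpNorm F 2 m ≤ ENNReal.ofReal δ) :
    Integrable (fun x => F x ^ 2) m ∧ ∫ x, F x ^ 2 ∂m ≤ δ ^ 2 := by
  have hL : MemLp F 2 m := ⟨hF.aestronglyMeasurable, h.trans_lt ENNReal.ofReal_lt_top⟩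
  have hi := hL.integrable_sq
  refine ⟨hi, ?_⟩
  have h1 : ∫⁻ x, ENNReal.ofReal (F x ^ 2) ∂m = eLpNorm F 2 m ^ 2 := by
    have := eLpNorm_nnreal_pow_eq_lintegral (f := F) (μ := m) (p := 2) (by norm_num)
    simp only [NNReal.coe_ofNat, ENNReal.coe_ofNat, ENNReal.rpow_ofNat] at this
    rw [this]
    refine lintegral_congr fun x => ?_
    rw [← Real.enorm_of_nonneg (sq_nonneg _), enorm_pow]
  have h2 : ENNReal.ofReal (∫ x, F x ^ 2 ∂m) ≤ ENNReal.ofReal (δ ^ 2) := by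
    rw [ofReal_integral_eq_lintegral_ofReal hi (ae_of_all _ fun _ => sq_nonneg _), h1]
    refine (pow_le_pow_left' h 2).trans ?_
    -- A negative δ truncates to 0 under `ENNReal.ofReal`; the bound δ² then holds because the norm
    -- is zero.
    rcases le_total 0 δ with h0 | h0
    · rw [ENNReal.ofReal_pow h0]
    · simp [ENNReal.ofReal_of_nonpos h0]
  exact (ENNReal.ofReal_le_ofReal_iff (sq_nonneg _)).1 h2

/-- Mean-square comparison of two values of the estimating function. -/
theorem sq_raw_sub_le {k I f f0 g g0 e e0 y B C κ U : ℝ} (hκ : 0 < κ) (hg : κ < g) (hg0 : κ < g0)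
    (hf : |f| ≤ C) (hf0 : |f0| ≤ C) (hk : |k| ≤ B) (hI : |I| ≤ 1) (hU : |y - e0| ≤ U) :
    ((k - I * (f / g)) * (y - e) - (k - I * (f0 / g0)) * (y - e0)) ^ 2
      ≤ 3 * (B ^ 2 + (C / κ) ^ 2) * (e - e0) ^ 2 + 3 * U ^ 2 * (2 / κ ^ 2) * (f - f0) ^ 2
        + 3 * U ^ 2 * (2 * C ^ 2 / κ ^ 4) * (g - g0) ^ 2 := by
  have pg := hκ.trans hg
  have pg0 := hκ.trans hg0
  have hI2 : I ^ 2 ≤ 1 := by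
    rw [← sq_abs]
    exact pow_le_one₀ (abs_nonneg _) hI
  have hk2 : k ^ 2 ≤ B ^ 2 := sq_le_sq' (abs_le.1 hk).1 (abs_le.1 hk).2
  have hf2 : f0 ^ 2 ≤ C ^ 2 := sq_le_sq' (abs_le.1 hf0).1 (abs_le.1 hf0).2
  have hU2 : (y - e0) ^ 2 ≤ U ^ 2 := sq_le_sq' (abs_le.1 hU).1 (abs_le.1 hU).2
  have hC : 0 ≤ C := (abs_nonneg _).trans hf
  have hr2 : (f / g) ^ 2 ≤ (C / κ) ^ 2 := by
    rw [← sq_abs, abs_div, abs_of_pos pg]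
    gcongr
  have hrr : (f / g - f0 / g0) ^ 2
      ≤ 2 / κ ^ 2 * (f - f0) ^ 2 + 2 * C ^ 2 / κ ^ 4 * (g - g0) ^ 2 := by
    -- Each error in the ratio is isolated, with denominators bounded below by κ and κ² and with the
    -- bounded f0 as the factor of the error in g.
    have e : f / g - f0 / g0 = (f - f0) / g - f0 * (g - g0) / (g * g0) := by
      field_simp
      ring
    have e1 : ((f - f0) / g) ^ 2 ≤ (f - f0) ^ 2 / κ ^ 2 := by
      rw [div_pow]
      gcongr
    have e2 : (f0 * (g - g0) / (g * g0)) ^ 2 ≤ C ^ 2 * (g - g0) ^ 2 / κ ^ 4 := by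
      rw [div_pow, mul_pow, mul_pow]
      have e4 : κ ^ 4 ≤ g ^ 2 * g0 ^ 2 := by
        calc κ ^ 4 = κ ^ 2 * κ ^ 2 := by ring
          _ ≤ _ := by gcongr
      gcongr
    rw [e]
    calc _ ≤ 2 * (((f - f0) / g) ^ 2 + (f0 * (g - g0) / (g * g0)) ^ 2) := by
          nlinarith [sq_nonneg ((f - f0) / g + f0 * (g - g0) / (g * g0))]
      _ ≤ 2 * ((f - f0) ^ 2 / κ ^ 2 + C ^ 2 * (g - g0) ^ 2 / κ ^ 4) := by gcongr
      _ = _ := by ring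
  -- Only the first term couples a nuisance error to the kernel value k, which is of size 1/h; the
  -- other two have bounded coefficients.
  have hdec : (k - I * (f / g)) * (y - e) - (k - I * (f0 / g0)) * (y - e0)
      = -(k * (e - e0)) + I * (f / g) * (e - e0) + -(I * (f / g - f0 / g0) * (y - e0)) := by
    ring
  rw [hdec]
  have h3sq : ∀ x y z : ℝ, (x + y + z) ^ 2 ≤ 3 * (x ^ 2 + y ^ 2 + z ^ 2) := fun x y z => by
    nlinarith [sq_nonneg (x - y), sq_nonneg (y - z), sq_nonneg (x - z)]
  refine (h3sq _ _ _).trans ?_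
  have t1 : (-(k * (e - e0))) ^ 2 ≤ B ^ 2 * (e - e0) ^ 2 := by
    rw [neg_sq, mul_pow]; gcongr
  have t2 : (I * (f / g) * (e - e0)) ^ 2 ≤ (C / κ) ^ 2 * (e - e0) ^ 2 := by
    rw [mul_pow, mul_pow]
    calc I ^ 2 * (f / g) ^ 2 * (e - e0) ^ 2 ≤ 1 * (C / κ) ^ 2 * (e - e0) ^ 2 := by gcongr
      _ = _ := by ring
  have t3 : (-(I * (f / g - f0 / g0) * (y - e0))) ^ 2
      ≤ (2 / κ ^ 2 * (f - f0) ^ 2 + 2 * C ^ 2 / κ ^ 4 * (g - g0) ^ 2) * U ^ 2 := by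
    rw [neg_sq, mul_pow, mul_pow]
    calc I ^ 2 * (f / g - f0 / g0) ^ 2 * (y - e0) ^ 2
        ≤ 1 * (2 / κ ^ 2 * (f - f0) ^ 2 + 2 * C ^ 2 / κ ^ 4 * (g - g0) ^ 2) * U ^ 2 := by gcongr
      _ = _ := by ring
  linarith

/-! ### Neyman orthogonality and moment bounds over nuisance values -/

namespace Population

variable {Ω 𝒳 : Type*} [MeasurableSpace Ω] [MeasurableSpace 𝒳]

/-- Range restrictions and mean-square error bounds for nuisance values, with errors evaluated at
the population covariates. -/
structure NuisanceBound (M : Population Ω 𝒳) (P : Measure Ω) [IsFiniteMeasure P] (Ker : ℝ → ℝ)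
    (b d ε κ C : ℝ) (η : Nuisance 𝒳) : Prop where
  measurable_f : Measurable η.f
  measurable_g : Measurable η.g
  measurable_e : Measurable η.e
  g_range : ∀ᵐ ω ∂P, κ < η.g (M.X ω)
  f_range : ∀ᵐ ω ∂P, |η.f (M.X ω)| ≤ C
  f_int : Integrable (fun ω => (η.f (M.X ω) - M.fh0 P Ker b d (M.X ω)) ^ 2) P
  g_int : Integrable (fun ω => (η.g (M.X ω) - M.g0 P (M.X ω)) ^ 2) P
  e_int : Integrable (fun ω => (η.e (M.X ω) - M.e0 P (M.X ω)) ^ 2) P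
  f_error : ∫ ω, (η.f (M.X ω) - M.fh0 P Ker b d (M.X ω)) ^ 2 ∂P ≤ ε ^ 2 / b
  g_error : ∫ ω, (η.g (M.X ω) - M.g0 P (M.X ω)) ^ 2 ∂P ≤ ε ^ 2
  e_error : ∫ ω, (η.e (M.X ω) - M.e0 P (M.X ω)) ^ 2 ∂P ≤ ε ^ 2

variable {M : Population Ω 𝒳}

theorem NuisanceBound.of_good {P : Measure Ω} [IsFiniteMeasure P] {Ker : ℝ → ℝ}
    (hk : KernelAssumption Ker) {b d ε κ c C : ℝ} (hb : 0 < b) (hc : 0 < c) {η : Nuisance 𝒳}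
    (mf : Measurable η.f) (mg : Measurable η.g) (me : Measurable η.e)
    (h1 : eLpNorm (fun x => η.f x - (M.eta0 P Ker b d).f x) 2 (P.map M.X)
      ≤ ENNReal.ofReal (ε / √b))
    (h2 : eLpNorm (fun x => η.g x - (M.eta0 P Ker b d).g x) 2 (P.map M.X) ≤ ENNReal.ofReal ε)
    (h3 : eLpNorm (fun x => η.e x - (M.eta0 P Ker b d).e x) 2 (P.map M.X) ≤ ENNReal.ofReal ε)
    (h4 : ∀ᵐ x ∂(P.map M.X), κ < η.g x ∧ η.g x < 1 - κ)
    (h5 : ∀ᵐ x ∂(P.map M.X), c < η.f x ∧ η.f x < C) :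
    M.NuisanceBound P Ker b d ε κ C η := by
  have hX := M.measurable_X.aemeasurable (μ := P)
  have df : Measurable (fun x => η.f x - (M.eta0 P Ker b d).f x) :=
    mf.sub (M.measurable_fh0 P hk b d)
  have dg : Measurable (fun x => η.g x - (M.eta0 P Ker b d).g x) := mg.sub (M.measurable_g0 P)
  have de : Measurable (fun x => η.e x - (M.eta0 P Ker b d).e x) := me.sub (M.measurable_e0 P)
  obtain ⟨i1, b1⟩ := integral_sq_le_of_eLpNorm_le df h1
  obtain ⟨i2, b2⟩ := integral_sq_le_of_eLpNorm_le dg h2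
  obtain ⟨i3, b3⟩ := integral_sq_le_of_eLpNorm_le de h3
  rw [integral_map hX (df.pow_const 2).aestronglyMeasurable] at b1
  rw [integral_map hX (dg.pow_const 2).aestronglyMeasurable] at b2
  rw [integral_map hX (de.pow_const 2).aestronglyMeasurable] at b3
  rw [div_pow, Real.sq_sqrt hb.le] at b1
  exact {
    measurable_f := mf
    measurable_g := mg
    measurable_e := me
    g_range := (ae_of_ae_map hX h4).mono fun _ h => h.1
    f_range := (ae_of_ae_map hX h5).mono fun _ h => abs_le.2 ⟨by linarith [h.1, h.2], h.2.le⟩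
    f_int := (integrable_map_measure (df.pow_const 2).aestronglyMeasurable hX).1 i1
    g_int := (integrable_map_measure (dg.pow_const 2).aestronglyMeasurable hX).1 i2
    e_int := (integrable_map_measure (de.pow_const 2).aestronglyMeasurable hX).1 i3
    f_error := b1
    g_error := b2
    e_error := b3 }

theorem rawSignal_obs {P : Measure Ω} [IsFiniteMeasure P] {Ker : ℝ → ℝ} {b d : ℝ} {η : Nuisance 𝒳}
    {ω : Ω} (hg : η.g (M.X ω) ≠ 0) :
    rawSignal Ker b d (M.lam P) η (M.obs ω)
      = (rescale Ker b (M.D ω - d) - ({0} : Set ℝ).indicator 1 (M.D ω)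
        * (η.f (M.X ω) / η.g (M.X ω))) * (M.Ylam P ω - η.e (M.X ω)) := by
  simp only [rawSignal, weight, obs, Obs.dose, Obs.cov, Obs.t, Obs.y, Ylam]
  congr 1
  field_simp

theorem abs_weight_obs_le {Ker : ℝ → ℝ} {b d κ C : ℝ} {η : Nuisance 𝒳} {ω : Ω} (hκ : 0 < κ)
    (hg : κ < η.g (M.X ω)) (hf : |η.f (M.X ω)| ≤ C) :
    |weight Ker b d η (M.obs ω)| ≤ |rescale Ker b (M.D ω - d)| + C / κ := by
  have hg0 : η.g (M.X ω) ≠ 0 := (hκ.trans hg).ne'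
  have e : weight Ker b d η (M.obs ω) = rescale Ker b (M.D ω - d)
      - ({0} : Set ℝ).indicator 1 (M.D ω) * (η.f (M.X ω) / η.g (M.X ω)) := by
    simp only [weight, obs, Obs.dose, Obs.cov]
    field_simp
  rw [e]
  refine (abs_sub _ _).trans ?_
  gcongr
  rw [abs_mul, abs_div, abs_of_pos (hκ.trans hg)]
  calc _ ≤ 1 * (C / κ) := by
        have hC := (abs_nonneg _).trans hf
        refine mul_le_mul (abs_indicator_one_le {0} (M.D ω)) ?_
          (div_nonneg (abs_nonneg _) (hκ.trans hg).le) zero_le_one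
        gcongr
    _ = _ := one_mul _

namespace Assumptions

variable {P : Measure Ω} [IsProbabilityMeasure P] {Q : Kernel ℝ Ω} {Ker : ℝ → ℝ} {h : ℕ → ℝ}
  {dL dH κ c C d : ℝ} {fD : ℝ → ℝ} {fDX : 𝒳 → ℝ → ℝ} {fYD : ℝ → ℝ → ℝ}

theorem nuisanceBound_eta0 (hA : M.Assumptions P Q Ker h dL dH κ c C fD fDX fYD) {b ε : ℝ}
    (hb : 0 < b)
    (hf : ∀ᵐ x ∂(P.map M.X), c < M.fh0 P Ker b d x ∧ M.fh0 P Ker b d x < C) :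
    M.NuisanceBound P Ker b d ε κ C (M.eta0 P Ker b d) :=
  .of_good hA.kernel hb hA.bounds.c_pos (M.measurable_fh0 P hA.kernel b d) (M.measurable_g0 P)
    (M.measurable_e0 P) (by simp) (by simp) (by simp)
    (hA.support.overlap.mono fun _ h => ⟨h.1, h.2.1⟩) hf

theorem integral_rawSignal_eq (hA : M.Assumptions P Q Ker h dL dH κ c C fD fDX fYD) {b ε : ℝ}
    (hb : 0 < b) {η : Nuisance 𝒳} (hη : M.NuisanceBound P Ker b d ε κ C η) :
    ∫ ω, rawSignal Ker b d (M.lam P) η (M.obs ω) ∂P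
      = (∫ ω, M.Ylam P ω * rescale Ker b (M.D ω - d) ∂P)
        - (∫ ω, M.e0 P (M.X ω) * rescale Ker b (M.D ω - d) ∂P)
        - ∫ ω, (M.fh0 P Ker b d (M.X ω) - M.g0 P (M.X ω) * (η.f (M.X ω) / η.g (M.X ω)))
          * (η.e (M.X ω) - M.e0 P (M.X ω)) ∂P := by
  have hκ := hA.support.κ_pos
  have hX := M.measurable_X
  have hR : ∀ᵐ ω ∂P, |η.f (M.X ω) / η.g (M.X ω)| ≤ C / κ := by
    filter_upwards [hη.g_range, hη.f_range] with ω h1 h2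
    rw [abs_div, abs_of_pos (hκ.trans h1)]
    have hC := (abs_nonneg _).trans h2
    gcongr
  have hei : Integrable (fun ω => η.e (M.X ω)) P := by
    have h1 : MemLp (fun ω => η.e (M.X ω) - M.e0 P (M.X ω)) 2 P :=
      (memLp_two_iff_integrable_sq ((hη.measurable_e.comp hX).sub
        ((M.measurable_e0 P).comp hX)).aestronglyMeasurable).2 hη.e_int
    have h2 := (h1.integrable (by norm_num)).add
      (integrable_of_ae_abs_le ((M.measurable_e0 P).comp hX) hA.ae_e0_le)
    refine h2.congr (ae_of_all _ fun ω => ?_)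
    simp
  rw [← hA.integral_raw_eq hb (r := fun x => η.f x / η.g x) (hη.measurable_f.div hη.measurable_g)
    hη.measurable_e hR hei]
  refine integral_congr_ae ?_
  filter_upwards [hη.g_range] with ω hω
  exact rawSignal_obs (hκ.trans hω).ne'

/-- With the true e the second factor of the product term is zero. -/
theorem integral_rawSignal_eta0 (hA : M.Assumptions P Q Ker h dL dH κ c C fD fDX fYD) {b fd : ℝ}
    (hb : 0 < b) (hfd : fd ≠ 0)
    (hf : ∀ᵐ x ∂(P.map M.X), c < M.fh0 P Ker b d x ∧ M.fh0 P Ker b d x < C) :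
    ∫ ω, rawSignal Ker b d (M.lam P) (M.eta0 P Ker b d) (M.obs ω) ∂P
      = fd * M.ATTh P Ker b d fd := by
  rw [hA.integral_rawSignal_eq hb (hA.nuisanceBound_eta0 (ε := 0) hb hf), hA.fD_mul_ATTh hb hfd]
  simp [eta0]

/-- Neyman orthogonality: the mean is affected only by products of nuisance errors. -/
theorem abs_integral_rawSignal_sub_le (hA : M.Assumptions P Q Ker h dL dH κ c C fD fDX fYD)
    {b ε : ℝ} (hb : 0 < b) {η : Nuisance 𝒳} (hη : M.NuisanceBound P Ker b d ε κ C η)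
    (hf : ∀ᵐ x ∂(P.map M.X), c < M.fh0 P Ker b d x ∧ M.fh0 P Ker b d x < C) :
    |(∫ ω, rawSignal Ker b d (M.lam P) η (M.obs ω) ∂P)
      - ∫ ω, rawSignal Ker b d (M.lam P) (M.eta0 P Ker b d) (M.obs ω) ∂P|
      ≤ ε ^ 2 / √b + C / κ * ε ^ 2 := by
  have hκ := hA.support.κ_pos
  have hC := hA.bounds.C_pos
  have hsb : 0 < √b := Real.sqrt_pos.2 hb
  -- The product of fd and `ATTh` does not depend on fd ≠ 0, so the value 1 is as good as f_D(d)
  -- here.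
  rw [hA.integral_rawSignal_eta0 hb one_ne_zero hf, hA.integral_rawSignal_eq hb hη,
    hA.fD_mul_ATTh hb one_ne_zero, sub_sub_cancel_left, abs_neg, ← Real.norm_eq_abs]
  have hdom : Integrable (fun ω => √b / 2 * (η.f (M.X ω) - M.fh0 P Ker b d (M.X ω)) ^ 2
      + (1 / (2 * √b) + C / κ / 2) * (η.e (M.X ω) - M.e0 P (M.X ω)) ^ 2
      + C / κ / 2 * (η.g (M.X ω) - M.g0 P (M.X ω)) ^ 2) P :=
    ((hη.f_int.const_mul _).add (hη.e_int.const_mul _)).add (hη.g_int.const_mul _)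
  refine (norm_integral_le_of_norm_le hdom ?_).trans ?_
  · filter_upwards [hη.g_range, hη.f_range] with ω h1 h2
    have hg0 := hκ.trans h1
    set F := η.f (M.X ω) - M.fh0 P Ker b d (M.X ω) with hF
    set G := η.g (M.X ω) - M.g0 P (M.X ω) with hG
    set E := η.e (M.X ω) - M.e0 P (M.X ω)
    set r := η.f (M.X ω) / η.g (M.X ω) with hr
    have hrb : |r| ≤ C / κ := by
      -- The ratio is bounded by the range restrictions alone, with no appeal to the error rates.
      rw [hr, abs_div, abs_of_pos hg0]
      gcongr
    have e : M.fh0 P Ker b d (M.X ω) - M.g0 P (M.X ω) * r = -F + G * r := by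
      rw [hF, hG, hr]
      have := hg0.ne'
      field_simp
      ring
    rw [e, Real.norm_eq_abs, abs_mul]
    have h3 : |-F + G * r| ≤ |F| + C / κ * |G| := by
      refine (abs_add_le _ _).trans ?_
      rw [abs_neg, abs_mul, mul_comm |G|]
      gcongr
    -- The weight √b balances the slower squared error ε²/b of f against the squared error ε² of e,
    -- giving ε²/√b as Cauchy–Schwarz would.
    have h4 : |F| * |E| ≤ √b / 2 * F ^ 2 + 1 / (2 * √b) * E ^ 2 := by
      rw [← sq_abs F, ← sq_abs E]
      have : √b / 2 * |F| ^ 2 + 1 / (2 * √b) * |E| ^ 2 - |F| * |E|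
          = (√b * |F| - |E|) ^ 2 / (2 * √b) := by
        field_simp
        ring
      have h5 : 0 ≤ (√b * |F| - |E|) ^ 2 / (2 * √b) := by positivity
      linarith
    have h6 : |G| * |E| ≤ (G ^ 2 + E ^ 2) / 2 := by
      rw [← sq_abs G, ← sq_abs E]
      nlinarith [sq_nonneg (|G| - |E|)]
    calc |-F + G * r| * |E| ≤ (|F| + C / κ * |G|) * |E| := by gcongr
      _ = |F| * |E| + C / κ * (|G| * |E|) := by ring
      _ ≤ (√b / 2 * F ^ 2 + 1 / (2 * √b) * E ^ 2) + C / κ * ((G ^ 2 + E ^ 2) / 2) := by gcongr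
      _ = _ := by ring
  · have i12 : Integrable (fun ω => √b / 2 * (η.f (M.X ω) - M.fh0 P Ker b d (M.X ω)) ^ 2
      + (1 / (2 * √b) + C / κ / 2) * (η.e (M.X ω) - M.e0 P (M.X ω)) ^ 2) P :=
      (hη.f_int.const_mul _).add (hη.e_int.const_mul _)
    rw [integral_add i12 (hη.g_int.const_mul _),
      integral_add (hη.f_int.const_mul _) (hη.e_int.const_mul _), integral_const_mul,
      integral_const_mul, integral_const_mul]
    have h1 := hη.f_error
    have h2 := hη.g_error
    have h3 := hη.e_error
    calc _ ≤ √b / 2 * (ε ^ 2 / b) + (1 / (2 * √b) + C / κ / 2) * ε ^ 2 + C / κ / 2 * ε ^ 2 := by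
          gcongr
      _ = ε ^ 2 / √b + C / κ * ε ^ 2 := by
          have : √b * √b = b := Real.mul_self_sqrt hb.le
          field_simp
          rw [Real.sq_sqrt hb.le]
          ring

theorem ae_abs_Ylam_sub_e0_le (hA : M.Assumptions P Q Ker h dL dH κ c C fD fDX fYD) :
    ∀ᵐ ω ∂P, |M.Ylam P ω - M.e0 P (M.X ω)| ≤ boundYlam M P C + C := by
  filter_upwards [hA.ae_Ylam_le, hA.ae_e0_le] with ω h1 h2
  exact (abs_sub _ _).trans (add_le_add h1 h2)

/-- The estimated and the true estimating functions are close in mean square. -/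
theorem exists_rawSignal_sub_sq_bound (hA : M.Assumptions P Q Ker h dL dH κ c C fD fDX fYD) :
    ∃ V > 0, ∀ b ε d : ℝ, 0 < b → b ≤ 1 → ∀ η : Nuisance 𝒳,
      M.NuisanceBound P Ker b d ε κ C η →
      (∀ᵐ x ∂(P.map M.X), c < M.fh0 P Ker b d x ∧ M.fh0 P Ker b d x < C) →
      Integrable (fun ω => (rawSignal Ker b d (M.lam P) η (M.obs ω)
        - rawSignal Ker b d (M.lam P) (M.eta0 P Ker b d) (M.obs ω)) ^ 2) P ∧
      ∫ ω, (rawSignal Ker b d (M.lam P) η (M.obs ω)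
        - rawSignal Ker b d (M.lam P) (M.eta0 P Ker b d) (M.obs ω)) ^ 2 ∂P
        ≤ V * (ε ^ 2 / b ^ 2) := by
  obtain ⟨B, hB0, hB⟩ := hA.kernel.exists_bound
  have hκ := hA.support.κ_pos
  have hC := hA.bounds.C_pos
  have hY1 := hA.boundYlam_pos
  set Y₁ : ℝ := boundYlam M P C + C with hY₁
  have hY₁0 : 0 < Y₁ := by positivity
  refine ⟨3 * (B ^ 2 + (C / κ) ^ 2 + Y₁ ^ 2 * (2 * (1 / κ ^ 2 + C ^ 2 / κ ^ 4))), by positivity,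
    fun b ε d hb hb1 η hη hf => ?_⟩
  have hη0 := hA.nuisanceBound_eta0 (ε := 0) hb hf
  have hdom : Integrable (fun ω => 3 * ((B / b) ^ 2 + (C / κ) ^ 2)
      * (η.e (M.X ω) - M.e0 P (M.X ω)) ^ 2
      + 3 * Y₁ ^ 2 * (2 / κ ^ 2) * (η.f (M.X ω) - M.fh0 P Ker b d (M.X ω)) ^ 2
      + 3 * Y₁ ^ 2 * (2 * C ^ 2 / κ ^ 4) * (η.g (M.X ω) - M.g0 P (M.X ω)) ^ 2) P :=
    ((hη.e_int.const_mul _).add (hη.f_int.const_mul _)).add (hη.g_int.const_mul _)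
  have hpt : ∀ᵐ ω ∂P, (rawSignal Ker b d (M.lam P) η (M.obs ω)
        - rawSignal Ker b d (M.lam P) (M.eta0 P Ker b d) (M.obs ω)) ^ 2
      ≤ 3 * ((B / b) ^ 2 + (C / κ) ^ 2) * (η.e (M.X ω) - M.e0 P (M.X ω)) ^ 2
      + 3 * Y₁ ^ 2 * (2 / κ ^ 2) * (η.f (M.X ω) - M.fh0 P Ker b d (M.X ω)) ^ 2
      + 3 * Y₁ ^ 2 * (2 * C ^ 2 / κ ^ 4) * (η.g (M.X ω) - M.g0 P (M.X ω)) ^ 2 := by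
    filter_upwards [hη.g_range, hη.f_range, hη0.g_range, hη0.f_range,
      hA.ae_abs_Ylam_sub_e0_le] with ω h1 h2 h3 h4 h5
    have hg := hκ.trans h1
    have hg0 := hκ.trans h3
    rw [rawSignal_obs hg.ne', rawSignal_obs hg0.ne']
    exact sq_raw_sub_le hκ h1 h3 h2 h4 (hB b hb _) (abs_indicator_one_le _ _) h5
  have hm : Measurable (fun ω => (rawSignal Ker b d (M.lam P) η (M.obs ω)
        - rawSignal Ker b d (M.lam P) (M.eta0 P Ker b d) (M.obs ω)) ^ 2) :=
    (((measurable_rawSignal_single hA.kernel hη.measurable_f hη.measurable_g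
      hη.measurable_e).comp M.measurable_obs).sub
      ((measurable_rawSignal_single hA.kernel hη0.measurable_f hη0.measurable_g
      hη0.measurable_e).comp M.measurable_obs)).pow_const 2
  have hint := hdom.mono' hm.aestronglyMeasurable (hpt.mono fun ω hω => by
    rwa [Real.norm_eq_abs, abs_of_nonneg (sq_nonneg _)])
  refine ⟨hint, (integral_mono_ae hint hdom hpt).trans ?_⟩
  have i12 : Integrable (fun ω => 3 * ((B / b) ^ 2 + (C / κ) ^ 2)
      * (η.e (M.X ω) - M.e0 P (M.X ω)) ^ 2
      + 3 * Y₁ ^ 2 * (2 / κ ^ 2) * (η.f (M.X ω) - M.fh0 P Ker b d (M.X ω)) ^ 2) P :=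
    (hη.e_int.const_mul _).add (hη.f_int.const_mul _)
  rw [integral_add i12 (hη.g_int.const_mul _),
    integral_add (hη.e_int.const_mul _) (hη.f_int.const_mul _), integral_const_mul,
    integral_const_mul, integral_const_mul]
  have h1 := hη.f_error
  have h2 := hη.g_error
  have h3 := hη.e_error
  -- The dominant term is ε²/b², from the squared kernel bound times the error in e; b ≤ 1 lets the
  -- other terms be absorbed into it.
  have hb2 : b ^ 2 ≤ 1 := pow_le_one₀ hb.le hb1
  have hE2 : ε ^ 2 ≤ ε ^ 2 / b ^ 2 := le_div_self (sq_nonneg _) (by positivity) hb2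
  have hE1 : ε ^ 2 / b ≤ ε ^ 2 / b ^ 2 := by
    gcongr
    nlinarith
  calc _ ≤ 3 * ((B / b) ^ 2 + (C / κ) ^ 2) * ε ^ 2 + 3 * Y₁ ^ 2 * (2 / κ ^ 2) * (ε ^ 2 / b)
        + 3 * Y₁ ^ 2 * (2 * C ^ 2 / κ ^ 4) * ε ^ 2 := by gcongr
    _ = 3 * B ^ 2 * (ε ^ 2 / b ^ 2) + 3 * (C / κ) ^ 2 * ε ^ 2
        + 3 * Y₁ ^ 2 * (2 / κ ^ 2) * (ε ^ 2 / b) + 3 * Y₁ ^ 2 * (2 * C ^ 2 / κ ^ 4) * ε ^ 2 := by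
        ring
    _ ≤ 3 * B ^ 2 * (ε ^ 2 / b ^ 2) + 3 * (C / κ) ^ 2 * (ε ^ 2 / b ^ 2)
        + 3 * Y₁ ^ 2 * (2 / κ ^ 2) * (ε ^ 2 / b ^ 2)
        + 3 * Y₁ ^ 2 * (2 * C ^ 2 / κ ^ 4) * (ε ^ 2 / b ^ 2) := by gcongr
    _ = _ := by ring

/-- Moments of the weights, uniformly over nuisance values in range. -/
theorem exists_weight_bound [IsMarkovKernel Q]
    (hA : M.Assumptions P Q Ker h dL dH κ c C fD fDX fYD) (hd : d ∈ Ioo dL dH) :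
    ∃ V > 0, ∀ b ε : ℝ, 0 < b → b ≤ 1 → ∀ η : Nuisance 𝒳, M.NuisanceBound P Ker b d ε κ C η →
      (∀ᵐ ω ∂P, |weight Ker b d η (M.obs ω)| ≤ V / b) ∧
      ∫ ω, |weight Ker b d η (M.obs ω)| ∂P ≤ V ∧
      ∫ ω, weight Ker b d η (M.obs ω) ^ 2 ∂P ≤ V / b := by
  obtain ⟨B, hB0, hB⟩ := hA.kernel.exists_bound
  obtain ⟨C₁, hC₁, h1⟩ := hA.exists_abs_rescale_bound hd
  obtain ⟨C₂, hC₂, h2⟩ := hA.exists_rescale_sq_bound hd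
  have hκ := hA.support.κ_pos
  have hC := hA.bounds.C_pos
  set V : ℝ := B + C₁ + 2 * C₂ + C / κ + 2 * (C / κ) ^ 2 with hV
  have hV0 : 0 < V := by positivity
  refine ⟨V, hV0, fun b ε hb hb1 η hη => ?_⟩
  have hle : ∀ᵐ ω ∂P, |weight Ker b d η (M.obs ω)| ≤ |rescale Ker b (M.D ω - d)| + C / κ := by
    filter_upwards [hη.g_range, hη.f_range] with ω h1 h2 using abs_weight_obs_le hκ h1 h2
  have hdiv : ∀ x : ℝ, 0 ≤ x → x ≤ x / b := fun x hx => le_div_self hx hb hb1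
  have hKm := M.measurable_rescale_dose hA.kernel b d
  have hKi : Integrable (fun ω => rescale Ker b (M.D ω - d)) P :=
    integrable_of_ae_abs_le hKm (ae_of_all _ fun ω => hB b hb _)
  have hK2i : Integrable (fun ω => rescale Ker b (M.D ω - d) ^ 2) P :=
    integrable_of_ae_abs_le (hKm.pow_const 2) (b := (B / b) ^ 2) (ae_of_all _ fun ω => by
      rw [abs_pow]
      gcongr
      exact hB b hb _)
  refine ⟨?_, ?_, ?_⟩
  · filter_upwards [hle] with ω hω
    refine hω.trans ?_
    have := hB b hb (M.D ω - d)
    have h3 := hdiv (C / κ) (by positivity)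
    calc |rescale Ker b (M.D ω - d)| + C / κ ≤ B / b + C / κ / b := add_le_add this h3
      _ = (B + C / κ) / b := by ring
      _ ≤ V / b := by
          gcongr
          have : 0 ≤ C₁ + 2 * C₂ + 2 * (C / κ) ^ 2 := by positivity
          rw [hV]; linarith
  · calc _ ≤ ∫ ω, (|rescale Ker b (M.D ω - d)| + C / κ) ∂P :=
          integral_mono_of_nonneg (ae_of_all _ fun _ => abs_nonneg _)
            (hKi.abs.add (integrable_const _)) hle
      _ = (∫ ω, |rescale Ker b (M.D ω - d)| ∂P) + C / κ := by
          rw [integral_add hKi.abs (integrable_const _)]; simp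
      _ ≤ C₁ + C / κ := by linarith [h1 b hb hb1]
      _ ≤ V := by
          have : 0 ≤ B + 2 * C₂ + 2 * (C / κ) ^ 2 := by positivity
          rw [hV]; linarith
  · calc _ ≤ ∫ ω, (2 * rescale Ker b (M.D ω - d) ^ 2 + 2 * (C / κ) ^ 2) ∂P := by
          refine integral_mono_of_nonneg (ae_of_all _ fun _ => sq_nonneg _)
            ((hK2i.const_mul _).add (integrable_const _)) ?_
          filter_upwards [hle] with ω hω
          rw [← sq_abs, ← sq_abs (rescale Ker b (M.D ω - d))]
          calc _ ≤ (|rescale Ker b (M.D ω - d)| + C / κ) ^ 2 := by gcongr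
            _ ≤ _ := by nlinarith [sq_nonneg (|rescale Ker b (M.D ω - d)| - C / κ)]
      _ = 2 * (∫ ω, rescale Ker b (M.D ω - d) ^ 2 ∂P) + 2 * (C / κ) ^ 2 := by
          rw [integral_add (hK2i.const_mul _) (integrable_const _), integral_const_mul]; simp
      _ ≤ 2 * (C₂ / b) + 2 * (C / κ) ^ 2 / b := by
          have := h2 b hb hb1
          have h3 := hdiv (2 * (C / κ) ^ 2) (by positivity)
          gcongr
      _ = (2 * C₂ + 2 * (C / κ) ^ 2) / b := by ring
      _ ≤ V / b := by
          gcongr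
          have : 0 ≤ B + C₁ + C / κ := by positivity
          rw [hV]; linarith

end Assumptions

end Population

/-! ### Cross-fitted averages controlled only on good auxiliary samples -/

section GoodSets

variable {S E : Type*} [MeasurableSpace S] [MeasurableSpace E] {μ : Measure S} {ν : Measure E}
  {Z : ℕ → S → E} {T : ℕ → Finset ℕ} {A : ℕ → Type*} [∀ n, MeasurableSpace (A n)]
  {α : ∀ n, S → A n}

theorem BoundedInProb.of_bad {X Y : ℕ → S → ℝ} {bad : ℕ → Set S}
    (hbad : Tendsto (fun n => μ (bad n)) atTop (𝓝 0)) (hX : BoundedInProb μ X)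
    (h : ∀ᶠ n in atTop, ∀ s ∉ bad n, |Y n s| ≤ |X n s|) : BoundedInProb μ Y := by
  intro γ hγ
  obtain ⟨B, hB⟩ := hX (γ / 2) (by positivity)
  refine ⟨B, ?_⟩
  filter_upwards [hB, h, hbad.eventually
    (Iic_mem_nhds (ENNReal.ofReal_pos.2 (half_pos hγ)))] with n h1 h2 h3
  calc μ {s | B < |Y n s|} ≤ μ ({s | B < |X n s|} ∪ bad n) := by
        refine measure_mono fun s hs => ?_
        by_cases hb : s ∈ bad n
        · exact .inr hb
        · exact .inl (lt_of_lt_of_le hs (h2 s hb))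
    _ ≤ ENNReal.ofReal (γ / 2) + ENNReal.ofReal (γ / 2) :=
        (measure_union_le _ _).trans (add_le_add h1 h3)
    _ = ENNReal.ofReal γ := by
        rw [← ENNReal.ofReal_add (by positivity) (by positivity), add_halves]

theorem BoundedInProb.const_mul {X : ℕ → S → ℝ} {x : ℕ → ℝ} {B : ℝ}
    (hX : BoundedInProb μ X) (hx : ∀ᶠ n in atTop, |x n| ≤ B) :
    BoundedInProb μ (fun n s => x n * X n s) := by
  intro γ hγ
  obtain ⟨B', hB'⟩ := hX γ hγ
  refine ⟨|B| * |B'|, ?_⟩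
  filter_upwards [hB', hx] with n h1 h2
  refine (measure_mono fun s hs => ?_).trans h1
  simp only [mem_ofPred_eq] at hs ⊢
  by_contra hcon
  rw [abs_mul] at hs
  have h3 : |x n| * |X n s| ≤ |B| * |B'| :=
    mul_le_mul (h2.trans (le_abs_self _)) ((not_lt.1 hcon).trans (le_abs_self _)) (abs_nonneg _)
      (abs_nonneg _)
  linarith

theorem measurable_uncurry_indicator {A : Type*} [MeasurableSpace A] {u : A → E → ℝ}
    (hu : Measurable (Function.uncurry u)) {G : Set A} (hG : MeasurableSet G) :
    Measurable (Function.uncurry fun a z => G.indicator (fun a => u a z) a) := by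
  have h : (Function.uncurry fun a z => G.indicator (fun a => u a z) a)
      = (Prod.fst ⁻¹' G).indicator (Function.uncurry u) := by
    funext p
    by_cases hp : p.1 ∈ G <;> simp [Function.uncurry, hp]
  rw [h]
  exact hu.indicator (measurable_fst hG)

/-- Averages without an auxiliary sample. -/
theorem CrossFit.trivial [IsProbabilityMeasure μ] (hZ : ∀ i, Measurable (Z i)) (hind : iIndepFun Z μ)
    (hlaw : ∀ i, μ.map (Z i) = ν) (hT : Tendsto (fun n => ((T n).card : ℝ)) atTop atTop) :
    CrossFit μ ν Z T (A := fun _ => Unit) (fun _ _ => ()) where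
  measurable := hZ
  indep := hind
  law := hlaw
  card_top := hT
  measurable_aux := fun _ => measurable_const
  indep_aux := fun _ => indepFun_const_left _ _

variable [IsProbabilityMeasure μ] [IsProbabilityMeasure ν]

/-- Setting the summand to zero outside the good set makes the moment bounds hold for every
auxiliary value, as the uniform version needs. The two averages differ only on an event of vanishing
probability. -/
theorem CrossFit.smallInProb_of_good (hc : CrossFit μ ν Z T α) {u : ∀ n, A n → E → ℝ}
    (hu : ∀ n, Measurable (Function.uncurry (u n))) {G : ∀ n, Set (A n)}
    (hG : ∀ n, MeasurableSet (G n)) (hbad : Tendsto (fun n => μ {s | α n s ∉ G n}) atTop (𝓝 0))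
    {V b : ℕ → ℝ} (hVn : ∀ n, 0 ≤ V n) (hbn : ∀ n, 0 ≤ b n)
    (hgood : ∀ᶠ n in atTop, ∀ a ∈ G n, MemLp (u n a) 2 ν ∧ ∫ z, u n a z ^ 2 ∂ν ≤ V n ∧
      |∫ z, u n a z ∂ν| ≤ b n)
    (hV0 : Tendsto (fun n => V n / (T n).card) atTop (𝓝 0)) (hb0 : Tendsto b atTop (𝓝 0)) :
    SmallInProb μ (fun n s => ((T n).card : ℝ)⁻¹ * ∑ i ∈ T n, u n (α n s) (Z i s)) := by
  refine (hc.smallInProb (fun n => measurable_uncurry_indicator (hu n) (hG n)) (V := V) (b := b)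
    ?_ ?_ ?_ hV0 hb0).of_eventually_bad hbad (.of_forall fun n s hs => ?_)
  · filter_upwards [hgood] with n hn a
    by_cases ha : a ∈ G n
    · simpa [ha] using (hn a ha).1
    · simp [ha]
  · filter_upwards [hgood] with n hn a
    by_cases ha : a ∈ G n
    · simpa [ha] using (hn a ha).2.1
    · simpa [ha] using hVn n
  · filter_upwards [hgood] with n hn a
    by_cases ha : a ∈ G n
    · simpa [ha] using (hn a ha).2.2
    · simpa [ha] using hbn n
  · simp only [mem_ofPred_eq, not_not] at hs
    simp [hs]

theorem CrossFit.boundedInProb_of_good (hc : CrossFit μ ν Z T α) {u : ∀ n, A n → E → ℝ}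
    (hu : ∀ n, Measurable (Function.uncurry (u n))) {G : ∀ n, Set (A n)}
    (hG : ∀ n, MeasurableSet (G n)) (hbad : Tendsto (fun n => μ {s | α n s ∉ G n}) atTop (𝓝 0))
    {V : ℕ → ℝ} {b B : ℝ} (hVn : ∀ n, 0 ≤ V n) (hbn : 0 ≤ b)
    (hgood : ∀ᶠ n in atTop, ∀ a ∈ G n, MemLp (u n a) 2 ν ∧ ∫ z, u n a z ^ 2 ∂ν ≤ V n ∧
      |∫ z, u n a z ∂ν| ≤ b)
    (hVB : ∀ᶠ n in atTop, V n / (T n).card ≤ B) :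
    BoundedInProb μ (fun n s => ((T n).card : ℝ)⁻¹ * ∑ i ∈ T n, u n (α n s) (Z i s)) := by
  refine (hc.boundedInProb (fun n => measurable_uncurry_indicator (hu n) (hG n)) (V := V) (b := b)
    ?_ ?_ ?_ hVB).of_bad hbad (.of_forall fun n s hs => ?_)
  · filter_upwards [hgood] with n hn a
    by_cases ha : a ∈ G n
    · simpa [ha] using (hn a ha).1
    · simp [ha]
  · filter_upwards [hgood] with n hn a
    by_cases ha : a ∈ G n
    · simpa [ha] using (hn a ha).2.1
    · simpa [ha] using hVn n
  · filter_upwards [hgood] with n hn a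
    by_cases ha : a ∈ G n
    · simpa [ha] using (hn a ha).2.2
    · simpa [ha] using hbn
  · simp only [mem_ofPred_eq, not_not] at hs
    simp [hs]

end GoodSets

/-! ### Folds as sets of observation numbers -/

section Folds

variable {K : ℕ} {S 𝒳 : Type*}

/-- The numbers of the observations in fold `k`. -/
def foldSet {n : ℕ} (fold : Fin (K * n) → Fin K) (k : Fin K) : Finset ℕ :=
  (Finset.univ.filter fun i => fold i = k).map Fin.valEmbedding

/-- The numbers of the observations outside fold `k`. -/
def coFoldSet {n : ℕ} (fold : Fin (K * n) → Fin K) (k : Fin K) : Finset ℕ :=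
  (Finset.univ.filter fun i => fold i ≠ k).map Fin.valEmbedding

theorem sum_foldSet {n : ℕ} (fold : Fin (K * n) → Fin K) (k : Fin K) (g : ℕ → ℝ) :
    ∑ i ∈ foldSet fold k, g i = ∑ i ∈ Finset.univ.filter (fun i => fold i = k), g i := by
  simp [foldSet]

theorem sum_coFoldSet {n : ℕ} (fold : Fin (K * n) → Fin K) (k : Fin K) (g : ℕ → ℝ) :
    ∑ i ∈ coFoldSet fold k, g i = ∑ i ∈ Finset.univ.filter (fun i => fold i ≠ k), g i := by
  simp [coFoldSet]

variable {fold : ∀ n : ℕ, Fin (K * n) → Fin K}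

theorem IsEqualPartition.card_foldSet (hf : IsEqualPartition fold) (n : ℕ) (k : Fin K) :
    (foldSet (fold n) k).card = n := by
  rw [foldSet, Finset.card_map, hf n k]

theorem IsEqualPartition.card_coFoldSet (hf : IsEqualPartition fold) (n : ℕ) (k : Fin K) :
    ((coFoldSet (fold n) k).card : ℝ) = (K : ℝ) * n - n := by
  have h := Finset.card_filter_add_card_filter_not (s := Finset.univ) (fun i => fold n i = k)
  rw [hf n k, Finset.card_univ, Fintype.card_fin] at h
  rw [coFoldSet, Finset.card_map, eq_sub_iff_add_eq']
  exact_mod_cast h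

theorem disjoint_coFoldSet_foldSet {n : ℕ} (fold : Fin (K * n) → Fin K) (k : Fin K) :
    Disjoint (coFoldSet fold k) (foldSet fold k) := by
  rw [coFoldSet, foldSet, Finset.disjoint_map]
  exact (Finset.disjoint_filter_filter_not _ _ _).symm

variable [MeasurableSpace S] [MeasurableSpace 𝒳] {μ : Measure S} {Z : ℕ → S → Obs 𝒳}

theorem measurable_firstObs (hZ : ∀ i, Measurable (Z i)) (N : ℕ) : Measurable (firstObs Z N) :=
  measurable_pi_lambda _ fun i => hZ i

theorem measurable_auxSample {n : ℕ} (fold : Fin (K * n) → Fin K) (k : Fin K) :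
    Measurable (auxSample (𝒳 := 𝒳) fold k) :=
  measurable_pi_lambda _ fun i => measurable_pi_apply i.1

/-- The fold and its complement are disjoint sets of indices of an independent sequence. -/
theorem indepFun_auxSample {n : ℕ} (fold : Fin (K * n) → Fin K) (k : Fin K)
    (hZ : ∀ i, Measurable (Z i)) (hind : iIndepFun Z μ) :
    IndepFun (fun s => auxSample fold k (firstObs Z (K * n) s))
      (fun s (i : foldSet fold k) => Z i s) μ := by
  have h := hind.indepFun_finset _ _ (disjoint_coFoldSet_foldSet fold k) hZ
  -- The auxiliary sample is a relabelling of the observations indexed by the complement of the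
  -- fold.
  have hφ : Measurable (fun (w : coFoldSet fold k → Obs 𝒳) (i : {i // fold i ≠ k}) =>
      w ⟨i.1, Finset.mem_map.2 ⟨i.1, by simpa using i.2, rfl⟩⟩) :=
    measurable_pi_lambda _ fun i => measurable_pi_apply _
  exact h.comp hφ measurable_id

theorem crossFit_aux [IsProbabilityMeasure μ] {ν : Measure (Obs 𝒳)} (hf : IsEqualPartition fold)
    (hZ : ∀ i, Measurable (Z i)) (hind : iIndepFun Z μ) (hlaw : ∀ i, μ.map (Z i) = ν)
    (k : Fin K) :
    CrossFit μ ν Z (fun n => foldSet (fold n) k) (A := fun n => AuxData 𝒳 (fold n) k)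
      (fun n s => auxSample (fold n) k (firstObs Z (K * n) s)) where
  measurable := hZ
  indep := hind
  law := hlaw
  card_top := by
    simp_rw [hf.card_foldSet]
    exact tendsto_natCast_atTop_atTop
  measurable_aux := fun n => (measurable_auxSample _ _).comp (measurable_firstObs hZ _)
  indep_aux := fun n => indepFun_auxSample _ _ hZ hind

end Folds

/-! ### Measurable sets of good nuisance values -/

section Good

/-- For exponent 2 the norm is a power of an integral, and Tonelli's theorem makes the integral
measurable in the parameter. -/
theorem measurable_eLpNorm_two {A E : Type*} [MeasurableSpace A] [MeasurableSpace E]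
    {m : Measure E} [SFinite m] {F : A → E → ℝ} (hF : Measurable (Function.uncurry F)) :
    Measurable (fun a => eLpNorm (F a) 2 m) := by
  simp_rw [eLpNorm_eq_lintegral_rpow_enorm_toReal (p := 2) (by norm_num) (by norm_num)]
  refine Measurable.pow_const ?_ _
  exact (hF.enorm.pow_const _).lintegral_prod_right'

/-- The condition says that a section of the complement has measure zero, and measures of sections
are measurable. -/
theorem measurableSet_ae {A E : Type*} [MeasurableSpace A] [MeasurableSpace E]
    {m : Measure E} [SFinite m] {p : A → E → Prop}
    (hp : MeasurableSet {q : A × E | p q.1 q.2}) : MeasurableSet {a | ∀ᵐ x ∂m, p a x} := by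
  have : {a | ∀ᵐ x ∂m, p a x} = (fun a => m (Prod.mk a ⁻¹' {q : A × E | p q.1 q.2}ᶜ)) ⁻¹' {0} := by
    ext a
    rfl
  rw [this]
  exact measurable_measure_prodMk_left hp.compl (measurableSet_singleton 0)

end Good

/-! ### Scales, and the rates of the estimators of `λ` and of the dose density -/

theorem integral_sub_mean_sq_le {Ω : Type*} [MeasurableSpace Ω] {P : Measure Ω}
    [IsProbabilityMeasure P] {X : Ω → ℝ} (hX : AEMeasurable X P) :
    ∫ ω, (X ω - ∫ ω', X ω' ∂P) ^ 2 ∂P ≤ ∫ ω, X ω ^ 2 ∂P := by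
  rw [← variance_eq_integral hX]
  exact variance_le_expectation_sq hX.aestronglyMeasurable

/-- The weights `(t - l) / (l (1 - l))` are locally Lipschitz in `l`. -/
theorem exists_lipschitz_lam {l₀ : ℝ} (h0 : 0 < l₀) (h1 : l₀ < 1) :
    ∃ L ρ : ℝ, 0 < ρ ∧ 0 ≤ L ∧ ∀ l, |l - l₀| < ρ → ∀ t : ℝ,
      |(t - l) / (l * (1 - l)) - (t - l₀) / (l₀ * (1 - l₀))| ≤ L * |l - l₀| * (1 + |t|) := by
  have hne : l₀ * (1 - l₀) ≠ 0 := (mul_pos h0 (sub_pos.2 h1)).ne'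
  have hA : DifferentiableAt ℝ (fun l : ℝ => (l * (1 - l))⁻¹) l₀ := by
    fun_prop (disch := exact hne)
  have hB : DifferentiableAt ℝ (fun l : ℝ => l * (l * (1 - l))⁻¹) l₀ := by
    fun_prop (disch := exact hne)
  obtain ⟨a, ha0, ha⟩ := hA.isBigO_sub.exists_pos
  obtain ⟨b, hb0, hb⟩ := hB.isBigO_sub.exists_pos
  obtain ⟨ρ, hρ, hball⟩ := Metric.eventually_nhds_iff.1 (ha.bound.and hb.bound)
  refine ⟨a + b, ρ, hρ, by positivity, fun l hl t => ?_⟩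
  obtain ⟨h2, h3⟩ := hball (y := l) (by rwa [Real.dist_eq])
  rw [Real.norm_eq_abs, Real.norm_eq_abs] at h2 h3
  -- The weight is affine in t, so differentiability of its two coefficients at l₀ gives a Lipschitz
  -- bound whose constants are free of t.
  have e : (t - l) / (l * (1 - l)) - (t - l₀) / (l₀ * (1 - l₀))
      = t * ((l * (1 - l))⁻¹ - (l₀ * (1 - l₀))⁻¹)
        - (l * (l * (1 - l))⁻¹ - l₀ * (l₀ * (1 - l₀))⁻¹) := by
    rw [div_eq_mul_inv, div_eq_mul_inv]
    ring
  rw [e]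
  calc _ ≤ |t| * (a * |l - l₀|) + b * |l - l₀| := by
        refine (abs_sub _ _).trans ?_
        rw [abs_mul]
        gcongr
    _ ≤ (a + b) * |l - l₀| * (1 + |t|) := by
        have h4 : 0 ≤ a * |l - l₀| := by positivity
        have h5 : 0 ≤ b * |l - l₀| * |t| := by positivity
        nlinarith

/-- The normalization `√(N h)`. -/
def rootNh (K : ℕ) (h : ℕ → ℝ) (n : ℕ) : ℝ := √(((K * n : ℕ) : ℝ) * h n)

theorem rootNh_nonneg (K : ℕ) (h : ℕ → ℝ) (n : ℕ) : 0 ≤ rootNh K h n := Real.sqrt_nonneg _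

theorem rootNh_eq (K : ℕ) (h : ℕ → ℝ) (n : ℕ) :
    rootNh K h n = √((K * n : ℕ) : ℝ) * √(h n) := Real.sqrt_mul (by positivity) _

namespace Population

variable {Ω 𝒳 : Type*} [MeasurableSpace Ω] [MeasurableSpace 𝒳] {M : Population Ω 𝒳}
  {P : Measure Ω}

theorem integral_obs {u : Obs 𝒳 → ℝ} (hu : Measurable u) :
    ∫ z, u z ∂(P.map M.obs) = ∫ ω, u (M.obs ω) ∂P :=
  integral_map M.measurable_obs.aemeasurable hu.aestronglyMeasurable

theorem memLp_obs {u : Obs 𝒳 → ℝ} (hu : Measurable u)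
    (hi : Integrable (fun ω => u (M.obs ω) ^ 2) P) : MemLp u 2 (P.map M.obs) :=
  (memLp_map_measure_iff hu.aestronglyMeasurable M.measurable_obs.aemeasurable).2
    ((memLp_two_iff_integrable_sq (hu.comp M.measurable_obs).aestronglyMeasurable).2 hi)

theorem abs_T_le (M : Population Ω 𝒳) (ω : Ω) : |M.T ω| ≤ 1 := by
  rcases M.T_binary ω with h | h <;> simp [h]

theorem integral_T [IsFiniteMeasure P] : ∫ ω, M.T ω ∂P = M.lam P := by
  have h : ∀ ω, M.T ω = (M.T ⁻¹' {1}).indicator 1 ω := by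
    intro ω
    rcases M.T_binary ω with h | h <;> simp [h]
  rw [integral_congr_ae (ae_of_all _ h),
    integral_indicator_one (M.measurable_T (measurableSet_singleton 1))]
  rfl

end Population

/-- The standing assumptions on the population, the sample, the folds, and the rates. -/
structure Sampling {Ω 𝒳 S : Type*} [MeasurableSpace Ω] [MeasurableSpace 𝒳] [MeasurableSpace S]
    (M : Population Ω 𝒳) (P : Measure Ω) [IsProbabilityMeasure P] (Q : Kernel ℝ Ω)
    (Ker : ℝ → ℝ) (h ε : ℕ → ℝ) (dL dH κ c C d : ℝ) (fD : ℝ → ℝ) (fDX : 𝒳 → ℝ → ℝ)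
    (fYD : ℝ → ℝ → ℝ) (μ : Measure S) (Z : ℕ → S → Obs 𝒳) {K : ℕ}
    (fold : ∀ n : ℕ, Fin (K * n) → Fin K) (η : NuisanceEstimator 𝒳 fold) : Prop where
  pop : M.Assumptions P Q Ker h dL dH κ c C fD fDX fYD
  mem : d ∈ Ioo dL dH
  two_le : 2 ≤ K
  sample : IsIIDSample M P μ Z
  partition : IsEqualPartition fold
  rates : Rates M P μ Z Ker d κ c C fold η h ε
  fast : ε =o[atTop] fun n : ℕ => ((K * n : ℕ) : ℝ) ^ (-(1 / 4) : ℝ)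

namespace Sampling

variable {Ω 𝒳 S : Type*} [MeasurableSpace Ω] [MeasurableSpace 𝒳] [MeasurableSpace S]
  {M : Population Ω 𝒳} {P : Measure Ω} [IsProbabilityMeasure P] {Q : Kernel ℝ Ω}
  {Ker : ℝ → ℝ} {h ε : ℕ → ℝ} {dL dH κ c C d : ℝ} {fD : ℝ → ℝ} {fDX : 𝒳 → ℝ → ℝ}
  {fYD : ℝ → ℝ → ℝ} {μ : Measure S} {Z : ℕ → S → Obs 𝒳} {K : ℕ}
  {fold : ∀ n : ℕ, Fin (K * n) → Fin K} {η : NuisanceEstimator 𝒳 fold}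

section Scales

theorem cast_K_pos (hS : Sampling M P Q Ker h ε dL dH κ c C d fD fDX fYD μ Z fold η) :
    (0 : ℝ) < K := by
  have := hS.two_le
  exact_mod_cast (by lia : 0 < K)

theorem sq_rootNh (hS : Sampling M P Q Ker h ε dL dH κ c C d fD fDX fYD μ Z fold η) (n : ℕ) :
    rootNh K h n ^ 2 = K * n * h n := by
  have := (hS.rates.h_pos n).le
  rw [rootNh, Real.sq_sqrt (by positivity)]
  push_cast
  ring

theorem tendsto_rootNh (hS : Sampling M P Q Ker h ε dL dH κ c C d fD fDX fYD μ Z fold η) :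
    Tendsto (rootNh K h) atTop atTop := Real.tendsto_sqrt_atTop.comp hS.rates.Nh_top

/-- √(Nh) h² is √(N h⁵), so undersmoothing removes all biases of order h². -/
theorem tendsto_rootNh_mul_sq
    (hS : Sampling M P Q Ker h ε dL dH κ c C d fD fDX fYD μ Z fold η) :
    Tendsto (fun n => rootNh K h n * h n ^ 2) atTop (𝓝 0) := by
  refine hS.rates.undersmoothing.congr fun n => ?_
  have h0 := (hS.rates.h_pos n).le
  have : ((K * n : ℕ) : ℝ) * h n ^ 5 = ((K * n : ℕ) : ℝ) * h n * (h n ^ 2) ^ 2 := by ring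
  rw [this, Real.sqrt_mul (by positivity), Real.sqrt_sq (by positivity), rootNh]

theorem tendsto_sqrt_h (hS : Sampling M P Q Ker h ε dL dH κ c C d fD fDX fYD μ Z fold η) :
    Tendsto (fun n => √(h n)) atTop (𝓝 0) := by
  have h1 := (Real.continuous_sqrt.tendsto 0).comp hS.rates.h_zero
  rw [Real.sqrt_zero] at h1
  exact h1

theorem tendsto_sqrt_mul_sq (hS : Sampling M P Q Ker h ε dL dH κ c C d fD fDX fYD μ Z fold η) :
    Tendsto (fun n => √((K * n : ℕ) : ℝ) * ε n ^ 2) atTop (𝓝 0) := by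
  have h1 := hS.fast.tendsto_div_nhds_zero.pow 2
  rw [zero_pow (by norm_num)] at h1
  refine h1.congr fun n => ?_
  rw [div_pow, ← Real.rpow_natCast (_ ^ (-(1 / 4) : ℝ)), ← Real.rpow_mul (by positivity),
    Real.sqrt_eq_rpow, div_eq_mul_inv, ← Real.rpow_neg (by positivity), mul_comm]
  norm_num

/-- The factor √h in √(Nh) cancels the 1/√h of the orthogonality bound, leaving √N ε², which
vanishes because ε = o(N^{-1/4}). -/
theorem tendsto_bias (hS : Sampling M P Q Ker h ε dL dH κ c C d fD fDX fYD μ Z fold η) (a : ℝ) :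
    Tendsto (fun n => rootNh K h n * (ε n ^ 2 / √(h n) + a * ε n ^ 2)) atTop (𝓝 0) := by
  have h1 := hS.tendsto_sqrt_mul_sq.mul ((hS.tendsto_sqrt_h.const_mul a).const_add 1)
  rw [zero_mul] at h1
  refine h1.congr fun n => ?_
  have h0 := Real.sqrt_pos.2 (hS.rates.h_pos n)
  rw [rootNh_eq]
  field_simp

theorem eventually_regular (hS : Sampling M P Q Ker h ε dL dH κ c C d fD fDX fYD μ Z fold η) :
    ∀ᶠ n in atTop, 1 ≤ n ∧ h n ≤ 1 ∧
      ∀ᵐ x ∂(P.map M.X), c < M.fh0 P Ker (h n) d x ∧ M.fh0 P Ker (h n) d x < C := by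
  filter_upwards [eventually_ge_atTop 1, hS.rates.h_zero.eventually (Iic_mem_nhds one_pos),
    hS.pop.bounds.fh0_bound] with n h1 h2 h3
  exact ⟨h1, h2, h3.mono fun x hx => hx d hS.mem⟩

/-- The complement has (K - 1)n elements, and K ≥ 2 gives K - 1 ≥ K/2. -/
theorem card_coFold_ge (hS : Sampling M P Q Ker h ε dL dH κ c C d fD fDX fYD μ Z fold η) (n : ℕ)
    (k : Fin K) : (K : ℝ) * n / 2 ≤ (coFoldSet (fold n) k).card := by
  rw [hS.partition.card_coFoldSet]
  have : (2 : ℝ) ≤ K := by exact_mod_cast hS.two_le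
  have hn : (0 : ℝ) ≤ n := by positivity
  nlinarith

/-- Centering and scaling an average over the complement of a fold. -/
theorem coFold_mean_sub (hS : Sampling M P Q Ker h ε dL dH κ c C d fD fDX fYD μ Z fold η) {n : ℕ}
    (hn : 1 ≤ n) (k : Fin K) (w : Obs 𝒳 → ℝ) (r a : ℝ) (s : S) :
    ((coFoldSet (fold n) k).card : ℝ)⁻¹ * ∑ i ∈ coFoldSet (fold n) k, r * (w (Z i s) - a)
      = r * (((K : ℝ) * n - n)⁻¹
        * ∑ i ∈ Finset.univ.filter (fun i => fold n i ≠ k), w (firstObs Z (K * n) s i) - a) := by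
  have hc := hS.card_coFold_ge n k
  have hn' : (0 : ℝ) < n := by exact_mod_cast hn
  have hpos : (0 : ℝ) < (coFoldSet (fold n) k).card :=
    lt_of_lt_of_le (by have := hS.cast_K_pos; positivity) hc
  rw [← Finset.mul_sum, Finset.sum_sub_distrib, Finset.sum_const, nsmul_eq_mul,
    sum_coFoldSet (fold n) k (fun i => w (Z i s)), ← hS.partition.card_coFoldSet n k]
  simp only [firstObs]
  field_simp

end Scales

variable [IsProbabilityMeasure μ]

theorem isProbabilityMeasure_law (M : Population Ω 𝒳) (P : Measure Ω) [IsProbabilityMeasure P] :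
    IsProbabilityMeasure (P.map M.obs) :=
  Measure.isProbabilityMeasure_map M.measurable_obs.aemeasurable

theorem crossFit_fold (hS : Sampling M P Q Ker h ε dL dH κ c C d fD fDX fYD μ Z fold η)
    (k : Fin K) :
    CrossFit μ (P.map M.obs) Z (fun n => foldSet (fold n) k) (A := fun _ => Unit)
      (fun _ _ => ()) :=
  .trivial hS.sample.measurable hS.sample.indep hS.sample.law (by
    simp_rw [hS.partition.card_foldSet]
    exact tendsto_natCast_atTop_atTop)

theorem crossFit_coFold (hS : Sampling M P Q Ker h ε dL dH κ c C d fD fDX fYD μ Z fold η)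
    (k : Fin K) :
    CrossFit μ (P.map M.obs) Z (fun n => coFoldSet (fold n) k) (A := fun _ => Unit)
      (fun _ _ => ()) := by
  refine .trivial hS.sample.measurable hS.sample.indep hS.sample.law ?_
  refine tendsto_atTop_mono (fun n => hS.card_coFold_ge n k) ?_
  refine (tendsto_natCast_atTop_atTop.const_mul_atTop hS.cast_K_pos).atTop_div_const (by norm_num)

theorem lamHat_rate (hS : Sampling M P Q Ker h ε dL dH κ c C d fD fDX fYD μ Z fold η)
    (k : Fin K) :
    BoundedInProb μ (fun n s => √((K * n : ℕ) : ℝ)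
      * (lamHat (fold n) (firstObs Z (K * n) s) k - M.lam P)) := by
  have := isProbabilityMeasure_law M P
  have hm : ∀ n : ℕ, Measurable (fun z : Obs 𝒳 => √((K * n : ℕ) : ℝ) * (z.t - M.lam P)) :=
    fun n => (Obs.measurable_t.sub_const _).const_mul _
  have hb : ∀ (n : ℕ) ω, (√((K * n : ℕ) : ℝ) * ((M.obs ω).t - M.lam P)) ^ 2 ≤ K * n := by
    intro n ω
    rw [mul_pow, Real.sq_sqrt (by positivity)]
    push_cast
    have h0 := hS.pop.crossSections.lam_pos
    have h1 := hS.pop.crossSections.lam_lt_one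
    have h2 : ((M.obs ω).t - M.lam P) ^ 2 ≤ 1 := by
      rw [show (M.obs ω).t = M.T ω from rfl]
      rcases M.T_binary ω with h | h <;> rw [h] <;> nlinarith
    have : (0 : ℝ) ≤ K * n := by positivity
    nlinarith
  have hi : ∀ n : ℕ, Integrable (fun ω => (√((K * n : ℕ) : ℝ)
      * ((M.obs ω).t - M.lam P)) ^ 2) P := fun n =>
    integrable_of_ae_abs_le (((hm n).comp M.measurable_obs).pow_const 2) (b := K * n)
      (ae_of_all _ fun ω => by rw [abs_of_nonneg (sq_nonneg _)]; exact hb n ω)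
  have key := (hS.crossFit_coFold k).boundedInProb
    (u := fun n _ z => √((K * n : ℕ) : ℝ) * (z.t - M.lam P))
    (fun n => (hm n).comp measurable_snd) (V := fun n => K * n) (b := 0) (B := 2)
    (.of_forall fun n _ => Population.memLp_obs (hm n) (hi n))
    (.of_forall fun n _ => by
      rw [Population.integral_obs ((hm n).pow_const 2)]
      calc _ ≤ ∫ _, (K * n : ℝ) ∂P := integral_mono (hi n) (integrable_const _) (hb n)
        _ = _ := by simp)
    (.of_forall fun n _ => by
      rw [Population.integral_obs (hm n), integral_const_mul, integral_sub]
      · rw [show (fun ω => (M.obs ω).t) = M.T from rfl, Population.integral_T]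
        simp
      · exact integrable_of_ae_abs_le M.measurable_T (b := 1) (ae_of_all _ M.abs_T_le)
      · exact integrable_const _)
    (by
      filter_upwards [eventually_ge_atTop 1] with n hn
      have hc := hS.card_coFold_ge n k
      have hn' : (0 : ℝ) < n := by exact_mod_cast hn
      have := hS.cast_K_pos
      rw [div_le_iff₀ (lt_of_lt_of_le (by positivity) hc)]
      linarith)
  refine key.mono ?_
  filter_upwards [eventually_ge_atTop 1] with n hn s
  rw [hS.coFold_mean_sub hn k Obs.t]
  rfl

/-- √(Nh) is √N times √h, and √h → 0: a parametric rate is negligible on the nonparametric scale. -/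
theorem lamHat_scaled (hS : Sampling M P Q Ker h ε dL dH κ c C d fD fDX fYD μ Z fold η)
    (k : Fin K) :
    SmallInProb μ (fun n s => rootNh K h n
      * (lamHat (fold n) (firstObs Z (K * n) s) k - M.lam P)) := by
  refine ((hS.lamHat_rate k).mul_small (smallInProb_of_tendsto hS.tendsto_sqrt_h)).mono
    (.of_forall fun n s => ?_)
  rw [rootNh_eq, mul_right_comm]

theorem lamHat_consistent (hS : Sampling M P Q Ker h ε dL dH κ c C d fD fDX fYD μ Z fold η)
    (k : Fin K) :
    SmallInProb μ (fun n s => lamHat (fold n) (firstObs Z (K * n) s) k - M.lam P) := by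
  refine (hS.lamHat_scaled k).mono ?_
  filter_upwards [hS.tendsto_rootNh.eventually_ge_atTop 1] with n hn s
  rw [abs_mul, abs_of_pos (one_pos.trans_le hn)]
  exact le_mul_of_one_le_left (abs_nonneg _) hn

/-- The second moment O(1/h) of K_h is offset by the factor Nh, leaving an O(1) variance after
averaging. The bias O(h²) stays bounded after scaling by undersmoothing. -/
theorem fHat_rate [IsMarkovKernel Q]
    (hS : Sampling M P Q Ker h ε dL dH κ c C d fD fDX fYD μ Z fold η) (k : Fin K) :
    BoundedInProb μ (fun n s => rootNh K h n
      * (fHat Ker (h n) d (fold n) (firstObs Z (K * n) s) k - fD d)) := by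
  have := isProbabilityMeasure_law M P
  obtain ⟨C₁, hC₁, h1⟩ := hS.pop.exists_mean_rescale_bound hS.mem
  obtain ⟨C₂, hC₂, h2⟩ := hS.pop.exists_rescale_sq_bound hS.mem
  obtain ⟨B, hB0, hB⟩ := hS.pop.kernel.exists_bound
  have hm : ∀ n : ℕ, Measurable (fun z : Obs 𝒳 =>
      rootNh K h n * (rescale Ker (h n) (z.dose - d) - fD d)) := fun n =>
    ((((hS.pop.kernel.measurable_rescale (h n)).comp (Obs.measurable_dose.sub_const d)).sub_const
      _)).const_mul _
  have hi0 : ∀ n : ℕ, Integrable (fun ω => rescale Ker (h n) (M.D ω - d)) P := fun n =>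
    integrable_of_ae_abs_le (M.measurable_rescale_dose hS.pop.kernel _ _)
      (ae_of_all _ fun ω => hB (h n) (hS.rates.h_pos n) _)
  have hi2 : ∀ n : ℕ, Integrable (fun ω => rescale Ker (h n) (M.D ω - d) ^ 2) P := fun n =>
    integrable_of_ae_abs_le ((M.measurable_rescale_dose hS.pop.kernel _ _).pow_const 2)
      (b := (B / h n) ^ 2) (ae_of_all _ fun ω => by
        rw [abs_pow]
        have := hB (h n) (hS.rates.h_pos n) (M.D ω - d)
        gcongr)
  have hb : ∀ (n : ℕ) ω, (rootNh K h n * (rescale Ker (h n) ((M.obs ω).dose - d) - fD d)) ^ 2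
      ≤ K * n * h n * (2 * rescale Ker (h n) (M.D ω - d) ^ 2 + 2 * fD d ^ 2) := by
    intro n ω
    rw [mul_pow, hS.sq_rootNh]
    have := (hS.rates.h_pos n).le
    gcongr
    rw [show (M.obs ω).dose = M.D ω from rfl]
    nlinarith [sq_nonneg (rescale Ker (h n) (M.D ω - d) + fD d)]
  have hid : ∀ n : ℕ, Integrable (fun ω =>
      K * n * h n * (2 * rescale Ker (h n) (M.D ω - d) ^ 2 + 2 * fD d ^ 2)) P := fun n =>
    (((hi2 n).const_mul 2).add (integrable_const _)).const_mul _
  have hi : ∀ n : ℕ, Integrable (fun ω => (rootNh K h n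
      * (rescale Ker (h n) ((M.obs ω).dose - d) - fD d)) ^ 2) P := fun n =>
    (hid n).mono' (((hm n).comp M.measurable_obs).pow_const 2).aestronglyMeasurable
      (ae_of_all _ fun ω => by
        rw [Real.norm_eq_abs, abs_of_nonneg (sq_nonneg _)]
        exact hb n ω)
  have key := (hS.crossFit_coFold k).boundedInProb
    (u := fun n _ z => rootNh K h n * (rescale Ker (h n) (z.dose - d) - fD d))
    (fun n => (hm n).comp measurable_snd)
    (V := fun n => K * n * (2 * C₂ + 2 * fD d ^ 2)) (b := C₁) (B := 2 * (2 * C₂ + 2 * fD d ^ 2))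
    (.of_forall fun n _ => Population.memLp_obs (hm n) (hi n))
    (by
      filter_upwards [hS.eventually_regular] with n hn _
      have h0 := hS.rates.h_pos n
      rw [Population.integral_obs ((hm n).pow_const 2)]
      refine (integral_mono (hi n) (hid n) (hb n)).trans ?_
      rw [integral_const_mul, integral_add ((hi2 n).const_mul 2) (integrable_const _),
        integral_const_mul]
      simp only [integral_const, probReal_univ, one_smul]
      have h3 := h2 (h n) h0 hn.2.1
      have h4 : h n * (2 * ∫ ω, rescale Ker (h n) (M.D ω - d) ^ 2 ∂P)
          ≤ h n * (2 * (C₂ / h n)) := by gcongr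
      have h5 : h n * (2 * (C₂ / h n)) = 2 * C₂ := by field_simp
      have h6 : h n * (2 * fD d ^ 2) ≤ 1 * (2 * fD d ^ 2) :=
        mul_le_mul_of_nonneg_right hn.2.1 (by positivity)
      calc _ = K * n * (h n * (2 * ∫ ω, rescale Ker (h n) (M.D ω - d) ^ 2 ∂P)
            + h n * (2 * fD d ^ 2)) := by ring
        _ ≤ K * n * (2 * C₂ + 1 * (2 * fD d ^ 2)) :=
            mul_le_mul_of_nonneg_left (add_le_add (h4.trans_eq h5) h6) (by positivity)
        _ = _ := by ring)
    (by
      have ht := hS.tendsto_rootNh_mul_sq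
      filter_upwards [ht.eventually (Iic_mem_nhds one_pos)] with n hn _
      have h0 := hS.rates.h_pos n
      have hr : 0 ≤ rootNh K h n := Real.sqrt_nonneg _
      rw [Population.integral_obs (hm n), integral_const_mul]
      have e : ∫ ω, (rescale Ker (h n) ((M.obs ω).dose - d) - fD d) ∂P
          = (∫ ω, rescale Ker (h n) (M.D ω - d) ∂P) - fD d := by
        change ∫ ω, (rescale Ker (h n) (M.D ω - d) - fD d) ∂P = _
        rw [integral_sub (hi0 n) (integrable_const _)]
        simp
      rw [e, abs_mul, abs_of_nonneg hr]
      calc _ ≤ rootNh K h n * (C₁ * h n ^ 2) := by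
            gcongr
            exact h1 (h n) h0
        _ = C₁ * (rootNh K h n * h n ^ 2) := by ring
        _ ≤ C₁ * 1 := by gcongr
        _ = C₁ := mul_one _)
    (by
      filter_upwards [eventually_ge_atTop 1] with n hn
      have hc := hS.card_coFold_ge n k
      have hn' : (0 : ℝ) < n := by exact_mod_cast hn
      have := hS.cast_K_pos
      rw [div_le_iff₀ (lt_of_lt_of_le (by positivity) hc)]
      have h5 : 0 ≤ 2 * C₂ + 2 * fD d ^ 2 := by positivity
      nlinarith)
  refine key.mono ?_
  filter_upwards [eventually_ge_atTop 1] with n hn s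
  rw [hS.coFold_mean_sub hn k (fun z => rescale Ker (h n) (z.dose - d))]
  rfl

theorem fHat_consistent [IsMarkovKernel Q]
    (hS : Sampling M P Q Ker h ε dL dH κ c C d fD fDX fYD μ Z fold η) (k : Fin K) :
    SmallInProb μ (fun n s => fHat Ker (h n) d (fold n) (firstObs Z (K * n) s) k - fD d) := by
  refine ((hS.fHat_rate k).mul_small
    (smallInProb_of_tendsto hS.tendsto_rootNh.inv_tendsto_atTop)).mono ?_
  filter_upwards [hS.tendsto_rootNh.eventually_gt_atTop 0] with n hn s
  refine le_of_eq (congrArg abs ?_)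
  rw [Pi.inv_apply]
  field_simp

end Sampling

/-! ### Moments of the estimating function and of the weights -/

namespace Population

variable {Ω 𝒳 : Type*} [MeasurableSpace Ω] [MeasurableSpace 𝒳] {M : Population Ω 𝒳}

namespace Assumptions

variable {P : Measure Ω} [IsProbabilityMeasure P] {Q : Kernel ℝ Ω} {Ker : ℝ → ℝ} {h : ℕ → ℝ}
  {dL dH κ c C d : ℝ} {fD : ℝ → ℝ} {fDX : 𝒳 → ℝ → ℝ} {fYD : ℝ → ℝ → ℝ}

/-- Size of the true estimating function. -/
theorem exists_oracle_bound [IsMarkovKernel Q]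
    (hA : M.Assumptions P Q Ker h dL dH κ c C fD fDX fYD) (hd : d ∈ Ioo dL dH) :
    ∃ V > 0, ∀ b : ℝ, 0 < b → b ≤ 1 →
      (∀ᵐ x ∂(P.map M.X), c < M.fh0 P Ker b d x ∧ M.fh0 P Ker b d x < C) →
      (∀ᵐ ω ∂P, |rawSignal Ker b d (M.lam P) (M.eta0 P Ker b d) (M.obs ω)| ≤ V / b) ∧
      ∫ ω, rawSignal Ker b d (M.lam P) (M.eta0 P Ker b d) (M.obs ω) ^ 2 ∂P ≤ V / b := by
  obtain ⟨V, hV0, hV⟩ := hA.exists_weight_bound hd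
  have hC := hA.bounds.C_pos
  have hY1 := hA.boundYlam_pos
  set Y₁ : ℝ := boundYlam M P C + C with hY₁
  have hY₁0 : 0 < Y₁ := by positivity
  refine ⟨V * Y₁ + V * Y₁ ^ 2, by positivity, fun b hb hb1 hf => ?_⟩
  have hη0 := hA.nuisanceBound_eta0 (ε := 0) hb hf
  obtain ⟨w1, -, w3⟩ := hV b 0 hb hb1 _ hη0
  have hwm := (measurable_weight_single (h := b) (d := d) hA.kernel hη0.measurable_f
    hη0.measurable_g).comp M.measurable_obs
  have hle : ∀ᵐ ω ∂P, |rawSignal Ker b d (M.lam P) (M.eta0 P Ker b d) (M.obs ω)|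
      ≤ |weight Ker b d (M.eta0 P Ker b d) (M.obs ω)| * Y₁ := by
    filter_upwards [hA.ae_abs_Ylam_sub_e0_le] with ω hω
    rw [rawSignal, abs_mul]
    exact mul_le_mul_of_nonneg_left hω (abs_nonneg _)
  refine ⟨?_, ?_⟩
  · filter_upwards [hle, w1] with ω h1 h2
    calc _ ≤ V / b * Y₁ := h1.trans (by gcongr)
      _ = V * Y₁ / b := by ring
      _ ≤ _ := by
          gcongr
          have : 0 ≤ V * Y₁ ^ 2 := by positivity
          linarith
  · have hwi : Integrable (fun ω => weight Ker b d (M.eta0 P Ker b d) (M.obs ω) ^ 2) P :=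
      integrable_of_ae_abs_le (hwm.pow_const 2) (b := (V / b) ^ 2) (w1.mono fun ω hω => by
        rw [abs_pow]
        gcongr)
    calc _ ≤ ∫ ω, Y₁ ^ 2 * weight Ker b d (M.eta0 P Ker b d) (M.obs ω) ^ 2 ∂P := by
          refine integral_mono_of_nonneg (ae_of_all _ fun _ => sq_nonneg _)
            (hwi.const_mul _) ?_
          filter_upwards [hle] with ω hω
          have h1 := pow_le_pow_left₀ (abs_nonneg _) hω 2
          rwa [mul_pow, sq_abs, sq_abs, mul_comm] at h1
      _ ≤ Y₁ ^ 2 * (V / b) := by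
          rw [integral_const_mul]
          gcongr
      _ = V * Y₁ ^ 2 / b := by ring
      _ ≤ _ := by
          gcongr
          have : 0 ≤ V * Y₁ := by positivity
          linarith

theorem integrable_oracle [IsMarkovKernel Q]
    (hA : M.Assumptions P Q Ker h dL dH κ c C fD fDX fYD) (hd : d ∈ Ioo dL dH) {b : ℝ}
    (hb : 0 < b) (hb1 : b ≤ 1)
    (hf : ∀ᵐ x ∂(P.map M.X), c < M.fh0 P Ker b d x ∧ M.fh0 P Ker b d x < C) :
    Integrable (fun ω => rawSignal Ker b d (M.lam P) (M.eta0 P Ker b d) (M.obs ω)) P := by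
  obtain ⟨V, hV0, hV⟩ := hA.exists_oracle_bound hd
  exact integrable_of_ae_abs_le ((measurable_rawSignal_single hA.kernel
    (M.measurable_fh0 P hA.kernel _ _) (M.measurable_g0 P) (M.measurable_e0 P)).comp
    M.measurable_obs) (hV b hb hb1 hf).1

/-- Moments of the scaled error of the estimating function, under the law of an observation. -/
theorem exists_rawSignal_sub_moments [IsMarkovKernel Q]
    (hA : M.Assumptions P Q Ker h dL dH κ c C fD fDX fYD) (hd : d ∈ Ioo dL dH) :
    ∃ V > 0, ∀ b ε r : ℝ, 0 < b → b ≤ 1 → 0 ≤ r → ∀ η : Nuisance 𝒳,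
      M.NuisanceBound P Ker b d ε κ C η →
      (∀ᵐ x ∂(P.map M.X), c < M.fh0 P Ker b d x ∧ M.fh0 P Ker b d x < C) →
      MemLp (fun z => r * (rawSignal Ker b d (M.lam P) η z
        - rawSignal Ker b d (M.lam P) (M.eta0 P Ker b d) z)) 2 (P.map M.obs) ∧
      ∫ z, (r * (rawSignal Ker b d (M.lam P) η z
        - rawSignal Ker b d (M.lam P) (M.eta0 P Ker b d) z)) ^ 2 ∂(P.map M.obs)
        ≤ r ^ 2 * (V * (ε ^ 2 / b ^ 2)) ∧
      |∫ z, r * (rawSignal Ker b d (M.lam P) η z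
        - rawSignal Ker b d (M.lam P) (M.eta0 P Ker b d) z) ∂(P.map M.obs)|
        ≤ r * (ε ^ 2 / √b + C / κ * ε ^ 2) := by
  obtain ⟨V, hV0, hV⟩ := hA.exists_rawSignal_sub_sq_bound
  refine ⟨V, hV0, fun b ε r hb hb1 hr η hη hf => ?_⟩
  obtain ⟨hi, hle⟩ := hV b ε d hb hb1 η hη hf
  have hr0 : Measurable (rawSignal Ker b d (M.lam P) (M.eta0 P Ker b d)) :=
    measurable_rawSignal_single hA.kernel (M.measurable_fh0 P hA.kernel _ _)
      (M.measurable_g0 P) (M.measurable_e0 P)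
  have hr1 : Measurable (rawSignal Ker b d (M.lam P) η) :=
    measurable_rawSignal_single hA.kernel hη.measurable_f hη.measurable_g hη.measurable_e
  have hm : Measurable (fun z => r * (rawSignal Ker b d (M.lam P) η z
        - rawSignal Ker b d (M.lam P) (M.eta0 P Ker b d) z)) := (hr1.sub hr0).const_mul r
  refine ⟨memLp_obs hm ?_, ?_, ?_⟩
  · simp_rw [mul_pow]
    exact hi.const_mul _
  · rw [integral_obs (hm.pow_const 2)]
    simp_rw [mul_pow]
    rw [integral_const_mul]
    exact mul_le_mul_of_nonneg_left hle (sq_nonneg r)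
  · rw [integral_obs hm, integral_const_mul, abs_mul, abs_of_nonneg hr]
    refine mul_le_mul_of_nonneg_left ?_ hr
    have i0 := hA.integrable_oracle hd hb hb1 hf
    have id : Integrable (fun ω => rawSignal Ker b d (M.lam P) η (M.obs ω)
        - rawSignal Ker b d (M.lam P) (M.eta0 P Ker b d) (M.obs ω)) P := by
      refine MemLp.integrable (q := 2) (by norm_num) ?_
      exact (memLp_two_iff_integrable_sq ((hr1.comp M.measurable_obs).sub
        (hr0.comp M.measurable_obs)).aestronglyMeasurable).2 hi
    have i1 : Integrable (fun ω => rawSignal Ker b d (M.lam P) η (M.obs ω)) P :=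
      (id.add i0).congr (ae_of_all _ fun ω => by simp)
    rw [integral_sub i1 i0]
    exact hA.abs_integral_rawSignal_sub_le hb hη hf

/-- Moments of the weights times the outcome, under the law of an observation. -/
theorem exists_weight_moments [IsMarkovKernel Q]
    (hA : M.Assumptions P Q Ker h dL dH κ c C fD fDX fYD) (hd : d ∈ Ioo dL dH) :
    ∃ V > 0, ∀ b ε : ℝ, 0 < b → b ≤ 1 → ∀ η : Nuisance 𝒳, M.NuisanceBound P Ker b d ε κ C η →
      MemLp (fun z => |weight Ker b d η z| * (|z.y| * (1 + |z.t|))) 2 (P.map M.obs) ∧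
      ∫ z, (|weight Ker b d η z| * (|z.y| * (1 + |z.t|))) ^ 2 ∂(P.map M.obs) ≤ V / b ∧
      |∫ z, |weight Ker b d η z| * (|z.y| * (1 + |z.t|)) ∂(P.map M.obs)| ≤ V := by
  obtain ⟨V, hV0, hV⟩ := hA.exists_weight_bound hd
  have hC := hA.bounds.C_pos
  refine ⟨V * (2 * C) ^ 2 + V * (2 * C), by positivity, fun b ε hb hb1 η hη => ?_⟩
  obtain ⟨w1, w2, w3⟩ := hV b ε hb hb1 η hη
  -- The factor |y|(1 + |t|) comes from the local Lipschitz bound in λ; it is bounded because |T| ≤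
  -- 1.
  have hYT : ∀ᵐ ω ∂P, |M.Y ω| * (1 + |M.T ω|) ≤ 2 * C := by
    filter_upwards [hA.bounds.Y_bound] with ω hω
    have h1 := M.abs_T_le ω
    calc _ ≤ C * (1 + 1) := by gcongr
      _ = 2 * C := by ring
  have hwz : Measurable (weight Ker b d η) :=
    measurable_weight_single hA.kernel hη.measurable_f hη.measurable_g
  have hm : Measurable (fun z : Obs 𝒳 => |weight Ker b d η z| * (|z.y| * (1 + |z.t|))) :=
    (continuous_abs.measurable.comp hwz).mul ((continuous_abs.measurable.comp Obs.measurable_y).mul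
      ((continuous_abs.measurable.comp Obs.measurable_t).const_add 1))
  have hw := hwz.comp M.measurable_obs
  have hwi : Integrable (fun ω => weight Ker b d η (M.obs ω)) P := integrable_of_ae_abs_le hw w1
  have hwi2 : Integrable (fun ω => weight Ker b d η (M.obs ω) ^ 2) P :=
    integrable_of_ae_abs_le (hw.pow_const 2) (b := (V / b) ^ 2) (w1.mono fun ω hω => by
      rw [abs_pow]
      gcongr)
  have hnn : ∀ z : Obs 𝒳, 0 ≤ |weight Ker b d η z| * (|z.y| * (1 + |z.t|)) := fun z => by
    positivity
  have hle : ∀ᵐ ω ∂P, |weight Ker b d η (M.obs ω)| * (|(M.obs ω).y| * (1 + |(M.obs ω).t|))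
      ≤ |weight Ker b d η (M.obs ω)| * (2 * C) := by
    filter_upwards [hYT] with ω hω
    exact mul_le_mul_of_nonneg_left hω (abs_nonneg _)
  have hle2 : ∀ᵐ ω ∂P, (|weight Ker b d η (M.obs ω)|
      * (|(M.obs ω).y| * (1 + |(M.obs ω).t|))) ^ 2
      ≤ weight Ker b d η (M.obs ω) ^ 2 * (2 * C) ^ 2 := by
    filter_upwards [hle] with ω hω
    have := pow_le_pow_left₀ (hnn _) hω 2
    rwa [mul_pow _ (2 * C), sq_abs] at this
  refine ⟨memLp_obs hm ?_, ?_, ?_⟩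
  · refine (hwi2.mul_const ((2 * C) ^ 2)).mono'
      ((hm.comp M.measurable_obs).pow_const 2).aestronglyMeasurable (hle2.mono fun ω hω => ?_)
    rwa [Real.norm_eq_abs, abs_of_nonneg (sq_nonneg _)]
  · rw [integral_obs (hm.pow_const 2)]
    refine (integral_mono_of_nonneg (ae_of_all _ fun _ => sq_nonneg _)
      (hwi2.mul_const _) hle2).trans ?_
    rw [integral_mul_const]
    calc _ ≤ V / b * (2 * C) ^ 2 := by gcongr
      _ = V * (2 * C) ^ 2 / b := by ring
      _ ≤ _ := by
          gcongr
          have : 0 ≤ V * (2 * C) := by positivity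
          linarith
  · rw [integral_obs hm, abs_of_nonneg (integral_nonneg fun _ => hnn _)]
    refine (integral_mono_of_nonneg (ae_of_all _ fun _ => hnn _)
      (hwi.abs.mul_const _) hle).trans ?_
    rw [integral_mul_const]
    have h1 : (∫ ω, |weight Ker b d η (M.obs ω)| ∂P) * (2 * C) ≤ V * (2 * C) := by gcongr
    have : 0 ≤ V * (2 * C) ^ 2 := by positivity
    linarith

end Assumptions

end Population

/-! ### Fold averages: oracle rate, effect of the nuisance estimates, effect of `λ̂` -/

namespace Sampling

variable {Ω 𝒳 S : Type*} [MeasurableSpace Ω] [MeasurableSpace 𝒳] [MeasurableSpace S]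
  {M : Population Ω 𝒳} {P : Measure Ω} [IsProbabilityMeasure P] {Q : Kernel ℝ Ω}
  {Ker : ℝ → ℝ} {h ε : ℕ → ℝ} {dL dH κ c C d : ℝ} {fD : ℝ → ℝ} {fDX : 𝒳 → ℝ → ℝ}
  {fYD : ℝ → ℝ → ℝ} {μ : Measure S} {Z : ℕ → S → Obs 𝒳} {K : ℕ}
  {fold : ∀ n : ℕ, Fin (K * n) → Fin K} {η : NuisanceEstimator 𝒳 fold}

/-- The average of the true estimating function over fold `k`. -/
def oracleMean (M : Population Ω 𝒳) (P : Measure Ω) [IsProbabilityMeasure P] (Ker : ℝ → ℝ)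
    (Z : ℕ → S → Obs 𝒳) (fold : ∀ n : ℕ, Fin (K * n) → Fin K) (b d : ℝ) (n : ℕ) (k : Fin K)
    (s : S) : ℝ :=
  (n : ℝ)⁻¹ * ∑ i ∈ foldSet (fold n) k,
    rawSignal Ker b d (M.lam P) (M.eta0 P Ker b d) (Z i s)

/-- The average of the estimated estimating function over fold `k`, with the value `l` for `λ`. -/
def estMean (Ker : ℝ → ℝ) (Z : ℕ → S → Obs 𝒳) (fold : ∀ n : ℕ, Fin (K * n) → Fin K)
    (η : NuisanceEstimator 𝒳 fold) (b d l : ℝ) (n : ℕ) (k : Fin K) (s : S) : ℝ :=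
  (n : ℝ)⁻¹ * ∑ i ∈ foldSet (fold n) k, rawSignal Ker b d l
    (η.est n k (auxSample (fold n) k (firstObs Z (K * n) s))) (Z i s)

/-- The auxiliary samples at which the nuisance estimates obey the error bounds. -/
def goodAux (M : Population Ω 𝒳) (P : Measure Ω) [IsProbabilityMeasure P] (Ker : ℝ → ℝ)
    (h ε : ℕ → ℝ) (κ c C d : ℝ) {fold : ∀ n : ℕ, Fin (K * n) → Fin K}
    (η : NuisanceEstimator 𝒳 fold) (k : Fin K) (n : ℕ) : Set (AuxData 𝒳 (fold n) k) :=
  {a | eLpNorm (fun x => (η.est n k a).f x - (M.eta0 P Ker (h n) d).f x) 2 (P.map M.X)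
      ≤ ENNReal.ofReal (ε n / √(h n))}
    ∩ {a | eLpNorm (fun x => (η.est n k a).g x - (M.eta0 P Ker (h n) d).g x) 2 (P.map M.X)
      ≤ ENNReal.ofReal (ε n)}
    ∩ {a | eLpNorm (fun x => (η.est n k a).e x - (M.eta0 P Ker (h n) d).e x) 2 (P.map M.X)
      ≤ ENNReal.ofReal (ε n)}
    ∩ {a | ∀ᵐ x ∂(P.map M.X), κ < (η.est n k a).g x ∧ (η.est n k a).g x < 1 - κ}
    ∩ {a | ∀ᵐ x ∂(P.map M.X), c < (η.est n k a).f x ∧ (η.est n k a).f x < C}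

theorem measurableSet_goodAux (hk : Population.KernelAssumption Ker) (k : Fin K) (n : ℕ) :
    MeasurableSet (goodAux M P Ker h ε κ c C d η k n) := by
  have hf := (η.measurable_f n k).sub ((M.measurable_fh0 P hk (h n) d).comp measurable_snd)
  have hg := (η.measurable_g n k).sub ((M.measurable_g0 P).comp measurable_snd)
  have he := (η.measurable_e n k).sub ((M.measurable_e0 P).comp measurable_snd)
  refine ((((measurableSet_le (measurable_eLpNorm_two hf) measurable_const).inter
    (measurableSet_le (measurable_eLpNorm_two hg) measurable_const)).inter
    (measurableSet_le (measurable_eLpNorm_two he) measurable_const)).inter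
    (measurableSet_ae ?_)).inter (measurableSet_ae ?_)
  · exact (measurableSet_lt measurable_const (η.measurable_g n k)).inter
      (measurableSet_lt (η.measurable_g n k) measurable_const)
  · exact (measurableSet_lt measurable_const (η.measurable_f n k)).inter
      (measurableSet_lt (η.measurable_f n k) measurable_const)

theorem nuisanceBound_of_goodAux
    (hS : Sampling M P Q Ker h ε dL dH κ c C d fD fDX fYD μ Z fold η) {k : Fin K} {n : ℕ}
    {a : AuxData 𝒳 (fold n) k} (ha : a ∈ goodAux M P Ker h ε κ c C d η k n) :
    M.NuisanceBound P Ker (h n) d (ε n) κ C (η.est n k a) :=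
  .of_good hS.pop.kernel (hS.rates.h_pos n) hS.pop.bounds.c_pos
    ((η.measurable_f n k).comp measurable_prodMk_left)
    ((η.measurable_g n k).comp measurable_prodMk_left)
    ((η.measurable_e n k).comp measurable_prodMk_left) ha.1.1.1.1 ha.1.1.1.2 ha.1.1.2 ha.1.2 ha.2

variable [IsProbabilityMeasure μ]

/-- `goodAux` keeps only conditions whose measurability is established, so the event of the rate
assumption is contained in a measurable event. Its probability also tends to one, and measurability
allows passing to the complement. -/
theorem tendsto_notMem_goodAux
    (hS : Sampling M P Q Ker h ε dL dH κ c C d fD fDX fYD μ Z fold η) (k : Fin K) :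
    Tendsto (fun n => μ {s | auxSample (fold n) k (firstObs Z (K * n) s)
      ∉ goodAux M P Ker h ε κ c C d η k n}) atTop (𝓝 0) := by
  have h1 : Tendsto (fun n => μ {s | auxSample (fold n) k (firstObs Z (K * n) s)
      ∈ goodAux M P Ker h ε κ c C d η k n}) atTop (𝓝 1) := by
    refine tendsto_of_tendsto_of_tendsto_of_le_of_le (hS.rates.nuisance k) tendsto_const_nhds
      (fun n => measure_mono fun s hs => ?_) (fun n => prob_le_one)
    exact ⟨⟨⟨⟨hs.f_error, hs.g_error⟩, hs.e_error⟩, hs.g_range⟩, hs.f_range⟩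
  have h2 := ENNReal.Tendsto.sub (tendsto_const_nhds (x := (1 : ENNReal))) h1
    (.inl ENNReal.one_ne_top)
  rw [tsub_self] at h2
  refine h2.congr fun n => ?_
  have hm : MeasurableSet {s | auxSample (fold n) k (firstObs Z (K * n) s)
      ∈ goodAux M P Ker h ε κ c C d η k n} :=
    ((measurable_auxSample _ _).comp (measurable_firstObs hS.sample.measurable _))
      (measurableSet_goodAux hS.pop.kernel k n)
  rw [← prob_compl_eq_one_sub hm]
  rfl

/-- At the true nuisances the mean is exactly f_D(d) θ, so there is no bias, and the variance V/h
times Nh/n is the constant K V. -/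
theorem oracle_rate [IsMarkovKernel Q]
    (hS : Sampling M P Q Ker h ε dL dH κ c C d fD fDX fYD μ Z fold η) (k : Fin K) :
    BoundedInProb μ (fun n s => rootNh K h n * (oracleMean M P Ker Z fold (h n) d n k s
      - fD d * M.ATTh P Ker (h n) d (fD d))) := by
  have := isProbabilityMeasure_law M P
  obtain ⟨V, hV0, hV⟩ := hS.pop.exists_oracle_bound hS.mem
  have hfd : fD d ≠ 0 := (hS.pop.fD_pos hS.mem).ne'
  have hrm : ∀ n, Measurable (rawSignal Ker (h n) d (M.lam P) (M.eta0 P Ker (h n) d)) := fun n =>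
    measurable_rawSignal_single hS.pop.kernel (M.measurable_fh0 P hS.pop.kernel _ _)
      (M.measurable_g0 P) (M.measurable_e0 P)
  have hm : ∀ n, Measurable (fun z : Obs 𝒳 => rootNh K h n
      * (rawSignal Ker (h n) d (M.lam P) (M.eta0 P Ker (h n) d) z
        - fD d * M.ATTh P Ker (h n) d (fD d))) := fun n => ((hrm n).sub_const _).const_mul _
  have key := (hS.crossFit_fold k).boundedInProb
    (u := fun n _ z => rootNh K h n
      * (rawSignal Ker (h n) d (M.lam P) (M.eta0 P Ker (h n) d) z
        - fD d * M.ATTh P Ker (h n) d (fD d)))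
    (fun n => (hm n).comp measurable_snd)
    (V := fun n => K * n * V) (b := 0) (B := K * V)
    (by
      filter_upwards [hS.eventually_regular] with n hn _
      have h1 := (hV (h n) (hS.rates.h_pos n) hn.2.1 hn.2.2).1
      refine Population.memLp_obs (hm n) (integrable_of_ae_abs_le
        (((hm n).comp M.measurable_obs).pow_const 2)
        (b := (rootNh K h n * (V / h n + |fD d * M.ATTh P Ker (h n) d (fD d)|)) ^ 2) ?_)
      filter_upwards [h1] with ω hω
      rw [abs_pow, abs_mul, abs_of_nonneg (rootNh_nonneg _ _ _)]
      refine pow_le_pow_left₀ (mul_nonneg (rootNh_nonneg _ _ _) (abs_nonneg _)) ?_ 2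
      refine mul_le_mul_of_nonneg_left ((abs_sub _ _).trans ?_) (rootNh_nonneg _ _ _)
      exact add_le_add hω le_rfl)
    (by
      filter_upwards [hS.eventually_regular] with n hn _
      have h0 := hS.rates.h_pos n
      rw [Population.integral_obs ((hm n).pow_const 2)]
      simp_rw [mul_pow, hS.sq_rootNh]
      rw [integral_const_mul, ← hS.pop.integral_rawSignal_eta0 h0 hfd hn.2.2]
      have h1 := integral_sub_mean_sq_le (P := P) ((hrm n).comp M.measurable_obs).aemeasurable
      have h2 := (hV (h n) h0 hn.2.1 hn.2.2).2
      calc _ ≤ K * n * h n * (V / h n) :=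
            mul_le_mul_of_nonneg_left (h1.trans h2) (by positivity)
        _ = K * n * V := by field_simp)
    (by
      filter_upwards [hS.eventually_regular] with n hn _
      have h0 := hS.rates.h_pos n
      rw [Population.integral_obs (hm n), integral_const_mul,
        integral_sub (hS.pop.integrable_oracle hS.mem h0 hn.2.1 hn.2.2) (integrable_const _), hS.pop.integral_rawSignal_eta0 h0 hfd hn.2.2]
      simp)
    (by
      filter_upwards [eventually_ge_atTop 1] with n hn
      have hn' : (0 : ℝ) < n := by exact_mod_cast hn
      rw [hS.partition.card_foldSet, div_le_iff₀ hn']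
      exact le_of_eq (by ring))
  refine key.mono ?_
  filter_upwards [eventually_ge_atTop 1] with n hn s
  have hn' : (n : ℝ) ≠ 0 := by
    have : (0 : ℝ) < n := by exact_mod_cast hn
    exact this.ne'
  refine le_of_eq (congrArg abs ?_)
  rw [← Finset.mul_sum, Finset.sum_sub_distrib, Finset.sum_const, hS.partition.card_foldSet,
    nsmul_eq_mul, oracleMean]
  field_simp

/-- Estimating the nuisance functions has no first-order effect. -/
theorem nuisance_effect [IsMarkovKernel Q]
    (hS : Sampling M P Q Ker h ε dL dH κ c C d fD fDX fYD μ Z fold η) (k : Fin K) :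
    SmallInProb μ (fun n s => rootNh K h n * (estMean Ker Z fold η (h n) d (M.lam P) n k s
      - oracleMean M P Ker Z fold (h n) d n k s)) := by
  have := isProbabilityMeasure_law M P
  obtain ⟨V, hV0, hV⟩ := hS.pop.exists_rawSignal_sub_moments hS.mem
  have hm : ∀ n, Measurable (Function.uncurry fun (a : AuxData 𝒳 (fold n) k) (z : Obs 𝒳) =>
      rootNh K h n * (rawSignal Ker (h n) d (M.lam P) (η.est n k a) z
        - rawSignal Ker (h n) d (M.lam P) (M.eta0 P Ker (h n) d) z)) := fun n =>
    ((measurable_rawSignal hS.pop.kernel (η.measurable_f n k) (η.measurable_g n k)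
      (η.measurable_e n k)).sub ((measurable_rawSignal_single hS.pop.kernel
      (M.measurable_fh0 P hS.pop.kernel _ _) (M.measurable_g0 P)
      (M.measurable_e0 P)).comp measurable_snd)).const_mul _
  have hκ := hS.pop.support.κ_pos
  have hC := hS.pop.bounds.C_pos
  -- The scaled variance is Nh · V ε²/h² divided by n, that is K V ε²/h.
  have hlim : Tendsto (fun n => rootNh K h n ^ 2 * (V * (ε n ^ 2 / h n ^ 2))
      / (foldSet (fold n) k).card) atTop (𝓝 0) := by
    have h1 := (hS.rates.ε_h.const_mul (K * V))
    rw [mul_zero] at h1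
    refine h1.congr' ?_
    filter_upwards [eventually_ge_atTop 1] with n hn
    have hn' : (0 : ℝ) < n := by exact_mod_cast hn
    have h0 := hS.rates.h_pos n
    rw [hS.partition.card_foldSet, hS.sq_rootNh]
    field_simp
  have key := (crossFit_aux hS.partition hS.sample.measurable hS.sample.indep hS.sample.law
    k).smallInProb_of_good hm (fun n => measurableSet_goodAux hS.pop.kernel k n)
    (hS.tendsto_notMem_goodAux k) (V := fun n => rootNh K h n ^ 2 * (V * (ε n ^ 2 / h n ^ 2)))
    (b := fun n => rootNh K h n * (ε n ^ 2 / √(h n) + C / κ * ε n ^ 2)) (fun n => by positivity)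
    (fun n => mul_nonneg (rootNh_nonneg _ _ _) (by positivity)) (by
      filter_upwards [hS.eventually_regular] with n hn a ha
      exact hV (h n) (ε n) (rootNh K h n) (hS.rates.h_pos n) hn.2.1 (rootNh_nonneg _ _ _) _
        (hS.nuisanceBound_of_goodAux ha) hn.2.2)
    hlim (hS.tendsto_bias _)
  refine key.mono (.of_forall fun n s => ?_)
  refine le_of_eq (congrArg abs ?_)
  rw [← Finset.mul_sum, Finset.sum_sub_distrib, hS.partition.card_foldSet, oracleMean, estMean]
  ring

/-- The weights are as large as 1/h, but their absolute mean is bounded because K_h has a bounded L¹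
norm. This average multiplies the error of `λ̂` in the Lipschitz bound. -/
theorem weight_mean_bounded [IsMarkovKernel Q]
    (hS : Sampling M P Q Ker h ε dL dH κ c C d fD fDX fYD μ Z fold η) (k : Fin K) :
    BoundedInProb μ (fun n s => (n : ℝ)⁻¹ * ∑ i ∈ foldSet (fold n) k,
      |weight Ker (h n) d (η.est n k (auxSample (fold n) k (firstObs Z (K * n) s))) (Z i s)|
        * (|(Z i s).y| * (1 + |(Z i s).t|))) := by
  have := isProbabilityMeasure_law M P
  obtain ⟨V, hV0, hV⟩ := hS.pop.exists_weight_moments hS.mem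
  have habs : Measurable (fun x : ℝ => |x|) := continuous_abs.measurable
  have hm : ∀ n, Measurable (Function.uncurry fun (a : AuxData 𝒳 (fold n) k) (z : Obs 𝒳) =>
      |weight Ker (h n) d (η.est n k a) z| * (|z.y| * (1 + |z.t|))) := fun n =>
    (habs.comp (measurable_weight hS.pop.kernel (η.measurable_f n k) (η.measurable_g n k))).mul
      ((habs.comp (Obs.measurable_y.comp measurable_snd)).mul
        ((habs.comp (Obs.measurable_t.comp measurable_snd)).const_add 1))
  -- The second moment V/h divided by n stays bounded because Nh ≥ 1 eventually.
  have hVB : ∀ᶠ n in atTop, V / h n / (foldSet (fold n) k).card ≤ K * V := by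
    filter_upwards [eventually_ge_atTop 1, hS.rates.Nh_top.eventually_ge_atTop 1] with n hn hN
    have hn' : (0 : ℝ) < n := by exact_mod_cast hn
    have h0 := hS.rates.h_pos n
    push_cast at hN
    rw [hS.partition.card_foldSet, div_div, div_le_iff₀ (by positivity)]
    calc V = V * 1 := (mul_one _).symm
      _ ≤ V * (K * n * h n) := by gcongr
      _ = _ := by ring
  have key := (crossFit_aux hS.partition hS.sample.measurable hS.sample.indep hS.sample.law
    k).boundedInProb_of_good hm (fun n => measurableSet_goodAux hS.pop.kernel k n)
    (hS.tendsto_notMem_goodAux k) (V := fun n => V / h n) (b := V)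
    (fun n => div_nonneg hV0.le (hS.rates.h_pos n).le) hV0.le (by
      filter_upwards [hS.eventually_regular] with n hn a ha
      exact hV (h n) (ε n) (hS.rates.h_pos n) hn.2.1 _ (hS.nuisanceBound_of_goodAux ha))
    hVB
  refine key.mono (.of_forall fun n s => ?_)
  rw [hS.partition.card_foldSet]

/-- Estimating `λ` has no first-order effect. -/
theorem lam_effect [IsMarkovKernel Q]
    (hS : Sampling M P Q Ker h ε dL dH κ c C d fD fDX fYD μ Z fold η) (k : Fin K) :
    SmallInProb μ (fun n s => rootNh K h n
      * (estMean Ker Z fold η (h n) d (lamHat (fold n) (firstObs Z (K * n) s) k) n k s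
        - estMean Ker Z fold η (h n) d (M.lam P) n k s)) := by
  obtain ⟨L, ρ, hρ, hL, hLip⟩ := exists_lipschitz_lam hS.pop.crossSections.lam_pos
    hS.pop.crossSections.lam_lt_one
  have key := (((hS.weight_mean_bounded k).const_mul (x := fun _ => L) (B := |L|)
    (.of_forall fun _ => le_rfl)).mul_small (hS.lamHat_scaled k))
  -- The discarded event is that `λ̂` lies outside the neighbourhood of λ where the weights are
  -- Lipschitz.
  refine key.of_eventually_bad (hS.lamHat_consistent k ρ hρ) (.of_forall fun n s hs => ?_)
  simp only [mem_ofPred_eq, not_le] at hs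
  set l := lamHat (fold n) (firstObs Z (K * n) s) k
  set a := η.est n k (auxSample (fold n) k (firstObs Z (K * n) s)) with ha
  -- The estimate of e does not depend on λ and cancels, so only the outcome weights change.
  have hsum : |estMean Ker Z fold η (h n) d l n k s
      - estMean Ker Z fold η (h n) d (M.lam P) n k s|
      ≤ (n : ℝ)⁻¹ * ∑ i ∈ foldSet (fold n) k, L * |l - M.lam P|
        * (|weight Ker (h n) d a (Z i s)| * (|(Z i s).y| * (1 + |(Z i s).t|))) := by
    rw [estMean, estMean, ← mul_sub, ← Finset.sum_sub_distrib, abs_mul,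
      abs_of_nonneg (by positivity : 0 ≤ (n : ℝ)⁻¹)]
    refine mul_le_mul_of_nonneg_left ((Finset.abs_sum_le_sum_abs _ _).trans
      (Finset.sum_le_sum fun i _ => ?_)) (by positivity)
    rw [rawSignal, rawSignal, ← ha, ← mul_sub, sub_sub_sub_cancel_right, ← sub_mul, abs_mul,
      abs_mul]
    calc _ ≤ |weight Ker (h n) d a (Z i s)|
          * (L * |l - M.lam P| * (1 + |(Z i s).t|) * |(Z i s).y|) := by
          gcongr
          exact hLip l hs _
      _ = _ := by ring
  rw [abs_mul, abs_of_nonneg (rootNh_nonneg _ _ _)]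
  refine (mul_le_mul_of_nonneg_left hsum (rootNh_nonneg _ _ _)).trans (le_of_eq ?_)
  rw [← Finset.mul_sum]
  set W := ∑ i ∈ foldSet (fold n) k,
    |weight Ker (h n) d a (Z i s)| * (|(Z i s).y| * (1 + |(Z i s).t|)) with hW
  have hW0 : 0 ≤ W := Finset.sum_nonneg fun i _ => by positivity
  rw [abs_mul, abs_mul (rootNh K h n), abs_of_nonneg (rootNh_nonneg _ _ _),
    abs_of_nonneg (by positivity : 0 ≤ L * ((n : ℝ)⁻¹ * W))]
  ring

end Sampling

/-! ### The influence function: size and mean -/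

namespace Population

variable {Ω 𝒳 : Type*} [MeasurableSpace Ω] [MeasurableSpace 𝒳]

/-- The influence function, whose second moment is `sigmaSq`. -/
def influence (M : Population Ω 𝒳) (P : Measure Ω) [IsFiniteMeasure P] (Ker : ℝ → ℝ)
    (b d fd : ℝ) (z : Obs 𝒳) : ℝ :=
  score Ker b d (M.ATTh P Ker b d fd) (M.lam P) fd (M.eta0 P Ker b d) z
    - M.ATTh P Ker b d fd / fd *
      (rescale Ker b (z.dose - d) - ∫ ω', rescale Ker b (M.D ω' - d) ∂P)

variable {M : Population Ω 𝒳}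

theorem influence_eq (M : Population Ω 𝒳) (P : Measure Ω) [IsFiniteMeasure P] (Ker : ℝ → ℝ)
    (b d fd : ℝ) (z : Obs 𝒳) :
    M.influence P Ker b d fd z
      = fd⁻¹ * rawSignal Ker b d (M.lam P) (M.eta0 P Ker b d) z - M.ATTh P Ker b d fd
        - M.ATTh P Ker b d fd / fd *
          (rescale Ker b (z.dose - d) - ∫ ω', rescale Ker b (M.D ω' - d) ∂P) := by
  rw [influence, score, signal_eq]

theorem measurable_influence {P : Measure Ω} [IsFiniteMeasure P] {Ker : ℝ → ℝ}
    (hk : KernelAssumption Ker) (b d fd : ℝ) : Measurable (M.influence P Ker b d fd) := by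
  have h : M.influence P Ker b d fd = _ := funext fun z => influence_eq M P Ker b d fd z
  rw [h]
  exact (((measurable_rawSignal_single hk (M.measurable_fh0 P hk _ _) (M.measurable_g0 P)
    (M.measurable_e0 P)).const_mul _).sub_const _).sub
    ((((hk.measurable_rescale b).comp (Obs.measurable_dose.sub_const d)).sub_const _).const_mul _)

namespace Assumptions

variable {P : Measure Ω} [IsProbabilityMeasure P] {Q : Kernel ℝ Ω} {Ker : ℝ → ℝ} {h : ℕ → ℝ}
  {dL dH κ c C d : ℝ} {fD : ℝ → ℝ} {fDX : 𝒳 → ℝ → ℝ} {fYD : ℝ → ℝ → ℝ}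

theorem exists_abs_ATTh_le [IsMarkovKernel Q]
    (hA : M.Assumptions P Q Ker h dL dH κ c C fD fDX fYD) (hd : d ∈ Ioo dL dH) :
    ∃ Θ > 0, ∀ b : ℝ, 0 < b → b ≤ 1 → |M.ATTh P Ker b d (fD d)| ≤ Θ := by
  obtain ⟨C', h0, h1⟩ := hA.exists_ATTh_bound hd
  refine ⟨C' + |M.ATT Q d| + 1, by positivity, fun b hb hb1 => ?_⟩
  have h2 := h1 b hb
  have h3 : C' * b ^ 2 ≤ C' * 1 := by
    gcongr
    exact pow_le_one₀ hb.le hb1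
  have h4 := abs_sub_abs_le_abs_sub (M.ATTh P Ker b d (fD d)) (M.ATT Q d)
  linarith

/-- The estimating function and K_h are O(1/h), and θ is bounded because it converges to ATT(d); h ≤
1 absorbs the constant term. -/
theorem exists_abs_influence_le [IsMarkovKernel Q]
    (hA : M.Assumptions P Q Ker h dL dH κ c C fD fDX fYD) (hd : d ∈ Ioo dL dH) :
    ∃ V > 0, ∀ b : ℝ, 0 < b → b ≤ 1 →
      (∀ᵐ x ∂(P.map M.X), c < M.fh0 P Ker b d x ∧ M.fh0 P Ker b d x < C) →
      ∀ᵐ ω ∂P, |M.influence P Ker b d (fD d) (M.obs ω)| ≤ V / b := by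
  obtain ⟨V, hV0, hV⟩ := hA.exists_oracle_bound hd
  obtain ⟨Θ, hΘ0, hΘ⟩ := hA.exists_abs_ATTh_le hd
  obtain ⟨B, hB0, hB⟩ := hA.kernel.exists_bound
  have hfd := hA.fD_pos hd
  refine ⟨(fD d)⁻¹ * V + Θ + Θ / fD d * (B + B), by positivity, fun b hb hb1 hf => ?_⟩
  have hE : |∫ ω', rescale Ker b (M.D ω' - d) ∂P| ≤ B / b := by
    have := norm_integral_le_of_norm_le_const (μ := P) (f := fun ω => rescale Ker b (M.D ω - d))
      (C := B / b) (ae_of_all _ fun ω => hB b hb _)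
    simpa using this
  filter_upwards [(hV b hb hb1 hf).1] with ω hω
  rw [influence_eq]
  have h1 := hB b hb ((M.obs ω).dose - d)
  have h2 := hΘ b hb hb1
  have h3 : Θ ≤ Θ / b := le_div_self hΘ0.le hb hb1
  calc _ ≤ (fD d)⁻¹ * (V / b) + Θ / b + Θ / fD d * (B / b + B / b) := by
        refine (abs_sub _ _).trans (add_le_add ((abs_sub _ _).trans (add_le_add ?_ ?_)) ?_)
        · rw [abs_mul, abs_of_pos (inv_pos.2 hfd)]
          gcongr
        · exact h2.trans h3
        · rw [abs_mul, abs_div, abs_of_pos hfd]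
          gcongr
          exact (abs_sub _ _).trans (add_le_add h1 hE)
    _ = _ := by ring

/-- The raw estimating function at the true nuisances has mean f_D(d) θ, so dividing by f_D(d) and
subtracting θ centres it; the density correction is centred at its exact mean. -/
theorem integral_influence [IsMarkovKernel Q]
    (hA : M.Assumptions P Q Ker h dL dH κ c C fD fDX fYD) (hd : d ∈ Ioo dL dH) {b : ℝ}
    (hb : 0 < b) (hb1 : b ≤ 1)
    (hf : ∀ᵐ x ∂(P.map M.X), c < M.fh0 P Ker b d x ∧ M.fh0 P Ker b d x < C) :
    ∫ ω, M.influence P Ker b d (fD d) (M.obs ω) ∂P = 0 := by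
  have hfd := (hA.fD_pos hd).ne'
  obtain ⟨B, hB0, hB⟩ := hA.kernel.exists_bound
  have hi := hA.integrable_oracle hd hb hb1 hf
  have hK : Integrable (fun ω => rescale Ker b (M.D ω - d)) P :=
    integrable_of_ae_abs_le (M.measurable_rescale_dose hA.kernel b d)
      (ae_of_all _ fun ω => hB b hb _)
  simp_rw [influence_eq]
  change ∫ ω, ((fD d)⁻¹ * rawSignal Ker b d (M.lam P) (M.eta0 P Ker b d) (M.obs ω)
    - M.ATTh P Ker b d (fD d) - M.ATTh P Ker b d (fD d) / fD d *
      (rescale Ker b (M.D ω - d) - ∫ ω', rescale Ker b (M.D ω' - d) ∂P)) ∂P = 0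
  have i1 : Integrable (fun ω => (fD d)⁻¹ * rawSignal Ker b d (M.lam P) (M.eta0 P Ker b d)
      (M.obs ω) - M.ATTh P Ker b d (fD d)) P := (hi.const_mul _).sub (integrable_const _)
  have i2 : Integrable (fun ω => M.ATTh P Ker b d (fD d) / fD d *
      (rescale Ker b (M.D ω - d) - ∫ ω', rescale Ker b (M.D ω' - d) ∂P)) P :=
    (hK.sub (integrable_const _)).const_mul _
  rw [integral_sub i1 i2, integral_sub (hi.const_mul _) (integrable_const _), integral_const_mul,
    integral_const_mul, integral_sub hK (integrable_const _),
    hA.integral_rawSignal_eta0 hb hfd hf]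
  simp only [integral_const, probReal_univ, one_smul, sub_self, mul_zero, sub_zero]
  field_simp
  ring

end Assumptions

end Population

/-! ### Linearization of the cross-fitted estimator and the limit law -/

theorem sum_filter_ne_eq {N K : ℕ} (fold : Fin N → Fin K) (w : Fin N → ℝ) :
    ∑ k, ∑ i ∈ Finset.univ.filter (fun i => fold i ≠ k), w i = ((K : ℝ) - 1) * ∑ i, w i := by
  simp_rw [Finset.sum_filter]
  rw [Finset.sum_comm, Finset.mul_sum]
  refine Finset.sum_congr rfl fun i _ => ?_
  -- Each observation lies in exactly one fold, hence in K - 1 of the complements.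
  have h1 : ∀ k, (if fold i ≠ k then w i else 0) = w i - if fold i = k then w i else 0 := by
    intro k
    by_cases hk : fold i = k <;> simp [hk]
  simp_rw [h1]
  rw [Finset.sum_sub_distrib, Finset.sum_ite_eq]
  simp
  ring

theorem sum_filter_eq_eq {N K : ℕ} (fold : Fin N → Fin K) (w : Fin N → ℝ) :
    ∑ k, ∑ i ∈ Finset.univ.filter (fun i => fold i = k), w i = ∑ i, w i :=
  Finset.sum_fiberwise _ _ _

theorem measurable_rawSignal_comp {S A 𝒳 : Type*} [MeasurableSpace S] [MeasurableSpace A]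
    [MeasurableSpace 𝒳] {η : A → Nuisance 𝒳} {Ker : ℝ → ℝ} {h d : ℝ}
    (hk : Population.KernelAssumption Ker)
    (hf : Measurable (fun p : A × 𝒳 => (η p.1).f p.2))
    (hg : Measurable (fun p : A × 𝒳 => (η p.1).g p.2))
    (he : Measurable (fun p : A × 𝒳 => (η p.1).e p.2)) {α : S → A} {ζ : S → Obs 𝒳} {l : S → ℝ}
    (hα : Measurable α) (hζ : Measurable ζ) (hl : Measurable l) :
    Measurable (fun s => rawSignal Ker h d (l s) (η (α s)) (ζ s)) := by
  have hc : Measurable (fun s => (α s, (ζ s).cov)) := hα.prodMk (Obs.measurable_cov.comp hζ)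
  have hD : Measurable (fun s => (ζ s).dose) := Obs.measurable_dose.comp hζ
  have hf' : Measurable (fun s => (η (α s)).f (ζ s).cov) := hf.comp hc
  have hg' : Measurable (fun s => (η (α s)).g (ζ s).cov) := hg.comp hc
  have hw : Measurable (fun s => weight Ker h d (η (α s)) (ζ s)) := by
    unfold weight
    exact ((((hk.measurable_rescale h).comp (hD.sub_const d)).mul hg').sub
      (((measurable_one.indicator (measurableSet_singleton 0)).comp hD).mul hf')).div hg'
  have he' : Measurable (fun s => (η (α s)).e (ζ s).cov) :=
    he.comp hc
  have ht : Measurable (fun s => (ζ s).t) := Obs.measurable_t.comp hζ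
  have hy : Measurable (fun s => (ζ s).y) := Obs.measurable_y.comp hζ
  unfold rawSignal
  exact hw.mul ((((ht.sub hl).div (hl.mul (hl.const_sub 1))).mul hy).sub he')

namespace Sampling

section Algebra

variable {S 𝒳 : Type*} [MeasurableSpace 𝒳] {K : ℕ} {fold : ∀ n : ℕ, Fin (K * n) → Fin K}

theorem attHatWith_eq (Ker : ℝ → ℝ) (Z : ℕ → S → Obs 𝒳) (η : NuisanceEstimator 𝒳 fold)
    (b d : ℝ) (n : ℕ) (l : Fin K → ℝ) (s : S) :
    attHatWith Ker b d (fold n) (η.est n) l (firstObs Z (K * n) s)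
      = (K : ℝ)⁻¹ * ∑ k, (fHat Ker b d (fold n) (firstObs Z (K * n) s) k)⁻¹
        * estMean Ker Z fold η b d (l k) n k s := by
  rw [attHatWith]
  congr 1
  refine Finset.sum_congr rfl fun k _ => ?_
  rw [estMean, sum_foldSet (fold n) k (fun i => rawSignal Ker b d (l k)
    (η.est n k (auxSample (fold n) k (firstObs Z (K * n) s))) (Z i s))]
  simp_rw [signal_eq]
  rw [← Finset.mul_sum]
  exact mul_left_comm _ _ _

theorem attHatWith_sub (Ker : ℝ → ℝ) (Z : ℕ → S → Obs 𝒳) (η : NuisanceEstimator 𝒳 fold)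
    (b d : ℝ) (n : ℕ) (l l' : Fin K → ℝ) (s : S) :
    attHatWith Ker b d (fold n) (η.est n) l (firstObs Z (K * n) s)
      - attHatWith Ker b d (fold n) (η.est n) l' (firstObs Z (K * n) s)
      = (K : ℝ)⁻¹ * ∑ k, (fHat Ker b d (fold n) (firstObs Z (K * n) s) k)⁻¹
        * (estMean Ker Z fold η b d (l k) n k s - estMean Ker Z fold η b d (l' k) n k s) := by
  rw [attHatWith_eq, attHatWith_eq, ← mul_sub, ← Finset.sum_sub_distrib]
  simp_rw [mul_sub]

end Algebra

variable {Ω 𝒳 S : Type*} [MeasurableSpace Ω] [MeasurableSpace 𝒳] [MeasurableSpace S]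
  {M : Population Ω 𝒳} {P : Measure Ω} [IsProbabilityMeasure P] {Q : Kernel ℝ Ω}
  {Ker : ℝ → ℝ} {h ε : ℕ → ℝ} {dL dH κ c C d : ℝ} {fD : ℝ → ℝ} {fDX : 𝒳 → ℝ → ℝ}
  {fYD : ℝ → ℝ → ℝ} {μ : Measure S} {Z : ℕ → S → Obs 𝒳} {K : ℕ}
  {fold : ∀ n : ℕ, Fin (K * n) → Fin K} {η : NuisanceEstimator 𝒳 fold}

/-- The mean of the influence function over the sample. -/
theorem mean_influence_eq
    (hS : Sampling M P Q Ker h ε dL dH κ c C d fD fDX fYD μ Z fold η) {n : ℕ} (hn : 1 ≤ n)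
    (b fd : ℝ) (s : S) :
    ((K * n : ℕ) : ℝ)⁻¹ * ∑ i ∈ Finset.range (K * n), M.influence P Ker b d fd (Z i s)
      = (K : ℝ)⁻¹ * ∑ k, (fd⁻¹ * oracleMean M P Ker Z fold b d n k s - M.ATTh P Ker b d fd
        - M.ATTh P Ker b d fd / fd * (fHat Ker b d (fold n) (firstObs Z (K * n) s) k
          - ∫ ω', rescale Ker b (M.D ω' - d) ∂P)) := by
  have hn' : (0 : ℝ) < n := by exact_mod_cast hn
  have hK := hS.cast_K_pos
  have hK2 : (2 : ℝ) ≤ K := by exact_mod_cast hS.two_le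
  have hK1 : (K : ℝ) - 1 ≠ 0 := by linarith
  have h1 : ∑ k, oracleMean M P Ker Z fold b d n k s
      = (n : ℝ)⁻¹ * ∑ i : Fin (K * n),
        rawSignal Ker b d (M.lam P) (M.eta0 P Ker b d) (Z i s) := by
    simp_rw [oracleMean, sum_foldSet _ _ (fun i =>
      rawSignal Ker b d (M.lam P) (M.eta0 P Ker b d) (Z i s))]
    rw [← Finset.mul_sum, sum_filter_eq_eq (fold n)
      (fun i => rawSignal Ker b d (M.lam P) (M.eta0 P Ker b d) (Z i s))]
  -- The multiplicity K - 1 cancels against the size (K - 1)n of a complement, so averaging over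
  -- folds recovers the full-sample density estimate.
  have h2 : ∑ k, fHat Ker b d (fold n) (firstObs Z (K * n) s) k
      = (n : ℝ)⁻¹ * ∑ i : Fin (K * n), rescale Ker b ((Z i s).dose - d) := by
    simp_rw [fHat]
    rw [← Finset.mul_sum, sum_filter_ne_eq (fold n)
      (fun i => rescale Ker b ((firstObs Z (K * n) s i).dose - d)), ← mul_assoc]
    congr 1
    rw [show (K : ℝ) * n - n = (K - 1) * n by ring]
    field_simp
  rw [Finset.sum_sub_distrib, Finset.sum_sub_distrib, ← Finset.mul_sum, ← Finset.mul_sum,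
    Finset.sum_sub_distrib, h1, h2, ← Fin.sum_univ_eq_sum_range (fun i =>
      M.influence P Ker b d fd (Z i s))]
  simp_rw [Population.influence_eq]
  rw [Finset.sum_sub_distrib, Finset.sum_sub_distrib, ← Finset.mul_sum, ← Finset.mul_sum,
    Finset.sum_sub_distrib]
  simp only [Finset.sum_const, Finset.card_univ, Fintype.card_fin, nsmul_eq_mul]
  push_cast
  field_simp

theorem measurable_estMean (hk : Population.KernelAssumption Ker) (hZ : ∀ i, Measurable (Z i))
    (η : NuisanceEstimator 𝒳 fold) (b d : ℝ) (n : ℕ) (k : Fin K) {l : S → ℝ}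
    (hl : Measurable l) : Measurable (fun s => estMean Ker Z fold η b d (l s) n k s) :=
  (Finset.measurable_sum _ fun i _ => measurable_rawSignal_comp hk (η.measurable_f n k)
    (η.measurable_g n k) (η.measurable_e n k)
    ((measurable_auxSample _ _).comp (measurable_firstObs hZ _)) (hZ i) hl).const_mul _

theorem measurable_fHat (hk : Population.KernelAssumption Ker) (hZ : ∀ i, Measurable (Z i))
    (b d : ℝ) (n : ℕ) (k : Fin K) :
    Measurable (fun s => fHat Ker b d (fold n) (firstObs Z (K * n) s) k) := by
  unfold fHat
  refine (Finset.measurable_sum _ fun i _ => ?_).const_mul _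
  exact (hk.measurable_rescale b).comp ((Obs.measurable_dose.comp (hZ i)).sub_const d)

theorem measurable_lamHat (hZ : ∀ i, Measurable (Z i)) (n : ℕ) (k : Fin K) :
    Measurable (fun s => lamHat (fold n) (firstObs Z (K * n) s) k) := by
  unfold lamHat
  refine (Finset.measurable_sum _ fun i _ => ?_).const_mul _
  exact Obs.measurable_t.comp (hZ i)

theorem measurable_attHat (hk : Population.KernelAssumption Ker) (hZ : ∀ i, Measurable (Z i))
    (η : NuisanceEstimator 𝒳 fold) (b d : ℝ) (n : ℕ) :
    Measurable (fun s => attHat Ker b d (fold n) (η.est n) (firstObs Z (K * n) s)) := by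
  simp_rw [attHat, attHatWith_eq]
  exact (Finset.measurable_sum _ fun k _ => (measurable_fHat hk hZ b d n k).inv.mul
    (measurable_estMean hk hZ η b d n k (measurable_lamHat hZ n k))).const_mul _

/-- A remainder of order `o_p((N h)^{-1/2})` is negligible relative to the standard error. -/
theorem small_div_se (hS : Sampling M P Q Ker h ε dL dH κ c C d fD fDX fYD μ Z fold η)
    {v : ℝ} (hv : 0 < v) (hnondeg : ∀ᶠ n in atTop, v ≤ h n * M.sigmaSq P Ker (h n) d (fD d))
    {X : ℕ → S → ℝ} (hX : SmallInProb μ (fun n s => rootNh K h n * X n s)) :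
    SmallInProb μ (fun n s =>
      X n s / (√(M.sigmaSq P Ker (h n) d (fD d)) / √((K * n : ℕ) : ℝ))) := by
  have h1 : SmallInProb μ (fun n s => (√v)⁻¹ * (rootNh K h n * X n s)) :=
    (boundedInProb_of_eventually_le (x := fun _ => (√v)⁻¹)
      (.of_forall fun _ => le_rfl)).mul_small hX
  refine h1.mono ?_
  filter_upwards [hnondeg] with n hn s
  have h0 := hS.rates.h_pos n
  have hsv : 0 < √v := Real.sqrt_pos.2 hv
  have h2 : √v ≤ √(h n) * √(M.sigmaSq P Ker (h n) d (fD d)) := by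
    rw [← Real.sqrt_mul h0.le]
    exact Real.sqrt_le_sqrt hn
  have hs : 0 < √(M.sigmaSq P Ker (h n) d (fD d)) :=
    pos_of_mul_pos_right (hsv.trans_le h2) (Real.sqrt_nonneg _)
  -- Nondegeneracy in the form 1/σ ≤ √h/√v, so that √N/σ is at most √(Nh)/√v.
  have h3 : (√(M.sigmaSq P Ker (h n) d (fD d)))⁻¹ ≤ (√v)⁻¹ * √(h n) := by
    rw [inv_le_iff_one_le_mul₀ hs, mul_assoc, inv_mul_eq_div, le_div_iff₀ hsv, one_mul]
    exact h2
  rw [div_div_eq_mul_div, abs_div, abs_mul, abs_mul, abs_mul, abs_of_pos hs,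
    abs_of_nonneg (Real.sqrt_nonneg _), abs_of_pos (inv_pos.2 hsv),
    abs_of_nonneg (rootNh_nonneg _ _ _), rootNh_eq, div_eq_mul_inv]
  calc _ ≤ |X n s| * √((K * n : ℕ) : ℝ) * ((√v)⁻¹ * √(h n)) := by gcongr
    _ = _ := by ring

variable [IsProbabilityMeasure μ]

/-- The standardized summands are at most (V/h)(√h/√v) = (V/√v)(Nh)^{-1/2} √N, which is the uniform
o(√N) bound required by the triangular-array theorem. -/
theorem influence_clt [IsMarkovKernel Q]
    (hS : Sampling M P Q Ker h ε dL dH κ c C d fD fDX fYD μ Z fold η) {v : ℝ} (hv : 0 < v)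
    (hnondeg : ∀ᶠ n in atTop, v ≤ h n * M.sigmaSq P Ker (h n) d (fD d)) :
    TendstoInDistribution (fun (n : ℕ) s => (√((K * n : ℕ) : ℝ))⁻¹
      * ∑ i ∈ Finset.range (K * n), (√(M.sigmaSq P Ker (h n) d (fD d)))⁻¹
        * M.influence P Ker (h n) d (fD d) (Z i s))
      atTop (id : ℝ → ℝ) (fun _ => μ) (gaussianReal 0 1) := by
  have := isProbabilityMeasure_law M P
  obtain ⟨V, hV0, hV⟩ := hS.pop.exists_abs_influence_le hS.mem
  have hm : ∀ n, Measurable (fun z => (√(M.sigmaSq P Ker (h n) d (fD d)))⁻¹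
      * M.influence P Ker (h n) d (fD d) z) := fun n =>
    (Population.measurable_influence hS.pop.kernel _ _ _).const_mul _
  have hσ : ∀ᶠ n in atTop, 0 < M.sigmaSq P Ker (h n) d (fD d) := by
    filter_upwards [hnondeg] with n hn
    exact pos_of_mul_pos_right (hv.trans_le hn) (hS.rates.h_pos n).le
  refine tendstoInDistribution_triangular hS.sample.measurable hS.sample.indep hS.sample.law
    hm (tendsto_id.const_mul_atTop' (by have := hS.two_le; lia))
    (b := fun n => V / √v * (rootNh K h n)⁻¹) ?_ ?_ ?_ ?_
  · simpa using hS.tendsto_rootNh.inv_tendsto_atTop.const_mul (V / √v)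
  · filter_upwards [hS.eventually_regular, hnondeg] with n hn hvn
    have h0 := hS.rates.h_pos n
    have hsv : 0 < √v := Real.sqrt_pos.2 hv
    have hsh : 0 < √(h n) := Real.sqrt_pos.2 h0
    have hN : 0 < √((K * n : ℕ) : ℝ) := Real.sqrt_pos.2 (by
      have := hS.two_le
      exact_mod_cast Nat.mul_pos (by lia) hn.1)
    refine (ae_map_iff M.measurable_obs.aemeasurable
      (measurableSet_le (continuous_abs.measurable.comp (hm n)) measurable_const)).2 ?_
    filter_upwards [hV (h n) h0 hn.2.1 hn.2.2] with ω hω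
    have h1 : √v ≤ √(h n) * √(M.sigmaSq P Ker (h n) d (fD d)) := by
      rw [← Real.sqrt_mul h0.le]
      exact Real.sqrt_le_sqrt hvn
    have hs : 0 < √(M.sigmaSq P Ker (h n) d (fD d)) :=
      pos_of_mul_pos_right (hsv.trans_le h1) hsh.le
    have h2 : (√(M.sigmaSq P Ker (h n) d (fD d)))⁻¹ ≤ √(h n) / √v := by
      rw [inv_le_iff_one_le_mul₀ hs, div_mul_eq_mul_div, le_div_iff₀ hsv, one_mul]
      exact h1
    rw [Function.comp_apply, abs_mul, abs_of_pos (inv_pos.2 hs), rootNh_eq]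
    calc _ ≤ √(h n) / √v * (V / h n) := by gcongr
      _ = √(h n) / √v * (V / √(h n) ^ 2) := by rw [Real.sq_sqrt h0.le]
      _ = _ := by field_simp
  · filter_upwards [hS.eventually_regular] with n hn
    rw [Population.integral_obs (hm n), integral_const_mul,
      hS.pop.integral_influence hS.mem (hS.rates.h_pos n) hn.2.1 hn.2.2, mul_zero]
  · filter_upwards [hσ] with n hn
    rw [Population.integral_obs ((hm n).pow_const 2)]
    simp_rw [mul_pow]
    rw [integral_const_mul, inv_pow, Real.sq_sqrt hn.le]
    exact inv_mul_cancel₀ hn.ne'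

theorem fHat_inv_bounded [IsMarkovKernel Q]
    (hS : Sampling M P Q Ker h ε dL dH κ c C d fD fDX fYD μ Z fold η) (k : Fin K) :
    BoundedInProb μ (fun n s => (fHat Ker (h n) d (fold n) (firstObs Z (K * n) s) k)⁻¹) := by
  have h1 := ((hS.fHat_consistent k).inv_sub (hS.pop.fD_pos hS.mem).ne').boundedInProb.add
    (boundedInProb_of_eventually_le (x := fun _ => (fD d)⁻¹) (.of_forall fun _ => le_rfl))
  exact h1.mono (.of_forall fun n s => by rw [sub_add_cancel])

/-- Replacing `λ` by its estimate changes the estimator by `o_p((N h)^{-1/2})`. -/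
theorem attHat_sub_attHatWith_small [IsMarkovKernel Q]
    (hS : Sampling M P Q Ker h ε dL dH κ c C d fD fDX fYD μ Z fold η) :
    SmallInProb μ (fun n s => rootNh K h n
      * (attHat Ker (h n) d (fold n) (η.est n) (firstObs Z (K * n) s)
        - attHatWith Ker (h n) d (fold n) (η.est n) (fun _ => M.lam P)
          (firstObs Z (K * n) s))) := by
  have h1 := (boundedInProb_of_eventually_le (μ := μ) (x := fun _ => (K : ℝ)⁻¹)
    (.of_forall fun _ => le_rfl)).mul_small (SmallInProb.sum Finset.univ fun k =>
      (hS.fHat_inv_bounded k).mul_small (hS.lam_effect k))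
  refine h1.mono (.of_forall fun n s => le_of_eq (congrArg abs ?_))
  rw [attHat, attHatWith_sub, mul_left_comm, Finset.mul_sum]
  simp_rw [mul_left_comm (rootNh K h n)]

/-- With S the oracle average, S - θ f̂ = (S - f_D θ) - θ(f̂ - f_D), and both parts have the rate
(Nh)^{-1/2}. Its product with the consistency error of 1/f̂ is the quadratic remainder of the
linearization. -/
theorem oracle_centered_bounded [IsMarkovKernel Q]
    (hS : Sampling M P Q Ker h ε dL dH κ c C d fD fDX fYD μ Z fold η) (k : Fin K) :
    BoundedInProb μ (fun n s => rootNh K h n * (oracleMean M P Ker Z fold (h n) d n k s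
      - M.ATTh P Ker (h n) d (fD d)
        * fHat Ker (h n) d (fold n) (firstObs Z (K * n) s) k)) := by
  obtain ⟨Θ, hΘ0, hΘ⟩ := hS.pop.exists_abs_ATTh_le hS.mem
  have h1 := (hS.oracle_rate k).add ((hS.fHat_rate k).const_mul
    (x := fun n => -M.ATTh P Ker (h n) d (fD d)) (B := Θ) (by
      filter_upwards [hS.eventually_regular] with n hn
      rw [abs_neg]
      exact hΘ (h n) (hS.rates.h_pos n) hn.2.1))
  refine h1.mono (.of_forall fun n s => le_of_eq (congrArg abs ?_))
  ring

/-- Asymptotic linearity of the estimator. -/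
theorem attHat_linear [IsMarkovKernel Q]
    (hS : Sampling M P Q Ker h ε dL dH κ c C d fD fDX fYD μ Z fold η) :
    SmallInProb μ (fun n s => rootNh K h n
      * (attHat Ker (h n) d (fold n) (η.est n) (firstObs Z (K * n) s) - M.ATT Q d
        - ((K * n : ℕ) : ℝ)⁻¹ * ∑ i ∈ Finset.range (K * n),
          M.influence P Ker (h n) d (fD d) (Z i s))) := by
  have hfd := hS.pop.fD_pos hS.mem
  obtain ⟨C₁, hC₁, h1⟩ := hS.pop.exists_ATTh_bound hS.mem
  obtain ⟨C₂, hC₂, h2⟩ := hS.pop.exists_mean_rescale_bound hS.mem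
  obtain ⟨Θ, hΘ0, hΘ⟩ := hS.pop.exists_abs_ATTh_le hS.mem
  -- the bias terms
  have hbias : Tendsto (fun n => rootNh K h n
      * ((M.ATTh P Ker (h n) d (fD d) - M.ATT Q d) + M.ATTh P Ker (h n) d (fD d)
        * (1 - (∫ ω, rescale Ker (h n) (M.D ω - d) ∂P) / fD d))) atTop (𝓝 0) := by
    have h3 := hS.tendsto_rootNh_mul_sq.const_mul (C₁ + Θ * (C₂ / fD d))
    rw [mul_zero] at h3
    refine squeeze_zero_norm' ?_ h3
    filter_upwards [hS.eventually_regular] with n hn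
    have h0 := hS.rates.h_pos n
    have h4 : |1 - (∫ ω, rescale Ker (h n) (M.D ω - d) ∂P) / fD d| ≤ C₂ / fD d * h n ^ 2 := by
      have : 1 - (∫ ω, rescale Ker (h n) (M.D ω - d) ∂P) / fD d
          = -((∫ ω, rescale Ker (h n) (M.D ω - d) ∂P) - fD d) / fD d := by
        field_simp
        ring
      rw [this, abs_div, abs_neg, abs_of_pos hfd, div_mul_eq_mul_div]
      gcongr
      exact h2 (h n) h0
    rw [Real.norm_eq_abs, abs_mul, abs_of_nonneg (rootNh_nonneg _ _ _)]
    calc _ ≤ rootNh K h n * (C₁ * h n ^ 2 + Θ * (C₂ / fD d * h n ^ 2)) := by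
          refine mul_le_mul_of_nonneg_left ((abs_add_le _ _).trans (add_le_add (h1 _ h0) ?_))
            (rootNh_nonneg _ _ _)
          rw [abs_mul]
          exact mul_le_mul (hΘ _ h0 hn.2.1) h4 (abs_nonneg _) hΘ0.le
      _ = _ := by ring
  -- the stochastic terms
  have hsum := (boundedInProb_of_eventually_le (μ := μ) (x := fun _ => (K : ℝ)⁻¹)
    (.of_forall fun _ => le_rfl)).mul_small (SmallInProb.sum Finset.univ fun k =>
      ((hS.oracle_centered_bounded k).mul_small
        ((hS.fHat_consistent k).inv_sub hfd.ne')).add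
      ((hS.fHat_inv_bounded k).mul_small ((hS.nuisance_effect k).add (hS.lam_effect k))))
  -- the event that a density estimate vanishes
  have hbad : Tendsto (fun n => μ (⋃ k, {s | fD d
      ≤ |fHat Ker (h n) d (fold n) (firstObs Z (K * n) s) k - fD d|})) atTop (𝓝 0) := by
    have h3 := tendsto_finsetSum Finset.univ fun k _ => hS.fHat_consistent k (fD d) hfd
    rw [Finset.sum_const_zero] at h3
    exact tendsto_of_tendsto_of_tendsto_of_le_of_le tendsto_const_nhds h3 (fun _ => zero_le)
      fun n => measure_iUnion_fintype_le _ _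
  refine ((smallInProb_of_tendsto hbias).add hsum).of_eventually_bad hbad ?_
  filter_upwards [eventually_ge_atTop 1] with n hn s hs
  refine le_of_eq (congrArg abs ?_)
  -- A vanishing f̂ would be at distance f_D(d) from f_D(d), which the excluded event covers.
  -- Cancelling f̂ is needed for the exact identity below.
  have hne : ∀ k, fHat Ker (h n) d (fold n) (firstObs Z (K * n) s) k ≠ 0 := by
    intro k hk
    refine hs (mem_iUnion.2 ⟨k, ?_⟩)
    rw [mem_ofPred_eq, hk, zero_sub, abs_neg]
    exact le_abs_self _
  -- The rest is an exact identity. In each fold, with S the oracle average, R the nuisance and λ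
  -- errors and m = E K_h, (S + R)/f̂ - ATT minus the influence term is (S - θ f̂)(1/f̂ - 1/f) +
  -- R/f̂ + (θ - ATT) + θ(1 - m/f). The last term appears because the influence function is centred
  -- at m and not at f.
  rw [hS.mean_influence_eq hn, attHat, attHatWith_eq]
  have hK := hS.cast_K_pos
  set f := fD d
  set θ := M.ATTh P Ker (h n) d f
  set m := ∫ ω, rescale Ker (h n) (M.D ω - d) ∂P
  have hconst : ∀ a : ℝ, a = (K : ℝ)⁻¹ * ∑ _k : Fin K, a := fun a => by
    rw [Finset.sum_const, Finset.card_univ, Fintype.card_fin, nsmul_eq_mul,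
      inv_mul_cancel_left₀ hK.ne']
  rw [hconst (M.ATT Q d), hconst (rootNh K h n * (θ - _ + θ * (1 - m / f))), ← mul_sub, ← mul_sub,
    mul_left_comm, ← mul_add, ← Finset.sum_sub_distrib, ← Finset.sum_sub_distrib,
    ← Finset.sum_add_distrib, Finset.mul_sum, ← hconst]
  congr 1
  refine Finset.sum_congr rfl fun k _ => ?_
  have := hne k
  field_simp
  ring

/-- Slutsky's theorem: by asymptotic linearity and nondegeneracy the standardized estimator and the
standardized influence mean differ by o_p(1). -/
theorem attHat_clt [IsMarkovKernel Q]
    (hS : Sampling M P Q Ker h ε dL dH κ c C d fD fDX fYD μ Z fold η) {v : ℝ} (hv : 0 < v)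
    (hnondeg : ∀ᶠ n in atTop, v ≤ h n * M.sigmaSq P Ker (h n) d (fD d)) :
    TendstoInDistribution (fun (n : ℕ) (s : S) =>
        (attHat Ker (h n) d (fold n) (η.est n) (firstObs Z (K * n) s) - M.ATT Q d)
          / (√(M.sigmaSq P Ker (h n) d (fD d)) / √((K * n : ℕ) : ℝ)))
      atTop (id : ℝ → ℝ) (fun _ => μ) (gaussianReal 0 1) := by
  refine tendstoInDistribution_of_tendstoInMeasure_sub _ _ (hS.influence_clt hv hnondeg) ?_
    fun n => (((measurable_attHat hS.pop.kernel hS.sample.measurable η (h n) d n).sub_const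
      _).div_const _).aemeasurable
  refine SmallInProb.tendstoInMeasure ((hS.small_div_se hv hnondeg hS.attHat_linear).mono
    (.of_forall fun n s => le_of_eq (congrArg abs ?_)))
  rw [Pi.sub_apply, Pi.sub_apply, sub_div _ (_ * _), ← Finset.mul_sum]
  congr 1
  -- Matches the two normalizations through √N/N = 1/√N, an identity that also holds at N = 0.
  rw [div_div_eq_mul_div, mul_right_comm, ← div_eq_inv_mul (√_) , Real.sqrt_div_self']
  rw [div_eq_mul_inv, one_div]
  ring

end Sampling

end CDiD

end

theorem mainTheorem7 {Ω 𝒳 S : Type*} [MeasurableSpace Ω] [MeasurableSpace 𝒳]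
    [MeasurableSpace S]
    -- population, conditional probabilities given the dose, densities
    (P : Measure Ω) [IsProbabilityMeasure P] (M : CDiD.Population Ω 𝒳)
    (Q : Kernel ℝ Ω) [IsMarkovKernel Q]
    (dL dH κ c C : ℝ) (fD : ℝ → ℝ) (fDX : 𝒳 → ℝ → ℝ) (fYD : ℝ → ℝ → ℝ)
    -- sample, folds, kernel, bandwidth, nuisance estimators
    (μ : Measure S) [IsProbabilityMeasure μ] (Z : ℕ → S → CDiD.Obs 𝒳)
    (K : ℕ) (hK : 2 ≤ K) (fold : ∀ n : ℕ, Fin (K * n) → Fin K)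
    (Ker : ℝ → ℝ) (h ε : ℕ → ℝ) (η : CDiD.NuisanceEstimator 𝒳 fold)
    (d : ℝ) (hd : d ∈ Ioo dL dH)
    -- assumptions
    (hQ : M.IsCondProbGivenDose P Q dL dH) (hversion : M.ContinuousVersion Q dL dH)
    (hdens : M.HasDensities P dL dH fD fDX fYD)
    (hrcs : M.RepeatedCrossSections P) (hsample : CDiD.IsIIDSample M P μ Z)
    (hfold : CDiD.IsEqualPartition fold)
    (hsupp : M.Support P dL dH κ fDX) (hant : M.NoAnticipation)
    (hpt : M.ParallelTrends Q dL dH) (hker : CDiD.Population.KernelAssumption Ker)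
    (hbound : M.BoundsSmoothness P Ker h dL dH c C fD fDX fYD)
    (hrates : CDiD.Rates M P μ Z Ker d κ c C fold η h ε)
    (hε : ε =o[atTop] fun n : ℕ => ((K * n : ℕ) : ℝ) ^ (-(1 / 4) : ℝ))
    -- nondegeneracy: the asymptotic variance is at least of order `1 / h`
    (hnondeg : ∃ v > 0, ∀ᶠ n in atTop, v ≤ h n * M.sigmaSq P Ker (h n) d (fD d)) :
    -- asymptotic normality
    TendstoInDistribution
      (fun (n : ℕ) (s : S) =>
        (CDiD.attHat Ker (h n) d (fold n) (η.est n) (CDiD.firstObs Z (K * n) s) - M.ATT Q d)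
          / (√(M.sigmaSq P Ker (h n) d (fD d)) / √((K * n : ℕ) : ℝ)))
      atTop (id : ℝ → ℝ) (fun _ => μ) (gaussianReal 0 1) ∧
    -- `λ` is estimated at the parametric rate
    (∀ k : Fin K, ∀ δ : ℝ, 0 < δ → ∃ B : ℝ, ∀ᶠ n : ℕ in atTop,
      μ {s | B < √((K * n : ℕ) : ℝ) *
        |CDiD.lamHat (fold n) (CDiD.firstObs Z (K * n) s) k - M.lam P|} ≤ ENNReal.ofReal δ) ∧
    -- replacing the true `λ` by its estimates has a negligible effect
    TendstoInMeasure μ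
      (fun (n : ℕ) (s : S) =>
        (CDiD.attHat Ker (h n) d (fold n) (η.est n) (CDiD.firstObs Z (K * n) s)
          - CDiD.attHatWith Ker (h n) d (fold n) (η.est n) (fun _ => M.lam P)
              (CDiD.firstObs Z (K * n) s))
          / (√(M.sigmaSq P Ker (h n) d (fD d)) / √((K * n : ℕ) : ℝ)))
      atTop (fun _ => 0) := by
  have hS : CDiD.Sampling M P Q Ker h ε dL dH κ c C d fD fDX fYD μ Z fold η :=
    { pop := ⟨hQ, hversion, hdens, hrcs, hsupp, hant, hpt, hker, hbound⟩
      mem := hd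
      two_le := hK
      sample := hsample
      partition := hfold
      rates := hrates
      fast := hε }
  obtain ⟨v, hv, hvn⟩ := hnondeg
  refine ⟨hS.attHat_clt hv hvn, fun k δ hδ => ?_,
    (hS.small_div_se hv hvn hS.attHat_sub_attHatWith_small).tendstoInMeasure⟩
  obtain ⟨B, hB⟩ := hS.lamHat_rate k δ hδ
  refine ⟨B, hB.mono fun n hn => ?_⟩
  simpa only [abs_mul, abs_of_nonneg (Real.sqrt_nonneg _)] using hn
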